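/- Let $\bar A=(A_0,A_1)$ be a compatible couple of quasi-Banach spaces (both continuously embedded in a common Hausdorff topological vector space) with $A_0\cap A_1\neq\{0\}$, and let $K(t,f)=K(t,f;A_0,A_1)=\inf\{\|f_0\|_{A_0}+t\|f_1\|_{A_1}: f=f_0+f_1,\ f_i\in A_i\}$. Write $\|\cdot\|_{q,(\alpha,\beta)}$ for the (quasi-)norm of $L_q(\alpha,\beta)$, $0<q\le\infty$, $1/\infty=0$. A positive Lebesgue measurable function $b$ on $(0,\infty)$ is slowly varying ($b\in SV$) if for every $\varepsilon>0$ the function $t^{\varepsilon}b(t)$ is equivalent (up to positive multiplicative constants) to a non-decreasing function and $t^{-\varepsilon}b(t)$ to a non-increasing function. For $0\le\theta\le1$, $0<s,r,q\le\infty$ and $a,b,c\in SV$ the following spaces consist of all $f\in A_0+A_1$ for which the indicated quasi-norm is finite: - $\bar A_{\theta,q;b}=(A_0,A_1)_{\theta,q;b}$: $\ \|u^{-\theta-1/q}b(u)K(u,f)\|_{q,(0,\infty)}$; - $\bar A^{\mathcal L}_{\theta,r,b,q,a}$: $\ \big\|t^{-1/r}b(t)\|u^{-\theta-1/q}a(u)K(u,f)\|_{q,(0,t)}\big\|_{r,(0,\infty)}$;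 - $\bar A^{\mathcal R}_{\theta,r,b,q,a}$: $\ \big\|t^{-1/r}b(t)\|u^{-\theta-1/q}a(u)K(u,f)\|_{q,(t,\infty)}\big\|_{r,(0,\infty)}$; - $\bar A^{\mathcal L,\mathcal R}_{\theta,s,c,r,b,q,a}$: $\ \Big\|t^{-1/s}c(t)\big\|u^{-1/r}b(u)\|v^{-\theta-1/q}a(v)K(v,f)\|_{q,(t,u)}\big\|_{r,(t,\infty)}\Big\|_{s,(0,\infty)}$; - $\bar A^{\mathcal R,\mathcal L}_{\theta,s,c,r,b,q,a}$: $\ \Big\|t^{-1/s}c(t)\big\|u^{-1/r}b(u)\|v^{-\theta-1/q}a(v)K(v,f)\|_{q,(u,t)}\big\|_{r,(0,t)}\Big\|_{s,(0,\infty)}$. Equality of spaces means equality as sets with equivalent quasi-norms; an intersection carries the maximum of the two quasi-norms. **Theorem.** Let $0<r,r_0,q_0,r_1,q_1\le\infty$ and $a,a_0,b_0,a_1,b_1\in SV$ be such that $$\|s^{-1/r_0}b_0(s)\|_{r_0,(0,1)}<\infty,\qquad \big\|s^{-1/r_0}b_0(s)\|u^{-1/q_0}a_0(u)\|_{q_0,(s,\infty)}\big\|_{r_0,(1,\infty)}<\infty,$$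 $$\|s^{-1/r_1}b_1(s)\|_{r_1,(1,\infty)}<\infty,\qquad \big\|s^{-1/r_1}b_1(s)\|u^{-1/q_1}a_1(u)\|_{q_1,(0,s)}\big\|_{r_1,(0,1)}<\infty.$$ For $t>0$ put $$\chi_0(t)=\big\|s^{-1/r_0}b_0(s)\|u^{-1/q_0}a_0(u)\|_{q_0,(s,\infty)}\big\|_{r_0,(t,\infty)}+\|s^{-1/r_0}b_0(s)\|_{r_0,(0,t)}\,\|u^{-1/q_0}a_0(u)\|_{q_0,(t,\infty)},$$ $$\chi_1(t)=\big\|s^{-1/r_1}b_1(s)\|u^{-1/q_1}a_1(u)\|_{q_1,(0,s)}\big\|_{r_1,(0,t)}+\|s^{-1/r_1}b_1(s)\|_{r_1,(t,\infty)}\,\|u^{-1/q_1}a_1(u)\|_{q_1,(0,t)},$$ $\rho(t)=t\,\chi_0(t)/\chi_1(t)$ and, for $0\le\theta\le1$, $a^\#=\chi_0^{1-\theta}\chi_1^{\theta}\,(a\circ\rho)$. (i) If $0<\theta<1$, then $\big(\bar A^{\mathcal R}_{0,r_0,b_0,q_0,a_0},\bar A^{\mathcal L}_{1,r_1,b_1,q_1,a_1}\big)_{\theta,r;a}=\bar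 A_{\theta,r;a^\#}$. (ii) If $\|s^{-1/r}a(s)\|_{r,(1,\infty)}<\infty$, then $\big(\bar A^{\mathcal R}_{0,r_0,b_0,q_0,a_0},\bar A^{\mathcal L}_{1,r_1,b_1,q_1,a_1}\big)_{0,r;a}=\bar A_{0,r;a^\#}\cap\bar A^{\mathcal R,\mathcal L}_{0,r,a\circ\rho,r_0,b_0,q_0,a_0}$. (iii) If $\|s^{-1/r}a(s)\|_{r,(0,1)}<\infty$, then $\big(\bar A^{\mathcal R}_{0,r_0,b_0,q_0,a_0},\bar A^{\mathcal L}_{1,r_1,b_1,q_1,a_1}\big)_{1,r;a}=\bar A_{1,r;a^\#}\cap\bar A^{\mathcal L,\mathcal R}_{1,r,a\circ\rho,r_1,b_1,q_1,a_1}$. -/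

import Mathlib

open scoped ENNReal NNReal Topology

namespace RealInterp

open MeasureTheory Set Filter

noncomputable section

/-! ### Quasi-Banach spaces and compatible couples

A quasi-normed space sitting inside a vector space `E` is described by its extended quasi-norm
`N : E → [0,∞]`; the space itself is the set of all `f` with `N f < ∞`. -/

/-- `N` is the extended quasi-norm of a quasi-Banach space over `𝕜` which is a linear subspace of
the topological vector space `E`, with continuous inclusion into `E`. -/
structure IsQuasiBanachIn (𝕜 : Type*) {E : Type*} [RCLike 𝕜] [AddCommGroup E] [Module 𝕜 E]
    [TopologicalSpace E] (N : E → ℝ≥0∞) : Prop where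
  eq_zero_iff : ∀ f : E, N f = 0 ↔ f = 0
  smul : ∀ (c : 𝕜) (f : E), N (c • f) = ‖c‖ₑ * N f
  add_le : ∃ C : ℝ≥0, ∀ f g : E, N (f + g) ≤ C * (N f + N g)
  complete : ∀ u : ℕ → E, (∀ n, N (u n) < ∞) →
    (∀ ε : ℝ≥0∞, 0 < ε → ∃ n₀ : ℕ, ∀ m ≥ n₀, ∀ n ≥ n₀, N (u m - u n) < ε) →
    ∃ f : E, N f < ∞ ∧ Tendsto (fun n => N (u n - f)) atTop (𝓝 0)
  continuous_incl : ∀ U ∈ 𝓝 (0 : E), ∃ δ : ℝ≥0∞, 0 < δ ∧ ∀ f : E, N f < δ → f ∈ U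

/-- A compatible couple of quasi-Banach spaces with nontrivial intersection: both spaces are
continuously embedded in the same Hausdorff topological vector space `E`. -/
structure IsCompatibleCouple (𝕜 : Type*) {E : Type*} [RCLike 𝕜] [AddCommGroup E] [Module 𝕜 E]
    [TopologicalSpace E] [IsTopologicalAddGroup E] [ContinuousSMul 𝕜 E] [T2Space E]
    (A₀ A₁ : E → ℝ≥0∞) : Prop where
  left : IsQuasiBanachIn 𝕜 A₀
  right : IsQuasiBanachIn 𝕜 A₁
  inter_nontrivial : ∃ f : E, f ≠ 0 ∧ A₀ f < ∞ ∧ A₁ f < ∞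

section Spaces

variable {E : Type*}

/-- `X ⊂ Y`: continuous embedding. -/
def Embedded (X Y : E → ℝ≥0∞) : Prop :=
  ∃ C : ℝ≥0, ∀ f : E, X f < ∞ → Y f ≤ C * X f

/-- `X = Y`: the same elements and equivalent quasi-norms. -/
def SpaceEq (X Y : E → ℝ≥0∞) : Prop :=
  Embedded X Y ∧ Embedded Y X

/-- The intersection `X ∩ Y` with quasi-norm `max (‖f‖_X) (‖f‖_Y)`. -/
def interSpace (X Y : E → ℝ≥0∞) : E → ℝ≥0∞ :=
  fun f => max (X f) (Y f)

/-- Peetre's functional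
`K(t, f) = inf {‖f₀‖_{A₀} + t ‖f₁‖_{A₁} : f = f₀ + f₁}`, for `t > 0`.
Decompositions with `fᵢ ∉ Aᵢ` contribute `∞`, so `K(t, f) < ∞` exactly when `f ∈ A₀ + A₁`. -/
def peetreK [Add E] (A₀ A₁ : E → ℝ≥0∞) (t : ℝ) (f : E) : ℝ≥0∞ :=
  ⨅ (f₀ : E) (f₁ : E) (_ : f₀ + f₁ = f), A₀ f₀ + ENNReal.ofReal t * A₁ f₁

end Spaces

/-! ### Slowly varying functions -/

/-- Equivalence `f ≈ g` of functions on `(0,∞)`. -/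
def EquivFun (f g : ℝ → ℝ) : Prop :=
  ∃ C : ℝ, 0 < C ∧ ∀ t : ℝ, 0 < t → f t ≤ C * g t ∧ g t ≤ C * f t

/-- `b ∈ SV`: slowly varying functions on `(0,∞)`. -/
structure SV (b : ℝ → ℝ) : Prop where
  pos : ∀ t : ℝ, 0 < t → 0 < b t
  measurable : AEMeasurable b (volume.restrict (Ioi 0))
  equiv_increasing : ∀ ε : ℝ, 0 < ε →
    ∃ g : ℝ → ℝ, MonotoneOn g (Ioi 0) ∧ EquivFun (fun t => t ^ ε * b t) g
  equiv_decreasing : ∀ ε : ℝ, 0 < ε →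
    ∃ g : ℝ → ℝ, AntitoneOn g (Ioi 0) ∧ EquivFun (fun t => t ^ (-ε) * b t) g

/-! ### Weighted Lebesgue quasi-norms and interpolation spaces -/

/-- `‖u^{α-1/q} b(u) g(u)‖_{q,I}`, the `L_q` quasi-norm with respect to Lebesgue measure on
`I ⊆ (0,∞)`, for `0 < q ≤ ∞` (with `1/∞ = 0`). -/
def wnorm (α : ℝ) (q : ℝ≥0∞) (b : ℝ → ℝ) (I : Set ℝ) (g : ℝ → ℝ≥0∞) : ℝ≥0∞ :=
  eLpNorm (fun u => ENNReal.ofReal (u ^ (α - (1 / q).toReal) * b u) * g u) q (volume.restrict I)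

section Interp

variable {E : Type*} [Add E]

/-- The standard space `(A₀, A₁)_{θ,q;b}`:
`‖u^{-θ-1/q} b(u) K(u,f)‖_{q,(0,∞)}`. -/
def stdSpace (A₀ A₁ : E → ℝ≥0∞) (θ : ℝ) (q : ℝ≥0∞) (b : ℝ → ℝ) : E → ℝ≥0∞ :=
  fun f => wnorm (-θ) q b (Ioi 0) fun u => peetreK A₀ A₁ u f

/-- The space `(A₀, A₁)^L_{θ,r,b,q,a}`:
`‖t^{-1/r} b(t) ‖u^{-θ-1/q} a(u) K(u,f)‖_{q,(0,t)}‖_{r,(0,∞)}`. -/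
def spaceL (A₀ A₁ : E → ℝ≥0∞) (θ : ℝ) (r : ℝ≥0∞) (b : ℝ → ℝ) (q : ℝ≥0∞) (a : ℝ → ℝ) :
    E → ℝ≥0∞ :=
  fun f => wnorm 0 r b (Ioi 0) fun t =>
    wnorm (-θ) q a (Ioo 0 t) fun u => peetreK A₀ A₁ u f

/-- The space `(A₀, A₁)^R_{θ,r,b,q,a}`:
`‖t^{-1/r} b(t) ‖u^{-θ-1/q} a(u) K(u,f)‖_{q,(t,∞)}‖_{r,(0,∞)}`. -/
def spaceR (A₀ A₁ : E → ℝ≥0∞) (θ : ℝ) (r : ℝ≥0∞) (b : ℝ → ℝ) (q : ℝ≥0∞) (a : ℝ → ℝ) :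
    E → ℝ≥0∞ :=
  fun f => wnorm 0 r b (Ioi 0) fun t =>
    wnorm (-θ) q a (Ioi t) fun u => peetreK A₀ A₁ u f

/-- The space `(A₀, A₁)^{L,R}_{θ,s,c,r,b,q,a}`:
`‖t^{-1/s} c(t) ‖u^{-1/r} b(u) ‖v^{-θ-1/q} a(v) K(v,f)‖_{q,(t,u)}‖_{r,(t,∞)}‖_{s,(0,∞)}`. -/
def spaceLR (A₀ A₁ : E → ℝ≥0∞) (θ : ℝ) (s : ℝ≥0∞) (c : ℝ → ℝ) (r : ℝ≥0∞) (b : ℝ → ℝ)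
    (q : ℝ≥0∞) (a : ℝ → ℝ) : E → ℝ≥0∞ :=
  fun f => wnorm 0 s c (Ioi 0) fun t => wnorm 0 r b (Ioi t) fun u =>
    wnorm (-θ) q a (Ioo t u) fun v => peetreK A₀ A₁ v f

/-- The space `(A₀, A₁)^{R,L}_{θ,s,c,r,b,q,a}`:
`‖t^{-1/s} c(t) ‖u^{-1/r} b(u) ‖v^{-θ-1/q} a(v) K(v,f)‖_{q,(u,t)}‖_{r,(0,t)}‖_{s,(0,∞)}`. -/
def spaceRL (A₀ A₁ : E → ℝ≥0∞) (θ : ℝ) (s : ℝ≥0∞) (c : ℝ → ℝ) (r : ℝ≥0∞) (b : ℝ → ℝ)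
    (q : ℝ≥0∞) (a : ℝ → ℝ) : E → ℝ≥0∞ :=
  fun f => wnorm 0 s c (Ioi 0) fun t => wnorm 0 r b (Ioo 0 t) fun u =>
    wnorm (-θ) q a (Ioo u t) fun v => peetreK A₀ A₁ v f

end Interp

/-! ### The weights of the reiteration formula -/

/-- `χ₀(t) = ‖s^{-1/r₀} b₀(s) ‖u^{-1/q₀} a₀(u)‖_{q₀,(s,∞)}‖_{r₀,(t,∞)}
+ ‖s^{-1/r₀} b₀(s)‖_{r₀,(0,t)} ‖u^{-1/q₀} a₀(u)‖_{q₀,(t,∞)}`. -/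
def chiR (r₀ : ℝ≥0∞) (b₀ : ℝ → ℝ) (q₀ : ℝ≥0∞) (a₀ : ℝ → ℝ) (t : ℝ) : ℝ :=
  (wnorm 0 r₀ b₀ (Ioi t) (fun s => wnorm 0 q₀ a₀ (Ioi s) fun _ => 1)
    + wnorm 0 r₀ b₀ (Ioo 0 t) (fun _ => 1) * wnorm 0 q₀ a₀ (Ioi t) (fun _ => 1)).toReal

/-- `χ₁(t) = ‖s^{-1/r₁} b₁(s) ‖u^{-1/q₁} a₁(u)‖_{q₁,(0,s)}‖_{r₁,(0,t)}
+ ‖s^{-1/r₁} b₁(s)‖_{r₁,(t,∞)} ‖u^{-1/q₁} a₁(u)‖_{q₁,(0,t)}`. -/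
def chiL (r₁ : ℝ≥0∞) (b₁ : ℝ → ℝ) (q₁ : ℝ≥0∞) (a₁ : ℝ → ℝ) (t : ℝ) : ℝ :=
  (wnorm 0 r₁ b₁ (Ioo 0 t) (fun s => wnorm 0 q₁ a₁ (Ioo 0 s) fun _ => 1)
    + wnorm 0 r₁ b₁ (Ioi t) (fun _ => 1) * wnorm 0 q₁ a₁ (Ioo 0 t) (fun _ => 1)).toReal

/-- `ρ(t) = t χ₀(t) / χ₁(t)`. -/
def rho (χ₀ χ₁ : ℝ → ℝ) (t : ℝ) : ℝ := t * χ₀ t / χ₁ t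

/-- `a^#(t) = χ₀(t)^{1-θ} χ₁(t)^θ a(ρ(t))`. -/
def aSharp (χ₀ χ₁ a : ℝ → ℝ) (θ : ℝ) (t : ℝ) : ℝ :=
  χ₀ t ^ (1 - θ) * χ₁ t ^ θ * a (rho χ₀ χ₁ t)

end

end RealInterp

namespace RealInterp

open MeasureTheory Set Filter

/-! ### The measure `du/u` on `(0,∞)` -/

/-! The heart of the matter is a Holmstedt formula for the outer couple (X₀, X₁). Up to constants,
K(ρ(t), f; X₀, X₁) is a sum of three terms: the part of the X₀-norm of K(·, f; A₀, A₁) living on s <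
u < t, the middle term χ₀(t) K(t, f; A₀, A₁), and ρ(t) times the part of the X₁-norm living on the
other side of t (`holmstedt`). For the upper bound, a decomposition f = f₀ + f₁ in (A₀, A₁) at
parameter t also serves for (X₀, X₁): beyond t one uses K(u, f₀) ≤ ‖f₀‖, below t one writes f₀ = f -
f₁ and uses K(u, f₁) ≤ u‖f₁‖ (`RParams.normR_peetreK_le`). For the lower bound, the norm of g₁ in X₁
forces K(u, g₁) ≤ 2 ‖g₁‖ u/χ₁(u), a function of index 1 whose R-part up to t is governed by its
value at t (`RParams.part_le_normR_add`).

Only R-spaces have to be treated. With respect to du/u, the substitution u ↦ 1/u together with K(u,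
f; A₀, A₁) = u K(1/u, f; A₁, A₀) turns the L-space at θ = 1 into an R-space at θ = 0 for the
reversed couple (`lnorm_inv`, `peetreK_swap`).

The weights χ₀ and χ₁ vary slowly, so ρ has index 1, and τ = ρ(t) may be substituted in the norm of
the left-hand space although ρ need be neither monotone nor continuous (`exists_lnorm_comp_equiv`).
With W = ρ^{-θ}(a ∘ ρ) this gives three norms (`reiteration`). The middle one is the norm with
weight a^# (`stdSpace_aSharp_eq`). By a Hardy inequality it absorbs the first norm when θ > 0 and
the third when θ < 1 (`RParams.lnorm_partR_le`). At θ = 0 the first norm survives as the R,L-space,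
at θ = 1 the third survives as the L,R-space. -/

/-- The measure `du/u` on `(0,∞)`, as a measure on `ℝ`. -/
noncomputable def logMeasure : Measure ℝ := (volume : Measure ℝ).map Real.exp

instance : SFinite logMeasure := by unfold logMeasure; infer_instance

theorem measurableEmbedding_exp : MeasurableEmbedding Real.exp :=
  Real.continuous_exp.measurableEmbedding Real.exp_injective

theorem logMeasure_eq_withDensity :
    logMeasure = (volume.restrict (Ioi 0)).withDensity fun u => ENNReal.ofReal u⁻¹ := by
  ext s hs
  have h := lintegral_image_eq_lintegral_abs_deriv_mul (s := univ) (f := Real.exp)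
    (f' := Real.exp) MeasurableSet.univ (fun x _ => (Real.hasDerivAt_exp x).hasDerivWithinAt)
    Real.exp_injective.injOn (fun u => ENNReal.ofReal u⁻¹ * s.indicator 1 u)
  rw [image_univ, Real.range_exp, Measure.restrict_univ] at h
  rw [withDensity_apply _ hs, ← lintegral_indicator hs]
  have h2 : ∀ u : ℝ, s.indicator (fun u => ENNReal.ofReal u⁻¹) u
      = ENNReal.ofReal u⁻¹ * s.indicator 1 u := by
    intro u; by_cases hu : u ∈ s <;> simp [hu]
  simp_rw [h2, h]
  rw [← lintegral_indicator_one hs, logMeasure, measurableEmbedding_exp.lintegral_map]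
  refine lintegral_congr fun x => ?_
  rw [← mul_assoc, abs_of_pos (Real.exp_pos x), ← ENNReal.ofReal_mul (Real.exp_pos x).le,
    mul_inv_cancel₀ (Real.exp_pos x).ne', ENNReal.ofReal_one, one_mul]

theorem logMeasure_Ioo {s t : ℝ} (hs : 0 < s) (ht : 0 < t) :
    logMeasure (Ioo s t) = ENNReal.ofReal (Real.log (t / s)) := by
  rw [logMeasure, Measure.map_apply Real.measurable_exp measurableSet_Ioo]
  have : Real.exp ⁻¹' Ioo s t = Ioo (Real.log s) (Real.log t) := by
    ext x
    simp [Real.lt_log_iff_exp_lt ht, Real.log_lt_iff_lt_exp hs]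
  rw [this, Real.volume_Ioo, Real.log_div ht.ne' hs.ne']

instance : NullSingletonClass logMeasure := by
  rw [logMeasure_eq_withDensity]; infer_instance

theorem restrict_logMeasure_Ioi : logMeasure.restrict (Ioi 0) = logMeasure := by
  rw [logMeasure_eq_withDensity, restrict_withDensity measurableSet_Ioi,
    Measure.restrict_restrict measurableSet_Ioi, inter_self]

theorem ae_logMeasure_pos : ∀ᵐ u ∂logMeasure, 0 < u := by
  rw [← restrict_logMeasure_Ioi]
  exact ae_restrict_mem measurableSet_Ioi

theorem map_inv_logMeasure : logMeasure.map (fun u : ℝ => u⁻¹) = logMeasure := by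
  have h : (volume : Measure ℝ).map (fun x => -x) = volume := Measure.map_neg_eq_self _
  conv_rhs => rw [logMeasure, ← h]
  rw [logMeasure, Measure.map_map measurable_inv Real.measurable_exp,
    Measure.map_map Real.measurable_exp measurable_neg]
  congr 1; ext x; simp [Real.exp_neg]

/-! ### Weighted norms with respect to `du/u` -/

/-- `‖w g‖_{q,I}` with respect to `du/u`. -/
noncomputable def lnorm (q : ℝ≥0∞) (I : Set ℝ) (w : ℝ → ℝ) (g : ℝ → ℝ≥0∞) : ℝ≥0∞ :=
  eLpNorm (fun u => ENNReal.ofReal (w u) * g u) q (logMeasure.restrict I)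

theorem lnorm_eq_lintegral {q : ℝ≥0∞} (hq : q ≠ 0) (hq' : q ≠ ∞) (I : Set ℝ) (w : ℝ → ℝ)
    (g : ℝ → ℝ≥0∞) : lnorm q I w g
      = (∫⁻ u in I, (ENNReal.ofReal (w u) * g u) ^ q.toReal ∂logMeasure) ^ (1 / q.toReal) := by
  simp [lnorm, eLpNorm_eq_lintegral_rpow_enorm_toReal hq hq']

theorem lnorm_top (I : Set ℝ) (w : ℝ → ℝ) (g : ℝ → ℝ≥0∞) : lnorm ∞ I w g
      = essSup (fun u => ENNReal.ofReal (w u) * g u) (logMeasure.restrict I) := by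
  simp [lnorm, eLpNormEssSup]

theorem lnorm_mono {q : ℝ≥0∞} {I : Set ℝ} (hI : MeasurableSet I) {w w' : ℝ → ℝ}
    {g g' : ℝ → ℝ≥0∞}
    (h : ∀ u ∈ I, ENNReal.ofReal (w u) * g u ≤ ENNReal.ofReal (w' u) * g' u) :
    lnorm q I w g ≤ lnorm q I w' g' := by
  refine eLpNorm_mono_enorm_ae ?_
  filter_upwards [ae_restrict_mem hI] with u hu using by simpa using h u hu

theorem lnorm_congr {q : ℝ≥0∞} {I : Set ℝ} (hI : MeasurableSet I) {w w' : ℝ → ℝ}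
    {g g' : ℝ → ℝ≥0∞}
    (h : ∀ u ∈ I, ENNReal.ofReal (w u) * g u = ENNReal.ofReal (w' u) * g' u) :
    lnorm q I w g = lnorm q I w' g' :=
  le_antisymm (lnorm_mono hI fun u hu => (h u hu).le) (lnorm_mono hI fun u hu => (h u hu).ge)

theorem lnorm_mono_right {q : ℝ≥0∞} {I : Set ℝ} (hI : MeasurableSet I) (w : ℝ → ℝ)
    {g g' : ℝ → ℝ≥0∞} (h : ∀ u ∈ I, g u ≤ g' u) : lnorm q I w g ≤ lnorm q I w g' :=
  lnorm_mono hI fun u hu => by gcongr; exact h u hu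

theorem lnorm_mono_set (q : ℝ≥0∞) {I J : Set ℝ} (h : I ⊆ J) (w : ℝ → ℝ) (g : ℝ → ℝ≥0∞) :
    lnorm q I w g ≤ lnorm q J w g :=
  eLpNorm_mono_measure _ (Measure.restrict_mono h le_rfl)

/-- Finiteness of the constant takes the place of measurability of `g`. This matters because slowly
varying weights enter the norms without a measurability assumption. -/
theorem eLpNorm_const_mul_ennreal {α : Type*} [MeasurableSpace α] {μ : Measure α} {q : ℝ≥0∞}
    {c : ℝ≥0∞} (hc : c ≠ ∞) (g : α → ℝ≥0∞) :
    eLpNorm (fun u => c * g u) q μ = c * eLpNorm g q μ := by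
  rcases eq_or_ne q 0 with rfl | hq
  · simp
  rcases eq_or_ne q ∞ with rfl | hq'
  · simp [eLpNormEssSup, ENNReal.essSup_const_mul]
  have hpos := ENNReal.toReal_pos hq hq'
  rw [eLpNorm_eq_lintegral_rpow_enorm_toReal hq hq', eLpNorm_eq_lintegral_rpow_enorm_toReal hq hq']
  simp only [enorm_eq_self, ENNReal.mul_rpow_of_nonneg _ _ hpos.le]
  rw [lintegral_const_mul' _ _ (ENNReal.rpow_ne_top_of_nonneg hpos.le hc),
    ENNReal.mul_rpow_of_nonneg _ _ (by positivity), ← ENNReal.rpow_mul,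
    mul_one_div_cancel hpos.ne', ENNReal.rpow_one]

theorem lnorm_const_mul (q : ℝ≥0∞) (I : Set ℝ) (w : ℝ → ℝ) {c : ℝ≥0∞} (hc : c ≠ ∞)
    (g : ℝ → ℝ≥0∞) : lnorm q I w (fun u => c * g u) = c * lnorm q I w g := by
  rw [lnorm, lnorm, ← eLpNorm_const_mul_ennreal hc]
  congr 1; ext u; ring

theorem lnorm_const (q : ℝ≥0∞) (I : Set ℝ) (w : ℝ → ℝ) {c : ℝ≥0∞} (hc : c ≠ ∞) :
    lnorm q I w (fun _ => c) = c * lnorm q I w (fun _ => 1) := by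
  simpa using lnorm_const_mul q I w hc (fun _ => 1)

theorem lnorm_le_const_mul {q : ℝ≥0∞} {I : Set ℝ} (hI : MeasurableSet I) {w w' : ℝ → ℝ}
    {g g' : ℝ → ℝ≥0∞} {c : ℝ≥0∞} (hc : c ≠ ∞)
    (h : ∀ u ∈ I, ENNReal.ofReal (w u) * g u ≤ c * (ENNReal.ofReal (w' u) * g' u)) :
    lnorm q I w g ≤ c * lnorm q I w' g' := by
  rw [← lnorm_const_mul _ _ _ hc]
  exact lnorm_mono hI fun u hu => (h u hu).trans_eq (by ring)

/-- Invariance of du/u under inversion; this exchanges the roles of 0 and ∞ and hence of L- and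
R-norms. -/
theorem lnorm_inv (q : ℝ≥0∞) (I : Set ℝ) (w : ℝ → ℝ) (g : ℝ → ℝ≥0∞) :
    lnorm q I w g = lnorm q ((fun u => u⁻¹) ⁻¹' I) (fun u => w u⁻¹) (fun u => g u⁻¹) := by
  have he : MeasurableEmbedding (fun u : ℝ => u⁻¹) := (MeasurableEquiv.inv ℝ).measurableEmbedding
  rw [lnorm, lnorm]
  conv_lhs => rw [← map_inv_logMeasure]
  rw [he.restrict_map, he.eLpNorm_map_measure]
  rfl

theorem preimage_inv_Ioo_zero {t : ℝ} (ht : 0 < t) : (fun u : ℝ => u⁻¹) ⁻¹' Ioo 0 t = Ioi t⁻¹ := by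
  ext u
  simp only [mem_preimage, mem_Ioo, inv_pos, mem_Ioi]
  constructor
  · rintro ⟨hu, h⟩; exact (inv_lt_comm₀ hu ht).1 h
  · intro h
    have hu : 0 < u := (inv_pos.2 ht).trans h
    exact ⟨hu, (inv_lt_comm₀ hu ht).2 h⟩

theorem preimage_inv_Ioi {t : ℝ} (ht : 0 < t) : (fun u : ℝ => u⁻¹) ⁻¹' Ioi t = Ioo 0 t⁻¹ := by
  ext u
  simp only [mem_preimage, mem_Ioo, mem_Ioi]
  constructor
  · intro h
    have hu : 0 < u := inv_pos.1 (ht.trans h)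
    exact ⟨hu, (lt_inv_comm₀ ht hu).1 h⟩
  · rintro ⟨hu, h⟩; exact (lt_inv_comm₀ hu ht).1 h

theorem preimage_inv_Ioi_zero : (fun u : ℝ => u⁻¹) ⁻¹' Ioi 0 = Ioi 0 := by
  ext u; simp

theorem preimage_inv_Ioo {s t : ℝ} (hs : 0 < s) (ht : 0 < t) :
    (fun u : ℝ => u⁻¹) ⁻¹' Ioo s t = Ioo t⁻¹ s⁻¹ := by
  have : Ioo s t = Ioo 0 t ∩ Ioi s := by
    ext u; simp only [mem_Ioo, mem_inter_iff, mem_Ioi]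
    exact ⟨fun h => ⟨⟨hs.trans h.1, h.2⟩, h.1⟩, fun h => ⟨h.2, h.1.2⟩⟩
  rw [this, preimage_inter, preimage_inv_Ioo_zero ht, preimage_inv_Ioi hs]
  ext u; simp only [mem_Ioo, mem_inter_iff, mem_Ioi]
  exact ⟨fun h => ⟨h.1, h.2.2⟩, fun h => ⟨h.1, (inv_pos.2 ht).trans h.1, h.2⟩⟩

/-- The factor u^{-1/q} raised to the power q is the density of du/u. For q = ∞ the factor is
absent, and only mutual absolute continuity with Lebesgue measure on `I` is needed. -/
theorem wnorm_eq_lnorm (α : ℝ) {q : ℝ≥0∞} (hq : 0 < q) (b : ℝ → ℝ) {I : Set ℝ}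
    (hI : MeasurableSet I) (hI0 : I ⊆ Ioi 0) (g : ℝ → ℝ≥0∞) :
    wnorm α q b I g = lnorm q I (fun u => u ^ α * b u) g := by
  have hν : logMeasure.restrict I = (volume.restrict I).withDensity fun u => ENNReal.ofReal u⁻¹ := by
    rw [logMeasure_eq_withDensity, restrict_withDensity hI, Measure.restrict_restrict hI,
      inter_eq_left.2 hI0]
  have hm : Measurable fun u : ℝ => ENNReal.ofReal u⁻¹ := by fun_prop
  rcases eq_or_ne q ∞ with rfl | hq'
  · have h1 : logMeasure.restrict I ≪ volume.restrict I := by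
      rw [hν]; exact withDensity_absolutelyContinuous _ _
    have h2 : volume.restrict I ≪ logMeasure.restrict I := by
      rw [hν]
      refine withDensity_absolutelyContinuous' hm.aemeasurable ?_
      filter_upwards [ae_restrict_mem hI] with u hu
      have : 0 < u := hI0 hu
      simpa using this
    simp only [wnorm, lnorm, eLpNorm_exponent_top, eLpNormEssSup, enorm_eq_self, one_div,
      ENNReal.inv_top, ENNReal.toReal_zero, sub_zero]
    exact le_antisymm (essSup_mono_measure h2) (essSup_mono_measure h1)
  · rw [lnorm_eq_lintegral hq.ne' hq', wnorm,
      eLpNorm_eq_lintegral_rpow_enorm_toReal hq.ne' hq', hν,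
      lintegral_withDensity_eq_lintegral_mul_non_measurable _ hm (by simp)]
    congr 1
    refine setLIntegral_congr_fun hI fun u hu => ?_
    have hu : 0 < u := hI0 hu
    have hpos := ENNReal.toReal_pos hq.ne' hq'
    simp only [enorm_eq_self, Pi.mul_apply]
    rw [Real.rpow_sub hu, div_eq_mul_inv, mul_right_comm, ENNReal.ofReal_mul' (by positivity),
      mul_right_comm, ENNReal.mul_rpow_of_nonneg _ _ hpos.le,
      ENNReal.ofReal_rpow_of_nonneg (by positivity) hpos.le, Real.inv_rpow (by positivity),
      ← Real.rpow_mul hu.le, one_div, ENNReal.toReal_inv, inv_mul_cancel₀ hpos.ne', Real.rpow_one,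
      mul_comm]

/-! ### Splitting the domain of a norm. -/

theorem eLpNorm_add_measure_le {α : Type*} [MeasurableSpace α] {q : ℝ≥0∞} (hq : q ≠ 0)
    (f : α → ℝ≥0∞) (μ ν : Measure α) :
    eLpNorm f q (μ + ν) ≤ 2 ^ (1 / q.toReal) * (eLpNorm f q μ + eLpNorm f q ν) := by
  rcases eq_or_ne q ∞ with rfl | hq'
  -- For q = ∞ the exponent `1 / q.toReal` is 1/0 = 0, so the constant is 1.
  · simp only [ENNReal.toReal_top, div_zero, ENNReal.rpow_zero, one_mul, eLpNorm_exponent_top,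
      eLpNormEssSup, enorm_eq_self]
    refine essSup_le_of_ae_le _ ?_
    rw [EventuallyLE, ae_add_measure_iff]
    constructor
    · filter_upwards [ENNReal.ae_le_essSup f] with x hx using hx.trans le_self_add
    · filter_upwards [ENNReal.ae_le_essSup f] with x hx using hx.trans le_add_self
  · have hpos := ENNReal.toReal_pos hq hq'
    simp only [eLpNorm_eq_lintegral_rpow_enorm_toReal hq hq', lintegral_add_measure]
    generalize ∫⁻ x, ‖f x‖ₑ ^ q.toReal ∂μ = x
    generalize ∫⁻ x, ‖f x‖ₑ ^ q.toReal ∂ν = y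
    have hp : 0 ≤ 1 / q.toReal := by positivity
    calc (x + y) ^ (1 / q.toReal) ≤ (2 * max x y) ^ (1 / q.toReal) := by
          gcongr; rw [two_mul]; gcongr <;> simp
      _ = 2 ^ (1 / q.toReal) * max (x ^ (1 / q.toReal)) (y ^ (1 / q.toReal)) := by
          rw [ENNReal.mul_rpow_of_nonneg _ _ hp, (ENNReal.monotone_rpow_of_nonneg hp).map_max]
      _ ≤ _ := by gcongr; exact max_le le_self_add le_add_self

/-- Points are null for du/u, so cutting at `t` loses nothing. Splitting the measure instead of the
function avoids measurability, and the constant depends on q alone. -/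
theorem exists_lnorm_split {q : ℝ≥0∞} (hq : 0 < q) : ∃ C : ℝ≥0∞, C ≠ ∞ ∧ ∀ (J : Set ℝ) (t : ℝ)
    (w : ℝ → ℝ) (g : ℝ → ℝ≥0∞),
      lnorm q J w g ≤ C * (lnorm q (J ∩ Iio t) w g + lnorm q (J ∩ Ioi t) w g) := by
  refine ⟨2 ^ (1 / q.toReal), ENNReal.rpow_ne_top_of_nonneg (by positivity) ENNReal.ofNat_ne_top,
    fun J t w g => ?_⟩
  have h : J =ᵐ[logMeasure] ((J ∩ Iio t) ∪ (J ∩ Ioi t) : Set ℝ) := by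
    have h1 : ∀ᵐ u ∂logMeasure, u ≠ t := by simp [ae_iff]
    filter_upwards [h1] with u hu
    refine propext ?_
    change u ∈ J ↔ (u ∈ J ∧ u < t) ∨ (u ∈ J ∧ t < u)
    rcases lt_or_gt_of_ne hu with h' | h' <;> tauto
  have h2 : logMeasure.restrict J
      ≤ logMeasure.restrict (J ∩ Iio t) + logMeasure.restrict (J ∩ Ioi t) := by
    rw [Measure.restrict_congr_set h]
    exact Measure.restrict_union_le _ _
  exact (eLpNorm_mono_measure _ h2).trans (eLpNorm_add_measure_le hq.ne' _ _ _)

theorem exists_lnorm_Ioi_le {q : ℝ≥0∞} (hq : 0 < q) : ∃ C : ℝ≥0∞, C ≠ ∞ ∧ ∀ (s t : ℝ), s ≤ t →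
    ∀ (w : ℝ → ℝ) (g : ℝ → ℝ≥0∞),
      lnorm q (Ioi s) w g ≤ C * (lnorm q (Ioo s t) w g + lnorm q (Ioi t) w g) := by
  obtain ⟨C, hC, h⟩ := exists_lnorm_split hq
  refine ⟨C, hC, fun s t hst w g => (h (Ioi s) t w g).trans_eq ?_⟩
  rw [Ioi_inter_Iio, Ioi_inter_Ioi, sup_eq_right.2 hst]

theorem exists_lnorm_Ioo_le {q : ℝ≥0∞} (hq : 0 < q) : ∃ C : ℝ≥0∞, C ≠ ∞ ∧ ∀ (x s t : ℝ),
    x ≤ s → s ≤ t → ∀ (w : ℝ → ℝ) (g : ℝ → ℝ≥0∞),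
      lnorm q (Ioo x t) w g ≤ C * (lnorm q (Ioo x s) w g + lnorm q (Ioo s t) w g) := by
  obtain ⟨C, hC, h⟩ := exists_lnorm_split hq
  refine ⟨C, hC, fun x s t hxs hst w g => (h (Ioo x t) s w g).trans_eq ?_⟩
  congr 3 <;> ext u <;> simp only [mem_Ioo, mem_inter_iff, mem_Iio, mem_Ioi]
  · exact ⟨fun h => ⟨h.1.1, h.2⟩, fun h => ⟨⟨h.1, h.2.trans_le hst⟩, h.2⟩⟩
  · exact ⟨fun h => ⟨h.2, h.1.2⟩, fun h => ⟨⟨hxs.trans_lt h.1, h.2⟩, h.1⟩⟩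

/-! ### Regularly varying functions -/

/-- Positive functions on `(0,∞)` which are regularly varying of index `α` up to constants. -/
structure RegVar (α : ℝ) (w : ℝ → ℝ) : Prop where
  pos : ∀ t : ℝ, 0 < t → 0 < w t
  bound : ∀ ε : ℝ, 0 < ε → ∃ C : ℝ, 0 < C ∧ ∀ s t : ℝ, 0 < s → s ≤ t →
    w t ≤ C * (t / s) ^ (ε + α) * w s ∧ w s ≤ C * (t / s) ^ (ε - α) * w t

theorem SV.regVar {b : ℝ → ℝ} (hb : SV b) : RegVar 0 b := by
  refine ⟨hb.pos, fun ε hε => ?_⟩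
  obtain ⟨g, hg, C, hC, hCg⟩ := hb.equiv_increasing ε hε
  obtain ⟨k, hk, D, hD, hDk⟩ := hb.equiv_decreasing ε hε
  refine ⟨C * C + D * D, by positivity, fun s t hs hst => ?_⟩
  have ht := hs.trans_le hst
  have hst1 : 0 < (t / s) ^ ε := by positivity
  have hbs := hb.pos s hs
  have hbt := hb.pos t ht
  rw [add_zero, sub_zero, Real.div_rpow ht.le hs.le]
  have hsp : 0 < s ^ ε := by positivity
  have htp : 0 < t ^ ε := by positivity
  constructor
  · have h1 : t ^ (-ε) * b t ≤ D * D * (s ^ (-ε) * b s) := calc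
      t ^ (-ε) * b t ≤ D * k t := (hDk t ht).1
      _ ≤ D * k s := by gcongr; exact hk hs ht hst
      _ ≤ D * (D * (s ^ (-ε) * b s)) := by gcongr; exact (hDk s hs).2
      _ = _ := by ring
    rw [Real.rpow_neg ht.le, Real.rpow_neg hs.le] at h1
    have h2 : b t ≤ D * D * (t ^ ε / s ^ ε) * b s := by
      have := mul_le_mul_of_nonneg_left h1 htp.le
      rw [← mul_assoc, mul_inv_cancel₀ htp.ne', one_mul] at this
      exact this.trans_eq (by ring)
    refine h2.trans ?_
    gcongr
    nlinarith [mul_pos hC hC]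
  · have h1 : s ^ ε * b s ≤ C * C * (t ^ ε * b t) := calc
      s ^ ε * b s ≤ C * g s := (hCg s hs).1
      _ ≤ C * g t := by gcongr; exact hg hs ht hst
      _ ≤ C * (C * (t ^ ε * b t)) := by gcongr; exact (hCg t ht).2
      _ = _ := by ring
    have h2 : b s ≤ C * C * (t ^ ε / s ^ ε) * b t := by
      have := mul_le_mul_of_nonneg_left h1 (inv_pos.2 hsp).le
      rw [← mul_assoc, inv_mul_cancel₀ hsp.ne', one_mul] at this
      exact this.trans_eq (by rw [div_eq_mul_inv]; ring)
    refine h2.trans ?_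
    gcongr
    nlinarith [mul_pos hD hD]

namespace RegVar

theorem rpow_id (α : ℝ) : RegVar α (fun t => t ^ α) := by
  refine ⟨fun t ht => by positivity, fun ε hε => ⟨1, one_pos, fun s t hs hst => ?_⟩⟩
  have ht := hs.trans_le hst
  have h1 : 1 ≤ t / s := (one_le_div hs).2 hst
  have h0 : 0 < t / s := by positivity
  have h2 : t ^ α = (t / s) ^ α * s ^ α := by
    rw [← Real.mul_rpow h0.le hs.le, div_mul_cancel₀ _ hs.ne']
  have h3 : s ^ α = (t / s) ^ (-α) * t ^ α := by
    rw [h2, ← mul_assoc, ← Real.rpow_add h0]; simp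
  constructor
  · rw [h2, one_mul]; gcongr
    linarith
  · rw [one_mul, h3]
    gcongr
    linarith

variable {α β : ℝ} {w v : ℝ → ℝ}

theorem mul (hw : RegVar α w) (hv : RegVar β v) : RegVar (α + β) (fun t => w t * v t) := by
  refine ⟨fun t ht => mul_pos (hw.pos t ht) (hv.pos t ht), fun ε hε => ?_⟩
  obtain ⟨C, hC, h⟩ := hw.bound (ε / 2) (by positivity)
  obtain ⟨D, hD, k⟩ := hv.bound (ε / 2) (by positivity)
  refine ⟨C * D, by positivity, fun s t hs hst => ?_⟩
  have ht := hs.trans_le hst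
  have h0 : 0 < t / s := by positivity
  have := hw.pos s hs
  have := hv.pos s hs
  have := hw.pos t ht
  have := hv.pos t ht
  constructor
  · rw [show ε + (α + β) = (ε / 2 + α) + (ε / 2 + β) by ring, Real.rpow_add h0]
    calc _ ≤ (C * (t / s) ^ (ε / 2 + α) * w s) * (D * (t / s) ^ (ε / 2 + β) * v s) :=
          mul_le_mul (h s t hs hst).1 (k s t hs hst).1 (by positivity) (by positivity)
      _ = _ := by ring
  · rw [show ε - (α + β) = (ε / 2 - α) + (ε / 2 - β) by ring, Real.rpow_add h0]
    calc _ ≤ (C * (t / s) ^ (ε / 2 - α) * w t) * (D * (t / s) ^ (ε / 2 - β) * v t) :=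
          mul_le_mul (h s t hs hst).2 (k s t hs hst).2 (by positivity) (by positivity)
      _ = _ := by ring

theorem inv (hw : RegVar α w) : RegVar (-α) (fun t => (w t)⁻¹) := by
  refine ⟨fun t ht => inv_pos.2 (hw.pos t ht), fun ε hε => ?_⟩
  obtain ⟨C, hC, h⟩ := hw.bound ε hε
  refine ⟨C, hC, fun s t hs hst => ?_⟩
  have ht := hs.trans_le hst
  have hws := hw.pos s hs
  have hwt := hw.pos t ht
  constructor
  · rw [← div_eq_mul_inv, le_div_iff₀ hws, inv_mul_le_iff₀ hwt]
    exact (h s t hs hst).2.trans_eq (by rw [sub_eq_add_neg]; ring)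
  · rw [← div_eq_mul_inv, le_div_iff₀ hwt, inv_mul_le_iff₀ hws]
    exact (h s t hs hst).1.trans_eq (by rw [sub_neg_eq_add]; ring)

theorem comp_inv (hw : RegVar α w) : RegVar (-α) (fun t => w t⁻¹) := by
  refine ⟨fun t ht => hw.pos _ (inv_pos.2 ht), fun ε hε => ?_⟩
  obtain ⟨C, hC, h⟩ := hw.bound ε hε
  refine ⟨C, hC, fun s t hs hst => ?_⟩
  have ht := hs.trans_le hst
  have := h t⁻¹ s⁻¹ (inv_pos.2 ht) (inv_anti₀ hs hst)
  rw [show s⁻¹ / t⁻¹ = t / s by field_simp] at this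
  exact ⟨by simpa [sub_eq_add_neg] using this.2, by simpa [sub_eq_add_neg] using this.1⟩

theorem rpow_nonneg (hw : RegVar α w) {c : ℝ} (hc : 0 ≤ c) :
    RegVar (c * α) (fun t => w t ^ c) := by
  refine ⟨fun t ht => Real.rpow_pos_of_pos (hw.pos t ht) _, fun ε hε => ?_⟩
  -- Dividing by c + 1 instead of c keeps the case c = 0.
  obtain ⟨C, hC, h⟩ := hw.bound (ε / (c + 1)) (by positivity)
  refine ⟨C ^ c, by positivity, fun s t hs hst => ?_⟩
  have ht := hs.trans_le hst
  have hws := hw.pos s hs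
  have hwt := hw.pos t ht
  have h1 : 1 ≤ t / s := (one_le_div hs).2 hst
  have h0 : 0 < t / s := by positivity
  have hcε : ε / (c + 1) * c ≤ ε := by
    rw [div_mul_eq_mul_div, div_le_iff₀ (by positivity)]; nlinarith
  constructor
  · calc w t ^ c ≤ (C * (t / s) ^ (ε / (c + 1) + α) * w s) ^ c :=
          Real.rpow_le_rpow hwt.le (h s t hs hst).1 hc
      _ = C ^ c * (t / s) ^ ((ε / (c + 1) + α) * c) * w s ^ c := by
          rw [Real.mul_rpow (by positivity) hws.le, Real.mul_rpow hC.le (by positivity),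
            ← Real.rpow_mul h0.le]
      _ ≤ _ := by
          gcongr
          linarith
  · calc w s ^ c ≤ (C * (t / s) ^ (ε / (c + 1) - α) * w t) ^ c :=
          Real.rpow_le_rpow hws.le (h s t hs hst).2 hc
      _ = C ^ c * (t / s) ^ ((ε / (c + 1) - α) * c) * w t ^ c := by
          rw [Real.mul_rpow (by positivity) hwt.le, Real.mul_rpow hC.le (by positivity),
            ← Real.rpow_mul h0.le]
      _ ≤ _ := by
          gcongr
          linarith

theorem congr (hw : RegVar α w) (h : ∀ t, 0 < t → v t = w t) : RegVar α v := by
  refine ⟨fun t ht => h t ht ▸ hw.pos t ht, fun ε hε => ?_⟩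
  obtain ⟨C, hC, k⟩ := hw.bound ε hε
  refine ⟨C, hC, fun s t hs hst => ?_⟩
  rw [h s hs, h t (hs.trans_le hst)]
  exact k s t hs hst

theorem of_equiv (hw : RegVar α w) (hpos : ∀ t, 0 < t → 0 < v t) {D : ℝ} (hD : 0 < D)
    (h : ∀ t, 0 < t → w t ≤ v t ∧ v t ≤ D * w t) : RegVar α v := by
  refine ⟨hpos, fun ε hε => ?_⟩
  obtain ⟨C, hC, k⟩ := hw.bound ε hε
  refine ⟨D * C, by positivity, fun s t hs hst => ?_⟩
  have ht := hs.trans_le hst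
  constructor
  · calc v t ≤ D * w t := (h t ht).2
      _ ≤ D * (C * (t / s) ^ (ε + α) * w s) := by gcongr; exact (k s t hs hst).1
      _ ≤ D * (C * (t / s) ^ (ε + α) * v s) := by gcongr; exact (h s hs).1
      _ = _ := by ring
  · calc v s ≤ D * w s := (h s hs).2
      _ ≤ D * (C * (t / s) ^ (ε - α) * w t) := by gcongr; exact (k s t hs hst).2
      _ ≤ D * (C * (t / s) ^ (ε - α) * v t) := by gcongr; exact (h t ht).1
      _ = _ := by ring

/-- Values at comparable points are comparable. -/
theorem le_of_comparable (hw : RegVar α w) {c : ℝ} (hc : 0 < c) : ∃ D : ℝ, 0 < D ∧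
    ∀ x y : ℝ, 0 < x → 0 < y → x ≤ c * y → y ≤ c * x → w x ≤ D * w y := by
  obtain ⟨C, hC, k⟩ := hw.bound (1 + |α|) (by positivity)
  have hα := abs_nonneg α
  have h1 : 0 ≤ 1 + |α| + α := by linarith [neg_abs_le α]
  have h2 : 0 ≤ 1 + |α| - α := by linarith [le_abs_self α]
  refine ⟨C * c ^ (1 + |α| + α) + C * c ^ (1 + |α| - α), by positivity,
    fun x y hx hy hxy hyx => ?_⟩
  have hwy := hw.pos y hy
  have p1 : 0 < C * c ^ (1 + |α| + α) * w y := by positivity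
  have p2 : 0 < C * c ^ (1 + |α| - α) * w y := by positivity
  rw [add_mul]
  rcases le_total y x with h | h
  · refine ((k y x hy h).1.trans ?_).trans (le_add_of_nonneg_right p2.le)
    gcongr
    exact (div_le_iff₀ hy).2 hxy
  · refine ((k x y hx h).2.trans ?_).trans (le_add_of_nonneg_left p1.le)
    gcongr
    exact (div_le_iff₀ hx).2 hyx

/-- Since ρ need not be monotone, ρ(t)/ρ(s) is only confined between powers of t/s, up to constants.
An outer function of index 0 turns any such bound into an arbitrarily small power. -/
theorem comp (hw : RegVar 0 w) {ρ : ℝ → ℝ} (hρ : RegVar β ρ) :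
    RegVar 0 (fun t => w (ρ t)) := by
  refine ⟨fun t ht => hw.pos _ (hρ.pos t ht), fun ε hε => ?_⟩
  obtain ⟨C, hC, h⟩ := hρ.bound 1 one_pos
  set γ : ℝ := 1 + |β| with hγ
  have hγ0 : 0 < γ := by positivity
  obtain ⟨D, hD, k⟩ := hw.bound (ε / γ) (by positivity)
  refine ⟨D * C ^ (ε / γ), by positivity, fun s t hs hst => ?_⟩
  have ht := hs.trans_le hst
  have h1 : 1 ≤ t / s := (one_le_div hs).2 hst
  have h0 : 0 < t / s := by positivity
  have hρs := hρ.pos s hs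
  have hρt := hρ.pos t ht
  have ub : ρ t / ρ s ≤ C * (t / s) ^ γ := by
    rw [div_le_iff₀ hρs]
    refine (h s t hs hst).1.trans ?_
    gcongr
    linarith [le_abs_self β]
  have lb : ρ s / ρ t ≤ C * (t / s) ^ γ := by
    rw [div_le_iff₀ hρt]
    refine (h s t hs hst).2.trans ?_
    gcongr
    linarith [neg_abs_le β]
  have key : ∀ x : ℝ, 0 < x → x ≤ C * (t / s) ^ γ →
      D * x ^ (ε / γ) ≤ D * C ^ (ε / γ) * (t / s) ^ ε := by
    intro x hx hxl
    rw [mul_assoc]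
    gcongr
    calc x ^ (ε / γ) ≤ (C * (t / s) ^ γ) ^ (ε / γ) :=
          Real.rpow_le_rpow hx.le hxl (by positivity)
      _ = _ := by
          rw [Real.mul_rpow hC.le (by positivity), ← Real.rpow_mul h0.le,
            mul_div_cancel₀ _ hγ0.ne']
  have hws := hw.pos _ hρs
  have hwt := hw.pos _ hρt
  simp only [add_zero, sub_zero] at k ⊢
  rcases le_total (ρ s) (ρ t) with hle | hle
  · have kk := k _ _ hρs hle
    have := key _ (div_pos hρt hρs) ub
    exact ⟨kk.1.trans (by gcongr), kk.2.trans (by gcongr)⟩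
  · have kk := k _ _ hρt hle
    have := key _ (div_pos hρs hρt) lb
    exact ⟨kk.2.trans (by gcongr), kk.1.trans (by gcongr)⟩

/-- Every regularly varying function is equivalent to a measurable one. -/
theorem exists_measurable (hw : RegVar α w) : ∃ v : ℝ → ℝ, Measurable v ∧ RegVar α v ∧
    ∃ D : ℝ, 0 < D ∧ ∀ t, 0 < t → w t ≤ v t ∧ v t ≤ D * w t := by
  obtain ⟨C, hC, k⟩ := hw.bound 1 one_pos
  -- With this exponent t^β w(t) is increasing up to a constant. Its running supremum `S` is then
  -- comparable to it and, being monotone, is measurable.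
  set β : ℝ := 1 + |α| with hβ
  have hle : ∀ s t, 0 < s → s ≤ t → s ^ β * w s ≤ C * (t ^ β * w t) := by
    intro s t hs hst
    have ht := hs.trans_le hst
    have hwt := hw.pos t ht
    have h1 : 1 ≤ t / s := (one_le_div hs).2 hst
    calc s ^ β * w s ≤ s ^ β * (C * (t / s) ^ (1 - α) * w t) := by
          gcongr; exact (k s t hs hst).2
      _ ≤ s ^ β * (C * (t / s) ^ β * w t) := by
          gcongr
          linarith [neg_abs_le α]
      _ = _ := by
          rw [Real.div_rpow ht.le hs.le]
          field_simp
  let S : ℝ → ℝ≥0∞ := fun t => ⨆ s ∈ Ioc 0 t, ENNReal.ofReal (s ^ β * w s)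
  have hS : Monotone S := fun t t' htt' =>
    biSup_mono fun s hs => ⟨hs.1, hs.2.trans htt'⟩
  have hSle : ∀ t, 0 < t → S t ≤ ENNReal.ofReal (C * (t ^ β * w t)) := fun t ht =>
    iSup₂_le fun s hs => ENNReal.ofReal_le_ofReal (hle s t hs.1 hs.2)
  have hSge : ∀ t, 0 < t → ENNReal.ofReal (t ^ β * w t) ≤ S t := fun t ht =>
    le_iSup₂ (f := fun s (_ : s ∈ Ioc 0 t) => ENNReal.ofReal (s ^ β * w s)) t ⟨ht, le_rfl⟩
  have hSr : ∀ t, 0 < t → t ^ β * w t ≤ (S t).toReal ∧ (S t).toReal ≤ C * (t ^ β * w t) := by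
    intro t ht
    have hwt := hw.pos t ht
    have hfin : S t ≠ ∞ := ((hSle t ht).trans_lt ENNReal.ofReal_lt_top).ne
    constructor
    · rw [← ENNReal.ofReal_le_iff_le_toReal hfin]; exact hSge t ht
    · exact ENNReal.toReal_le_of_le_ofReal (by positivity) (hSle t ht)
  have hv : ∀ t, 0 < t → w t ≤ t ^ (-β) * (S t).toReal ∧ t ^ (-β) * (S t).toReal ≤ C * w t := by
    intro t ht
    have e : t ^ (-β) * t ^ β = 1 := by rw [← Real.rpow_add ht]; simp
    obtain ⟨h1, h2⟩ := hSr t ht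
    have p : 0 < t ^ (-β) := by positivity
    constructor
    · have := mul_le_mul_of_nonneg_left h1 p.le
      rwa [← mul_assoc, e, one_mul] at this
    · have := mul_le_mul_of_nonneg_left h2 p.le
      exact this.trans_eq (by linear_combination (C * w t) * e)
  refine ⟨fun t => t ^ (-β) * (S t).toReal, ?_, ?_, C, hC, hv⟩
  · have := hS.measurable
    fun_prop
  · exact hw.of_equiv (fun t ht => (hw.pos t ht).trans_le (hv t ht).1) hC hv

end RegVar

/-! ### Quasi-concave functions and elementary norm estimates -/

/-- Non-decreasing functions `g` such that `g(t)/t` is non-increasing on `(0,∞)`. -/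
structure QuasiConcave (g : ℝ → ℝ≥0∞) : Prop where
  mono : Monotone g
  le_mul : ∀ s t : ℝ, 0 < s → s ≤ t → g t ≤ ENNReal.ofReal (t / s) * g s

theorem QuasiConcave.one : QuasiConcave fun _ => 1 :=
  ⟨monotone_const, fun s t hs hst => by
    rw [mul_one, ← ENNReal.ofReal_one]
    exact ENNReal.ofReal_le_ofReal ((one_le_div hs).2 hst)⟩

theorem QuasiConcave.le_of_le_mul {g : ℝ → ℝ≥0∞} (hg : QuasiConcave g) {c x y : ℝ} (hy : 0 < y)
    (hc : 1 ≤ c) (h : x ≤ c * y) : g x ≤ ENNReal.ofReal c * g y := by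
  refine (hg.mono h).trans ((hg.le_mul y (c * y) hy (by nlinarith)).trans_eq ?_)
  rw [mul_div_assoc, div_self hy.ne', mul_one]

/-! ### Norms of powers and of regularly varying functions. -/

theorem lintegral_rpow_Ioo {p t : ℝ} (hp : 0 < p) (ht : 0 < t) :
    ∫⁻ u in Ioo 0 t, ENNReal.ofReal (u ^ p) ∂logMeasure = ENNReal.ofReal (t ^ p / p) := by
  have hm : Measurable fun u : ℝ => ENNReal.ofReal u⁻¹ := by fun_prop
  rw [logMeasure_eq_withDensity, restrict_withDensity measurableSet_Ioo,
    Measure.restrict_restrict measurableSet_Ioo,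
    inter_eq_left.2 (show Ioo 0 t ⊆ Ioi (0 : ℝ) from fun u hu => hu.1),
    lintegral_withDensity_eq_lintegral_mul_non_measurable _ hm (by simp)]
  have h1 : ∀ u ∈ Ioo 0 t, ((fun u : ℝ => ENNReal.ofReal u⁻¹) * fun u => ENNReal.ofReal (u ^ p)) u
      = ENNReal.ofReal (u ^ (p - 1)) := by
    intro u hu
    have hu0 : 0 < u := hu.1
    rw [Pi.mul_apply, ← ENNReal.ofReal_mul (by positivity), Real.rpow_sub_one hu0.ne', div_eq_mul_inv,
      mul_comm]
  rw [setLIntegral_congr_fun measurableSet_Ioo h1, ← ofReal_integral_eq_lintegral_ofReal]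
  · rw [← integral_Ioc_eq_integral_Ioo, ← intervalIntegral.integral_of_le ht.le,
      integral_rpow (Or.inl (by linarith))]
    simp [Real.zero_rpow hp.ne']
  · have := (intervalIntegral.intervalIntegrable_rpow' (a := 0) (b := t)
      (show -1 < p - 1 by linarith)).1
    exact this.mono_set Ioo_subset_Ioc_self
  · filter_upwards [ae_restrict_mem measurableSet_Ioo] with u hu
    exact Real.rpow_nonneg hu.1.le _

theorem lnorm_rpow_Ioo_le {q : ℝ≥0∞} (hq : 0 < q) {β : ℝ} (hβ : 0 < β) : ∃ C : ℝ≥0∞, C ≠ ∞ ∧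
    ∀ t : ℝ, 0 < t →
      lnorm q (Ioo 0 t) (fun u => u ^ β) (fun _ => 1) ≤ C * ENNReal.ofReal (t ^ β) := by
  rcases eq_or_ne q ∞ with rfl | hq'
  · refine ⟨1, ENNReal.one_ne_top, fun t ht => ?_⟩
    rw [lnorm_top, one_mul]
    refine essSup_le_of_ae_le _ ?_
    filter_upwards [ae_restrict_mem measurableSet_Ioo] with u hu
    rw [mul_one]
    exact ENNReal.ofReal_le_ofReal (Real.rpow_le_rpow hu.1.le hu.2.le hβ.le)
  · have hpos := ENNReal.toReal_pos hq.ne' hq'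
    set p := q.toReal
    refine ⟨ENNReal.ofReal ((1 / (β * p)) ^ (1 / p)), ENNReal.ofReal_ne_top, fun t ht => ?_⟩
    rw [lnorm_eq_lintegral hq.ne' hq']
    have : ∀ u ∈ Ioo 0 t, (ENNReal.ofReal (u ^ β) * 1) ^ p = ENNReal.ofReal (u ^ (β * p)) := by
      intro u hu
      have hu0 : 0 < u := hu.1
      rw [mul_one, ENNReal.ofReal_rpow_of_nonneg (by positivity) hpos.le, Real.rpow_mul hu0.le]
    rw [setLIntegral_congr_fun measurableSet_Ioo this, lintegral_rpow_Ioo (by positivity) ht,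
      ENNReal.ofReal_rpow_of_nonneg (by positivity) (by positivity),
      ← ENNReal.ofReal_mul (by positivity)]
    refine le_of_eq ?_
    congr 1
    rw [div_eq_mul_one_div, Real.mul_rpow (by positivity) (by positivity), ← Real.rpow_mul ht.le,
      mul_assoc, mul_one_div_cancel hpos.ne', mul_one, mul_comm]

theorem RegVar.lnorm_Ioo_le {q : ℝ≥0∞} (hq : 0 < q) {α : ℝ} (hα : 0 < α) {w : ℝ → ℝ}
    (hw : RegVar α w) : ∃ C : ℝ≥0∞, C ≠ ∞ ∧ ∀ t : ℝ, 0 < t →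
      lnorm q (Ioo 0 t) w (fun _ => 1) ≤ C * ENNReal.ofReal (w t) := by
  obtain ⟨A, hA, hAt⟩ := lnorm_rpow_Ioo_le hq (half_pos hα)
  -- Half of the index is given away: w(u) ≤ C (u/t)^{α/2} w(t) for u ≤ t, and the remaining power
  -- is still integrable at 0.
  obtain ⟨C, hC, h⟩ := hw.bound (α / 2) (half_pos hα)
  refine ⟨ENNReal.ofReal C * A, by finiteness, fun t ht => ?_⟩
  have hwt := hw.pos t ht
  have h1 : lnorm q (Ioo 0 t) w (fun _ => 1) ≤ ENNReal.ofReal (C * t ^ (-(α / 2)) * w t) *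
      lnorm q (Ioo 0 t) (fun u => u ^ (α / 2)) (fun _ => 1) := by
    refine lnorm_le_const_mul measurableSet_Ioo ENNReal.ofReal_ne_top fun u hu => ?_
    have hu0 : 0 < u := hu.1
    rw [mul_one, mul_one, ← ENNReal.ofReal_mul (by positivity)]
    refine ENNReal.ofReal_le_ofReal ((h u t hu0 hu.2.le).2.trans_eq ?_)
    rw [show α / 2 - α = -(α / 2) by ring, Real.rpow_neg (by positivity), Real.rpow_neg ht.le,
      Real.div_rpow ht.le hu0.le]
    field_simp
  refine h1.trans ((mul_le_mul_right (hAt t ht) _).trans_eq ?_)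
  rw [mul_left_comm, ← ENNReal.ofReal_mul (by positivity), mul_comm (ENNReal.ofReal C) A,
    mul_assoc A,
    ← ENNReal.ofReal_mul hC.le]
  congr 2
  rw [Real.rpow_neg ht.le]
  field_simp

theorem RegVar.lnorm_Ioi_le {q : ℝ≥0∞} (hq : 0 < q) {α : ℝ} (hα : α < 0) {w : ℝ → ℝ}
    (hw : RegVar α w) : ∃ C : ℝ≥0∞, C ≠ ∞ ∧ ∀ t : ℝ, 0 < t →
      lnorm q (Ioi t) w (fun _ => 1) ≤ C * ENNReal.ofReal (w t) := by
  obtain ⟨C, hC, h⟩ := hw.comp_inv.lnorm_Ioo_le hq (neg_pos.2 hα)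
  refine ⟨C, hC, fun t ht => ?_⟩
  rw [lnorm_inv, preimage_inv_Ioi ht]
  simpa using h t⁻¹ (inv_pos.2 ht)

/-- The interval (t/2, t) has du/u-measure log 2 for every t, so a constant is its own norm there up
to a factor depending only on q. -/
theorem exists_le_lnorm_of_le {q : ℝ≥0∞} (hq : 0 < q) : ∃ A : ℝ≥0∞, A ≠ ∞ ∧
    ∀ (t : ℝ), 0 < t → ∀ (c : ℝ≥0∞) (w : ℝ → ℝ) (g : ℝ → ℝ≥0∞),
      (∀ u ∈ Ioo (t / 2) t, c ≤ ENNReal.ofReal (w u) * g u) →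
      c ≤ A * lnorm q (Ioo (t / 2) t) w g := by
  have hlog : ENNReal.ofReal (Real.log 2) ≠ 0 := by
    simpa using Real.log_pos one_lt_two
  have hB0 : ENNReal.ofReal (Real.log 2) ^ (1 / q.toReal) ≠ 0 := by
    simp [ENNReal.rpow_eq_zero_iff, Real.log_pos one_lt_two]
  have hB : ENNReal.ofReal (Real.log 2) ^ (1 / q.toReal) ≠ ∞ :=
    ENNReal.rpow_ne_top_of_nonneg (by positivity) ENNReal.ofReal_ne_top
  refine ⟨(ENNReal.ofReal (Real.log 2) ^ (1 / q.toReal))⁻¹, ENNReal.inv_ne_top.2 hB0,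
    fun t ht c w g h => ?_⟩
  have hμ : logMeasure (Ioo (t / 2) t) = ENNReal.ofReal (Real.log 2) := by
    rw [logMeasure_Ioo (by positivity) ht]; congr 2; field_simp
  have h1 : eLpNorm (fun _ : ℝ => c) q (logMeasure.restrict (Ioo (t / 2) t))
      ≤ lnorm q (Ioo (t / 2) t) w g := by
    refine eLpNorm_mono_enorm_ae ?_
    filter_upwards [ae_restrict_mem measurableSet_Ioo] with u hu using by simpa using h u hu
  rw [eLpNorm_const _ hq.ne' (by
    rw [Ne, Measure.restrict_eq_zero, hμ]; exact hlog), Measure.restrict_apply_univ, hμ,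
    enorm_eq_self] at h1
  calc c = (ENNReal.ofReal (Real.log 2) ^ (1 / q.toReal))⁻¹ *
        (c * ENNReal.ofReal (Real.log 2) ^ (1 / q.toReal)) := by
        rw [mul_comm c, ← mul_assoc, ENNReal.inv_mul_cancel hB0 hB, one_mul]
    _ ≤ _ := by gcongr

/-- On (t/2, t) neither a regularly varying weight nor a quasi-concave function changes by more than
a constant factor. Pointwise bounds are obtained from norms in this way throughout. -/
theorem RegVar.mul_le_lnorm {q : ℝ≥0∞} (hq : 0 < q) {α : ℝ} {w : ℝ → ℝ} (hw : RegVar α w) :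
    ∃ C : ℝ≥0∞, C ≠ ∞ ∧ ∀ g : ℝ → ℝ≥0∞, QuasiConcave g → ∀ t : ℝ, 0 < t →
      ENNReal.ofReal (w t) * g t ≤ C * lnorm q (Ioo (t / 2) t) w g := by
  obtain ⟨A, hA, h⟩ := exists_le_lnorm_of_le hq
  obtain ⟨D, hD, k⟩ := hw.le_of_comparable (c := 2) two_pos
  refine ⟨A * (ENNReal.ofReal D * 2), by finiteness, fun g hg t ht => ?_⟩
  rw [mul_assoc, ← lnorm_const_mul _ _ _ (by finiteness)]
  refine h t ht _ _ _ fun u hu => ?_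
  have hu0 : 0 < u := by linarith [hu.1]
  have hut := hu.1
  calc ENNReal.ofReal (w t) * g t ≤ ENNReal.ofReal (D * w u) * (ENNReal.ofReal 2 * g u) := by
        gcongr
        · exact k t u ht hu0 (by linarith) (by linarith [hu.2])
        · exact hg.le_of_le_mul hu0 one_le_two (by linarith)
    _ = _ := by rw [ENNReal.ofReal_mul hD.le]; simp; ring

theorem RegVar.le_lnorm_Ioi {q : ℝ≥0∞} (hq : 0 < q) {α : ℝ} {w : ℝ → ℝ} (hw : RegVar α w) :
    ∃ C : ℝ≥0∞, C ≠ ∞ ∧ ∀ t : ℝ, 0 < t →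
      ENNReal.ofReal (w t) ≤ C * lnorm q (Ioi t) w (fun _ => 1) := by
  obtain ⟨A, hA, h⟩ := hw.mul_le_lnorm hq
  obtain ⟨D, hD, k⟩ := hw.le_of_comparable (c := 2) two_pos
  refine ⟨ENNReal.ofReal D * A, by finiteness, fun t ht => ?_⟩
  -- At 2t the dyadic interval is (t, 2t), which lies to the right of t.
  have h2 := h _ QuasiConcave.one (2 * t) (by positivity)
  calc ENNReal.ofReal (w t) ≤ ENNReal.ofReal (D * w (2 * t)) := by
        gcongr; exact k _ _ ht (by positivity) (by linarith) le_rfl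
    _ = ENNReal.ofReal D * (ENNReal.ofReal (w (2 * t)) * 1) := by
        rw [ENNReal.ofReal_mul hD.le, mul_one]
    _ ≤ ENNReal.ofReal D * (A * lnorm q (Ioi t) w (fun _ => 1)) := by
        refine mul_le_mul_right (h2.trans (mul_le_mul_right (lnorm_mono_set _ ?_ _ _) _)) _
        intro u hu
        have := hu.1
        simp only [mem_Ioi]; linarith
    _ = _ := by ring

/-- The quasi-triangle inequality wants measurable functions, so the weight is exchanged for a
measurable equivalent; `LpAddConst` accounts for q < 1. -/
theorem RegVar.lnorm_add_le {α : ℝ} {w : ℝ → ℝ} (hw : RegVar α w) (q : ℝ≥0∞) :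
    ∃ C : ℝ≥0∞, C ≠ ∞ ∧ ∀ I : Set ℝ, MeasurableSet I → I ⊆ Ioi 0 → ∀ F G : ℝ → ℝ≥0∞,
      Measurable F → Measurable G →
      lnorm q I w (fun u => F u + G u) ≤ C * (lnorm q I w F + lnorm q I w G) := by
  obtain ⟨v, hv, -, D, hD, h⟩ := hw.exists_measurable
  refine ⟨q.LpAddConst * ENNReal.ofReal D, ENNReal.mul_ne_top (ENNReal.LpAddConst_lt_top q).ne
    ENNReal.ofReal_ne_top, fun I hI hI0 F G hF hG => ?_⟩
  have key : ∀ F : ℝ → ℝ≥0∞, lnorm q I v F ≤ ENNReal.ofReal D * lnorm q I w F := fun F =>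
    lnorm_le_const_mul hI ENNReal.ofReal_ne_top fun u hu => by
      rw [← mul_assoc, ← ENNReal.ofReal_mul hD.le]
      gcongr
      exact (h u (hI0 hu)).2
  have hadd : lnorm q I v (fun u => F u + G u)
      ≤ q.LpAddConst * (lnorm q I v F + lnorm q I v G) := by
    refine le_trans (le_of_eq ?_) (eLpNorm_add_le' (f := fun u => ENNReal.ofReal (v u) * F u)
      (g := fun u => ENNReal.ofReal (v u) * G u) ?_ ?_ q)
    · rw [lnorm]; congr 1; ext u; simp [mul_add]
    · exact (by fun_prop : Measurable _).aestronglyMeasurable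
    · exact (by fun_prop : Measurable _).aestronglyMeasurable
  calc lnorm q I w (fun u => F u + G u) ≤ lnorm q I v (fun u => F u + G u) :=
        lnorm_mono hI fun u hu => by gcongr; exact (h u (hI0 hu)).1
    _ ≤ q.LpAddConst * (ENNReal.ofReal D * lnorm q I w F + ENNReal.ofReal D * lnorm q I w G) :=
        hadd.trans (by gcongr <;> exact key _)
    _ = _ := by ring

/-! ### A Hardy type inequality -/

theorem logMeasure_restrict_Iio (t : ℝ) :
    logMeasure.restrict (Iio t) = logMeasure.restrict (Ioo 0 t) := by
  conv_lhs => rw [← restrict_logMeasure_Ioi, Measure.restrict_restrict measurableSet_Iio]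
  congr 1; ext u; simp [and_comm]

theorem lintegral_mul_lintegral_Ioo {φ ψ : ℝ → ℝ≥0∞} (hφ : Measurable φ) (hψ : Measurable ψ) :
    ∫⁻ t, φ t * ∫⁻ u in Ioo 0 t, ψ u ∂logMeasure ∂logMeasure
      = ∫⁻ u, ψ u * ∫⁻ t in Ioi u, φ t ∂logMeasure ∂logMeasure := by
  have hm : Measurable (Function.uncurry fun t u : ℝ => if u < t then φ t * ψ u else 0) := by
    refine Measurable.ite (measurableSet_lt measurable_snd measurable_fst) ?_ measurable_const
    fun_prop
  calc ∫⁻ t, φ t * ∫⁻ u in Ioo 0 t, ψ u ∂logMeasure ∂logMeasure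
      = ∫⁻ t, ∫⁻ u, (if u < t then φ t * ψ u else 0) ∂logMeasure ∂logMeasure := by
        refine lintegral_congr fun t => ?_
        rw [← logMeasure_restrict_Iio, ← lintegral_const_mul _ hψ,
          ← lintegral_indicator measurableSet_Iio]
        refine lintegral_congr fun u => ?_
        simp [indicator_apply]
    _ = ∫⁻ u, ∫⁻ t, (if u < t then φ t * ψ u else 0) ∂logMeasure ∂logMeasure :=
        lintegral_lintegral_swap hm.aemeasurable
    _ = _ := by
        refine lintegral_congr fun u => ?_
        rw [← lintegral_const_mul _ hφ, ← lintegral_indicator measurableSet_Ioi]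
        refine lintegral_congr fun t => ?_
        simp [indicator_apply, mul_comm]

/-- Inner and outer exponents agree. For finite r, Tonelli's theorem therefore leaves only the tail
norm of `v`, which is at most a multiple of v(u) because the index is negative. For r = ∞ it is
enough that `v` decreases up to a constant. -/
theorem RegVar.lnorm_lnorm_Ioo_le_of_measurable {r : ℝ≥0∞} (hr : 0 < r) {δ : ℝ} (hδ : δ < 0)
    {v w : ℝ → ℝ} (hv : RegVar δ v) (hvm : Measurable v) (hwm : Measurable w) :
    ∃ C : ℝ≥0∞, C ≠ ∞ ∧ ∀ F : ℝ → ℝ≥0∞, Measurable F →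
      lnorm r (Ioi 0) v (fun t => lnorm r (Ioo 0 t) w F)
        ≤ C * lnorm r (Ioi 0) (fun u => v u * w u) F := by
  rcases eq_or_ne r ∞ with rfl | hr'
  -- The choice ε = -δ cancels the index, leaving v(t) ≤ C v(u) for u ≤ t.
  · obtain ⟨C, hC, h⟩ := hv.bound (-δ) (neg_pos.2 hδ)
    refine ⟨ENNReal.ofReal C, ENNReal.ofReal_ne_top, fun F hF => ?_⟩
    rw [lnorm_top]
    refine essSup_le_of_ae_le _ ?_
    filter_upwards [ae_restrict_mem measurableSet_Ioi] with t ht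
    rw [← lnorm_const_mul _ _ _ ENNReal.ofReal_ne_top]
    refine (lnorm_le_const_mul (w' := fun u => v u * w u) (g' := F) (c := ENNReal.ofReal C)
      measurableSet_Ioo ENNReal.ofReal_ne_top ?_).trans
      (mul_le_mul_right (lnorm_mono_set _ (fun u hu => hu.1) _ _) _)
    intro u hu
    have h1 := (h u t hu.1 hu.2.le).1
    have hvu := hv.pos u hu.1
    rw [neg_add_cancel, Real.rpow_zero, mul_one] at h1
    calc ENNReal.ofReal (w u) * (ENNReal.ofReal (v t) * F u)
        ≤ ENNReal.ofReal (w u) * (ENNReal.ofReal (C * v u) * F u) := by gcongr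
      _ = _ := by
        rw [ENNReal.ofReal_mul hC.le, ENNReal.ofReal_mul hvu.le]; ring
  · have hpos := ENNReal.toReal_pos hr.ne' hr'
    obtain ⟨C, hC, h⟩ := hv.lnorm_Ioi_le hr hδ
    refine ⟨C, hC, fun F hF => ?_⟩
    rw [← lnorm_const_mul _ _ _ hC]
    simp only [lnorm_eq_lintegral hr.ne' hr', restrict_logMeasure_Ioi] at h ⊢
    set p := r.toReal
    have hcancel : ∀ x : ℝ≥0∞, (x ^ (1 / p)) ^ p = x := fun x => by
      rw [← ENNReal.rpow_mul, one_div_mul_cancel hpos.ne', ENNReal.rpow_one]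
    gcongr ?_ ^ (1 / p)
    simp only [ENNReal.mul_rpow_of_nonneg _ _ hpos.le, hcancel, mul_one] at h ⊢
    simp only [← ENNReal.mul_rpow_of_nonneg _ _ hpos.le]
    rw [lintegral_mul_lintegral_Ioo (by fun_prop) (by fun_prop)]
    refine lintegral_mono_ae ?_
    filter_upwards [ae_logMeasure_pos] with u hu
    have h1 := ENNReal.rpow_le_rpow (h u hu) hpos.le
    rw [hcancel] at h1
    refine (mul_le_mul_right h1 _).trans_eq ?_
    rw [← ENNReal.mul_rpow_of_nonneg _ _ hpos.le, ENNReal.ofReal_mul (hv.pos u hu).le]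
    congr 1; ring

theorem RegVar.lnorm_lnorm_Ioo_le {r : ℝ≥0∞} (hr : 0 < r) {δ β : ℝ} (hδ : δ < 0)
    {v w : ℝ → ℝ} (hv : RegVar δ v) (hw : RegVar β w) :
    ∃ C : ℝ≥0∞, C ≠ ∞ ∧ ∀ F : ℝ → ℝ≥0∞, Measurable F →
      lnorm r (Ioi 0) v (fun t => lnorm r (Ioo 0 t) w F)
        ≤ C * lnorm r (Ioi 0) (fun u => v u * w u) F := by
  obtain ⟨v', hvm, hv', D, hD, hvv⟩ := hv.exists_measurable
  obtain ⟨w', hwm, hw', E, hE, hww⟩ := hw.exists_measurable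
  obtain ⟨C, hC, h⟩ := hv'.lnorm_lnorm_Ioo_le_of_measurable hr hδ hvm hwm
  refine ⟨C * ENNReal.ofReal (D * E), by finiteness, fun F hF => ?_⟩
  calc lnorm r (Ioi 0) v (fun t => lnorm r (Ioo 0 t) w F)
      ≤ lnorm r (Ioi 0) v' (fun t => lnorm r (Ioo 0 t) w' F) := by
        refine lnorm_mono measurableSet_Ioi fun t ht => ?_
        gcongr
        · exact (hvv t ht).1
        · exact lnorm_mono measurableSet_Ioo fun u hu => by gcongr; exact (hww u hu.1).1
    _ ≤ C * lnorm r (Ioi 0) (fun u => v' u * w' u) F := h F hF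
    _ ≤ C * (ENNReal.ofReal (D * E) * lnorm r (Ioi 0) (fun u => v u * w u) F) := by
        gcongr
        refine lnorm_le_const_mul measurableSet_Ioi ENNReal.ofReal_ne_top fun u hu => ?_
        have hvu := hv.pos u hu
        have hwu' := (hw'.pos u hu).le
        rw [← mul_assoc, ← ENNReal.ofReal_mul (by positivity)]
        have h1 : v' u * w' u ≤ D * E * (v u * w u) :=
          (mul_le_mul (hvv u hu).2 (hww u hu).2 hwu' (by positivity)).trans_eq (by ring)
        gcongr
    _ = _ := by ring

/-! ### Change of variables -/

/-- A substitute for a change of variables in the manner of Schur's test. Averaging G(t)^p over the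
section of `S` above t costs `c`; after exchanging the integrals, the opposite section costs `c'`.
For r = ∞, a section of positive measure contains a τ at which F is below its essential supremum. -/
theorem exists_eLpNorm_le_of_kernel {S : Set (ℝ × ℝ)} (hS : MeasurableSet S) {C c c' : ℝ≥0∞}
    (hC : C ≠ ∞) (hc0 : c ≠ 0) (hc : c ≠ ∞) (hc' : c' ≠ ∞) {r : ℝ≥0∞} (hr : 0 < r)
    (h₁ : ∀ t, 0 < t → c ≤ logMeasure {τ | (t, τ) ∈ S})
    (h₂ : ∀ τ, 0 < τ → logMeasure {t | (t, τ) ∈ S} ≤ c') :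
    ∃ K : ℝ≥0∞, K ≠ ∞ ∧ ∀ G F : ℝ → ℝ≥0∞, Measurable G → Measurable F →
      (∀ t τ, 0 < t → 0 < τ → (t, τ) ∈ S → G t ≤ C * F τ) →
      eLpNorm G r logMeasure ≤ K * eLpNorm F r logMeasure := by
  rcases eq_or_ne r ∞ with rfl | hr'
  · refine ⟨C, hC, fun G F _ _ h => ?_⟩
    simp only [eLpNorm_exponent_top, eLpNormEssSup, enorm_eq_self]
    refine essSup_le_of_ae_le _ ?_
    filter_upwards [ae_logMeasure_pos] with t ht
    by_contra hcon
    have : logMeasure {τ | (t, τ) ∈ S} = 0 := by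
      have h0 : ∀ᵐ τ ∂logMeasure, ¬ (t, τ) ∈ S := by
        filter_upwards [ae_logMeasure_pos, ENNReal.ae_le_essSup F] with τ hτ hF hmem
        exact hcon ((h t τ ht hτ hmem).trans (by gcongr))
      simpa [ae_iff] using h0
    exact hc0 (le_zero_iff.1 ((h₁ t ht).trans_eq this))
  · have hpos := ENNReal.toReal_pos hr.ne' hr'
    set p := r.toReal with hp
    refine ⟨(c⁻¹ * (C ^ p * c')) ^ (1 / p), ENNReal.rpow_ne_top_of_nonneg (by positivity)
      (ENNReal.mul_ne_top (ENNReal.inv_ne_top.2 hc0) (ENNReal.mul_ne_top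
        (ENNReal.rpow_ne_top_of_nonneg hpos.le hC) hc')), fun G F hG hF h => ?_⟩
    simp only [eLpNorm_eq_lintegral_rpow_enorm_toReal hr.ne' hr', enorm_eq_self, ← hp]
    rw [← ENNReal.mul_rpow_of_nonneg _ _ (by positivity)]
    gcongr ?_ ^ (1 / p)
    have hm : ∀ A : Set ℝ, MeasurableSet A → ∀ x : ℝ≥0∞,
        ∫⁻ y, A.indicator (fun _ => x) y ∂logMeasure = x * logMeasure A := by
      intro A hA x
      rw [lintegral_indicator hA, setLIntegral_const]
    have hS1 : ∀ t, MeasurableSet {τ | (t, τ) ∈ S} := fun t => measurable_prodMk_left hS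
    have hS2 : ∀ τ, MeasurableSet {t | (t, τ) ∈ S} := fun τ => measurable_prodMk_right hS
    have key : c * ∫⁻ t, G t ^ p ∂logMeasure ≤ C ^ p * c' * ∫⁻ t, F t ^ p ∂logMeasure := calc
      c * ∫⁻ t, G t ^ p ∂logMeasure = ∫⁻ t, c * G t ^ p ∂logMeasure :=
          (lintegral_const_mul' _ _ hc).symm
      _ ≤ ∫⁻ t, ∫⁻ τ, S.indicator (fun z => C ^ p * F z.2 ^ p) (t, τ) ∂logMeasure ∂logMeasure := by
          refine lintegral_mono_ae ?_
          filter_upwards [ae_logMeasure_pos] with t ht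
          calc c * G t ^ p ≤ G t ^ p * logMeasure {τ | (t, τ) ∈ S} := by
                rw [mul_comm]; gcongr; exact h₁ t ht
            _ = ∫⁻ τ, {τ | (t, τ) ∈ S}.indicator (fun _ => G t ^ p) τ ∂logMeasure :=
                (hm _ (hS1 t) _).symm
            _ ≤ _ := by
                refine lintegral_mono_ae ?_
                filter_upwards [ae_logMeasure_pos] with τ hτ
                by_cases hz : (t, τ) ∈ S
                · rw [indicator_of_mem hz, indicator_of_mem (show τ ∈ {τ | (t, τ) ∈ S} from hz),
                    ← ENNReal.mul_rpow_of_nonneg _ _ hpos.le]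
                  exact ENNReal.rpow_le_rpow (h t τ ht hτ hz) hpos.le
                · rw [indicator_of_notMem (show τ ∉ {τ | (t, τ) ∈ S} from hz)]
                  exact zero_le
      _ = ∫⁻ τ, ∫⁻ t, S.indicator (fun z => C ^ p * F z.2 ^ p) (t, τ) ∂logMeasure ∂logMeasure := by
          refine lintegral_lintegral_swap (Measurable.aemeasurable ?_)
          exact Measurable.indicator (by fun_prop) hS
      _ ≤ ∫⁻ τ, C ^ p * c' * F τ ^ p ∂logMeasure := by
          refine lintegral_mono_ae ?_
          filter_upwards [ae_logMeasure_pos] with τ hτ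
          calc ∫⁻ t, S.indicator (fun z => C ^ p * F z.2 ^ p) (t, τ) ∂logMeasure
              = ∫⁻ t, {t | (t, τ) ∈ S}.indicator (fun _ => C ^ p * F τ ^ p) t ∂logMeasure := rfl
            _ = C ^ p * F τ ^ p * logMeasure {t | (t, τ) ∈ S} := hm _ (hS2 τ) _
            _ ≤ C ^ p * F τ ^ p * c' := by gcongr; exact h₂ τ hτ
            _ = _ := by ring
      _ = _ := lintegral_const_mul _ (by fun_prop)
    calc ∫⁻ t, G t ^ p ∂logMeasure = c⁻¹ * (c * ∫⁻ t, G t ^ p ∂logMeasure) := by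
          rw [← mul_assoc, ENNReal.inv_mul_cancel hc0 hc, one_mul]
      _ ≤ c⁻¹ * (C ^ p * c' * ∫⁻ t, F t ^ p ∂logMeasure) := by gcongr
      _ = _ := by ring

theorem lnorm_Ioi_zero (q : ℝ≥0∞) (w : ℝ → ℝ) (g : ℝ → ℝ≥0∞) :
    lnorm q (Ioi 0) w g = eLpNorm (fun u => ENNReal.ofReal (w u) * g u) q logMeasure := by
  rw [lnorm, restrict_logMeasure_Ioi]

/-! ### Substitution by a function of index one. -/

section

variable {ρ : ℝ → ℝ} (hρ : RegVar 1 ρ)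
include hρ

/-- A function of index 1 grows at least like the power 1/2, up to a constant, so two points with
comparable values of ρ have bounded ratio. The set in question thus lies in an interval of bounded
logarithmic length. -/
theorem RegVar.exists_logMeasure_level_le : ∃ c' : ℝ≥0∞, c' ≠ ∞ ∧ ∀ τ, 0 < τ →
    logMeasure {t | ρ t < τ ∧ τ < 2 * ρ t} ≤ c' := by
  obtain ⟨C, hC, h⟩ := hρ.bound (1 / 2) (by norm_num)
  -- From (t/s)^{1/2} ≤ 2C, squared.
  set M : ℝ := (2 * C) ^ 2 with hM
  have hM0 : 0 < M := by positivity
  have key : ∀ s t : ℝ, 0 < s → s ≤ t → ρ t < 2 * ρ s → t ≤ M * s := by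
    intro s t hs hst hlt
    have ht := hs.trans_le hst
    have h0 : 0 < t / s := by positivity
    have h1 := (h s t hs hst).2
    have hρs := hρ.pos s hs
    have h2 : (t / s) ^ (1 / 2 : ℝ) ≤ 2 * C := by
      have e : (t / s) ^ (1 / 2 - 1 : ℝ) = ((t / s) ^ (1 / 2 : ℝ))⁻¹ := by
        rw [← Real.rpow_neg h0.le]; norm_num
      have p : 0 < (t / s) ^ (1 / 2 : ℝ) := by positivity
      rw [e] at h1
      have h3 : (t / s) ^ (1 / 2 : ℝ) * ρ s ≤ C * ρ t := by
        have := mul_le_mul_of_nonneg_left h1 p.le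
        refine this.trans_eq ?_
        field_simp
      have h4 : (t / s) ^ (1 / 2 : ℝ) * ρ s ≤ 2 * C * ρ s := by nlinarith
      exact le_of_mul_le_mul_right h4 hρs
    have h5 : t / s ≤ M := by
      have := pow_le_pow_left₀ (by positivity) h2 2
      rwa [← Real.rpow_natCast, ← Real.rpow_mul h0.le, show (1 / 2 : ℝ) * (2 : ℕ) = 1 by norm_num,
        Real.rpow_one] at this
    exact (div_le_iff₀ hs).1 h5
  refine ⟨ENNReal.ofReal (Real.log (2 * M * (2 * M))), ENNReal.ofReal_ne_top, fun τ hτ => ?_⟩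
  set A := {t | ρ t < τ ∧ τ < 2 * ρ t}
  have hA : logMeasure A ≤ logMeasure (A ∩ Ioi 0) := by
    refine measure_mono_ae ?_
    filter_upwards [ae_logMeasure_pos] with t ht hA using ⟨hA, ht⟩
  refine hA.trans ?_
  rcases (A ∩ Ioi 0).eq_empty_or_nonempty with he | ⟨s, hsA, hs⟩
  · rw [he]; simp
  have hs : 0 < s := hs
  have hsub : A ∩ Ioi 0 ⊆ Ioo (s / (2 * M)) (2 * M * s) := by
    rintro t ⟨htA, ht⟩
    have ht : 0 < t := ht
    have hM1 : 0 < M * s := by positivity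
    have hM2 : 0 < M * t := by positivity
    have h1 : t ≤ M * s ∨ t ≤ s := by
      rcases le_total s t with hst | hst
      · exact Or.inl (key s t hs hst (htA.1.trans hsA.2))
      · exact Or.inr hst
    have h2 : s ≤ M * t ∨ s ≤ t := by
      rcases le_total t s with hst | hst
      · exact Or.inl (key t s ht hst (hsA.1.trans htA.2))
      · exact Or.inr hst
    have hM1' : s ≤ M * s := key s s hs le_rfl (by linarith [hρ.pos s hs])
    have hM2' : t ≤ M * t := key t t ht le_rfl (by linarith [hρ.pos t ht])
    refine ⟨?_, ?_⟩
    · rw [div_lt_iff₀ (by positivity)]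
      rcases h2 with h2 | h2 <;> nlinarith
    · rcases h1 with h1 | h1 <;> nlinarith
  refine (measure_mono hsub).trans_eq ?_
  rw [logMeasure_Ioo (by positivity) (by positivity)]
  congr 2
  field_simp

/-- As ρ may jump, τ need not be close to a value of ρ, and a larger window cτ is allowed. Past t₀ =
sup{ρ ≤ τ} one has ρ > τ, while a point t₁ > t₀/2 with ρ(t₁) ≤ τ bounds ρ on (t₀, 2t₀); this
interval has measure log 2. -/
theorem RegVar.exists_le_logMeasure_level : ∃ c : ℝ, 2 ≤ c ∧ ∀ τ, 0 < τ →
    ENNReal.ofReal (Real.log 2) ≤ logMeasure {t | ρ t < c * τ ∧ τ < 2 * ρ t} := by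
  obtain ⟨C, hC, h⟩ := hρ.bound (1 / 2) (by norm_num)
  refine ⟨2 + C * (4 : ℝ) ^ (1 / 2 + 1 : ℝ), by
    have : 0 < C * (4 : ℝ) ^ (1 / 2 + 1 : ℝ) := by positivity
    linarith, fun τ hτ => ?_⟩
  have hρ1 := hρ.pos 1 one_pos
  set A := {t | 0 < t ∧ ρ t ≤ τ}
  have hsqrt : ∀ x : ℝ, 0 < x → (x ^ 2) ^ (1 / 2 : ℝ) = x := fun x hx => by
    rw [← Real.rpow_natCast, ← Real.rpow_mul hx.le]; norm_num
  have hne : A.Nonempty := by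
    -- The bound with exponent 1/2 gives ρ(x²) ≤ C x ρ(1), and `x` is chosen to make this at most τ.
    -- The upper bound y² for `A` below comes from the same estimate on the other side of 1.
    set x := min 1 (τ / (C * ρ 1)) with hx
    have hx0 : 0 < x := lt_min one_pos (by positivity)
    have hx1 : x ≤ 1 := min_le_left _ _
    refine ⟨x ^ 2, by positivity, ?_⟩
    have h1 := (h (x ^ 2) 1 (by positivity) (pow_le_one₀ hx0.le hx1)).2
    rw [show (1 / 2 - 1 : ℝ) = -(1 / 2) by norm_num, one_div (x ^ 2), Real.inv_rpow (by positivity),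
      Real.rpow_neg (by positivity), inv_inv, hsqrt x hx0] at h1
    refine h1.trans ?_
    have h2 : x ≤ τ / (C * ρ 1) := min_le_right _ _
    rw [le_div_iff₀ (by positivity)] at h2
    linarith
  have hbdd : BddAbove A := by
    set y := max 1 (C * τ / ρ 1) with hy
    have hy1 : 1 ≤ y := le_max_left _ _
    refine ⟨y ^ 2, fun t ht => ?_⟩
    by_contra hcon
    rw [not_le] at hcon
    have ht1 : 1 ≤ t := (one_le_pow₀ hy1).trans hcon.le
    have h1 := (h 1 t one_pos ht1).2
    rw [div_one, show (1 / 2 - 1 : ℝ) = -(1 / 2) by norm_num, Real.rpow_neg ht.1.le] at h1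
    have h2 : y < t ^ (1 / 2 : ℝ) := by
      rw [← hsqrt y (by positivity)]
      exact Real.rpow_lt_rpow (by positivity) hcon (by norm_num)
    have h3 : C * τ / ρ 1 ≤ y := le_max_right _ _
    have p : 0 < t ^ (1 / 2 : ℝ) := h2.trans' (by positivity)
    have h4 : ρ 1 * t ^ (1 / 2 : ℝ) ≤ C * ρ t := by
      have := mul_le_mul_of_nonneg_right h1 p.le
      refine this.trans_eq ?_
      field_simp
    have h5 : C * ρ t ≤ C * τ := by gcongr; exact ht.2
    have h6 : C * τ < t ^ (1 / 2 : ℝ) * ρ 1 := by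
      rw [← div_lt_iff₀ hρ1]; linarith
    linarith
  obtain ⟨t₂, ht₂⟩ := hne
  set t₀ := sSup A with ht₀
  have ht₀pos : 0 < t₀ := ht₂.1.trans_le (le_csSup hbdd ht₂)
  obtain ⟨t₁, ht₁, hlt⟩ := exists_lt_of_lt_csSup ⟨t₂, ht₂⟩ (show t₀ / 2 < sSup A by linarith)
  have hsub : Ioo t₀ (2 * t₀) ⊆ {t | ρ t < (2 + C * (4 : ℝ) ^ (1 / 2 + 1 : ℝ)) * τ ∧ τ < 2 * ρ t} := by
    intro t ht
    have htpos : 0 < t := ht₀pos.trans ht.1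
    have h1 : τ < ρ t := by
      by_contra hcon
      exact absurd (le_csSup hbdd (show t ∈ A from ⟨htpos, not_lt.1 hcon⟩)) (not_le.2 ht.1)
    have h2 : t₁ ≤ t := (le_csSup hbdd ht₁).trans ht.1.le
    -- This explains the 4 in the constant: t < 2t₀ and t₁ > t₀/2.
    have h3 : t / t₁ ≤ 4 := by
      rw [div_le_iff₀ ht₁.1]
      have := ht.2
      linarith
    have h0 : 0 < t / t₁ := div_pos htpos ht₁.1
    have h4 : ρ t ≤ C * (4 : ℝ) ^ (1 / 2 + 1 : ℝ) * τ := by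
      refine (h t₁ t ht₁.1 h2).1.trans ?_
      have := ht₁.2
      have := (hρ.pos t₁ ht₁.1).le
      gcongr
    exact ⟨by linarith, by linarith⟩
  refine (le_of_eq ?_).trans (measure_mono hsub)
  rw [logMeasure_Ioo ht₀pos (by positivity)]
  congr 2
  field_simp

variable {α : ℝ} {w : ℝ → ℝ} (hw : RegVar α w)
include hw

/-- The kernel is ρ(t) < τ < 2ρ(t), where w(τ) and w(ρ(t)) are comparable and g(ρ(t)) ≤ g(τ). The
converse below exchanges the variables, widens the window, and uses that g(t)/t decreases to get
g(τ) ≤ 2 g(ρ(t)). -/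
theorem lnorm_comp_le_of_measurable (hρm : Measurable ρ) (hwm : Measurable w) {r : ℝ≥0∞}
    (hr : 0 < r) : ∃ K : ℝ≥0∞, K ≠ ∞ ∧ ∀ g : ℝ → ℝ≥0∞, QuasiConcave g →
      lnorm r (Ioi 0) (fun t => w (ρ t)) (fun t => g (ρ t)) ≤ K * lnorm r (Ioi 0) w g := by
  obtain ⟨c', hc', h'⟩ := hρ.exists_logMeasure_level_le
  obtain ⟨D, hD, k⟩ := hw.le_of_comparable two_pos
  have hlog : ENNReal.ofReal (Real.log 2) ≠ 0 := by simpa using Real.log_pos one_lt_two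
  obtain ⟨K, hK, h⟩ := exists_eLpNorm_le_of_kernel
    (S := {z : ℝ × ℝ | ρ z.1 < z.2 ∧ z.2 < 2 * ρ z.1})
    ((measurableSet_lt (f := fun z : ℝ × ℝ => ρ z.1) (g := fun z => z.2) (by fun_prop)
      (by fun_prop)).inter (measurableSet_lt (f := fun z : ℝ × ℝ => z.2)
        (g := fun z => 2 * ρ z.1) (by fun_prop) (by fun_prop)))
    (C := ENNReal.ofReal D) ENNReal.ofReal_ne_top hlog ENNReal.ofReal_ne_top hc' hr
    (fun t ht => by
      have hρt := hρ.pos t ht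
      refine le_of_eq ?_
      change _ = logMeasure (Ioo (ρ t) (2 * ρ t))
      rw [logMeasure_Ioo hρt (by positivity)]
      congr 2
      field_simp)
    h'
  refine ⟨K, hK, fun g hg => ?_⟩
  have := hg.mono.measurable
  rw [lnorm_Ioi_zero, lnorm_Ioi_zero]
  refine h _ _ (by fun_prop) (by fun_prop) fun t τ ht hτ hz => ?_
  rw [← mul_assoc, ← ENNReal.ofReal_mul hD.le]
  have hz1 : ρ t < τ := hz.1
  have hz2 : τ < 2 * ρ t := hz.2
  gcongr
  · exact k _ _ (hρ.pos t ht) hτ (by linarith) hz2.le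
  · exact hg.mono hz1.le

theorem lnorm_le_comp_of_measurable (hρm : Measurable ρ) (hwm : Measurable w) {r : ℝ≥0∞}
    (hr : 0 < r) : ∃ K : ℝ≥0∞, K ≠ ∞ ∧ ∀ g : ℝ → ℝ≥0∞, QuasiConcave g →
      lnorm r (Ioi 0) w g ≤ K * lnorm r (Ioi 0) (fun t => w (ρ t)) (fun t => g (ρ t)) := by
  obtain ⟨c, hc, h'⟩ := hρ.exists_le_logMeasure_level
  have hc0 : 0 < c := by linarith
  obtain ⟨D, hD, k⟩ := hw.le_of_comparable hc0
  have hlog : ENNReal.ofReal (Real.log 2) ≠ 0 := by simpa using Real.log_pos one_lt_two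
  obtain ⟨K, hK, h⟩ := exists_eLpNorm_le_of_kernel
    (S := {z : ℝ × ℝ | ρ z.2 < c * z.1 ∧ z.1 < 2 * ρ z.2})
    ((measurableSet_lt (f := fun z : ℝ × ℝ => ρ z.2) (g := fun z => c * z.1) (by fun_prop)
      (by fun_prop)).inter (measurableSet_lt (f := fun z : ℝ × ℝ => z.1)
        (g := fun z => 2 * ρ z.2) (by fun_prop) (by fun_prop)))
    (C := ENNReal.ofReal D * ENNReal.ofReal 2) (by finiteness) hlog ENNReal.ofReal_ne_top
    (c' := ENNReal.ofReal (Real.log (2 * c))) ENNReal.ofReal_ne_top hr h'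
    (fun t ht => by
      have hρt := hρ.pos t ht
      have : {τ | (τ, t) ∈ {z : ℝ × ℝ | ρ z.2 < c * z.1 ∧ z.1 < 2 * ρ z.2}}
          ⊆ Ioo (ρ t / c) (2 * ρ t) := by
        rintro τ ⟨h1, h2⟩
        exact ⟨by rw [div_lt_iff₀ hc0, mul_comm]; exact h1, h2⟩
      refine (measure_mono this).trans_eq ?_
      rw [logMeasure_Ioo (by positivity) (by positivity)]
      congr 2
      field_simp)
  refine ⟨K, hK, fun g hg => ?_⟩
  have := hg.mono.measurable
  rw [lnorm_Ioi_zero, lnorm_Ioi_zero]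
  refine h _ _ (by fun_prop) (by fun_prop) fun τ t hτ ht hz => ?_
  have hz1 : ρ t < c * τ := hz.1
  have hz2 : τ < 2 * ρ t := hz.2
  have hρt := hρ.pos t ht
  calc ENNReal.ofReal (w τ) * g τ
      ≤ ENNReal.ofReal (D * w (ρ t)) * (ENNReal.ofReal 2 * g (ρ t)) := by
        gcongr
        · exact k _ _ hτ hρt (by nlinarith) hz1.le
        · exact hg.le_of_le_mul hρt one_le_two hz2.le
    _ = _ := by rw [ENNReal.ofReal_mul hD.le]; ring

theorem exists_lnorm_comp_equiv {r : ℝ≥0∞} (hr : 0 < r) : ∃ K : ℝ≥0∞, K ≠ ∞ ∧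
    ∀ g : ℝ → ℝ≥0∞, QuasiConcave g →
      lnorm r (Ioi 0) (fun t => w (ρ t)) (fun t => g (ρ t)) ≤ K * lnorm r (Ioi 0) w g ∧
      lnorm r (Ioi 0) w g ≤ K * lnorm r (Ioi 0) (fun t => w (ρ t)) (fun t => g (ρ t)) := by
  obtain ⟨σ, hσm, hσ, D, hD, hρσ⟩ := hρ.exists_measurable
  obtain ⟨v, hvm, hv, E, hE, hwv⟩ := hw.exists_measurable
  obtain ⟨K₁, hK₁, h₁⟩ := lnorm_comp_le_of_measurable hσ hv hσm hvm hr
  obtain ⟨K₂, hK₂, h₂⟩ := lnorm_le_comp_of_measurable hσ hv hσm hvm hr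
  have hc : 0 < 1 + D := by positivity
  obtain ⟨B, hB, k⟩ := hv.le_of_comparable hc
  have c1 : ∀ t, 0 < t → ρ t ≤ (1 + D) * σ t := fun t ht => by
    have := (hρσ t ht).1
    have := hσ.pos t ht
    nlinarith
  have c2 : ∀ t, 0 < t → σ t ≤ (1 + D) * ρ t := fun t ht => by
    have := (hρσ t ht).2
    have := hρ.pos t ht
    nlinarith
  refine ⟨ENNReal.ofReal B * K₁ * ENNReal.ofReal E
    + K₂ * (ENNReal.ofReal (B * E) * ENNReal.ofReal (1 + D)), by finiteness, fun g hg => ⟨?_, ?_⟩⟩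
  · calc lnorm r (Ioi 0) (fun t => w (ρ t)) (fun t => g (ρ t))
        ≤ ENNReal.ofReal B * lnorm r (Ioi 0) (fun t => v (σ t)) (fun t => g (σ t)) := by
          refine lnorm_le_const_mul measurableSet_Ioi ENNReal.ofReal_ne_top fun t ht => ?_
          rw [← mul_assoc, ← ENNReal.ofReal_mul hB.le]
          have hρt := hρ.pos t ht
          gcongr
          · exact (hwv _ hρt).1.trans (k _ _ hρt (hσ.pos t ht) (c1 t ht) (c2 t ht))
          · exact hg.mono (hρσ t ht).1
      _ ≤ ENNReal.ofReal B * (K₁ * (ENNReal.ofReal E * lnorm r (Ioi 0) w g)) := by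
          gcongr
          refine (h₁ g hg).trans ?_
          gcongr
          refine lnorm_le_const_mul measurableSet_Ioi ENNReal.ofReal_ne_top fun t ht => ?_
          rw [← mul_assoc, ← ENNReal.ofReal_mul hE.le]
          gcongr
          exact (hwv t ht).2
      _ = ENNReal.ofReal B * K₁ * ENNReal.ofReal E * lnorm r (Ioi 0) w g := by ring
      _ ≤ _ := by gcongr; exact le_self_add
  · calc lnorm r (Ioi 0) w g ≤ lnorm r (Ioi 0) v g :=
          lnorm_mono measurableSet_Ioi fun t ht => by gcongr; exact (hwv t ht).1
      _ ≤ K₂ * lnorm r (Ioi 0) (fun t => v (σ t)) (fun t => g (σ t)) := h₂ g hg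
      _ ≤ K₂ * (ENNReal.ofReal (B * E) * ENNReal.ofReal (1 + D) *
            lnorm r (Ioi 0) (fun t => w (ρ t)) (fun t => g (ρ t))) := by
          gcongr
          refine lnorm_le_const_mul measurableSet_Ioi (by finiteness) fun t ht => ?_
          have hρt := hρ.pos t ht
          calc ENNReal.ofReal (v (σ t)) * g (σ t)
              ≤ ENNReal.ofReal (B * E * w (ρ t)) * (ENNReal.ofReal (1 + D) * g (ρ t)) := by
                gcongr
                · rw [mul_assoc]
                  refine (k _ _ (hσ.pos t ht) hρt (c2 t ht) (c1 t ht)).trans ?_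
                  gcongr
                  exact (hwv _ hρt).2
                · exact hg.le_of_le_mul hρt (by linarith) (c2 t ht)
            _ = _ := by rw [ENNReal.ofReal_mul (by positivity)]; ring
      _ = K₂ * (ENNReal.ofReal (B * E) * ENNReal.ofReal (1 + D)) *
            lnorm r (Ioi 0) (fun t => w (ρ t)) (fun t => g (ρ t)) := by ring
      _ ≤ _ := by gcongr; exact le_add_self

end

/-! ### The functionals of an `R`-space -/

/-- `‖b(s) ‖a(u) g(u)‖_{q,(s,∞)}‖_{r,(0,∞)}` with respect to `du/u`. -/
noncomputable def normR (r : ℝ≥0∞) (b : ℝ → ℝ) (q : ℝ≥0∞) (a : ℝ → ℝ) (g : ℝ → ℝ≥0∞) : ℝ≥0∞ :=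
  lnorm r (Ioi 0) b fun s => lnorm q (Ioi s) a g

/-- `‖b(s) ‖a(u) g(u)‖_{q,(s,t)}‖_{r,(0,t)}` with respect to `du/u`. -/
noncomputable def partR (r : ℝ≥0∞) (b : ℝ → ℝ) (q : ℝ≥0∞) (a : ℝ → ℝ) (t : ℝ)
    (g : ℝ → ℝ≥0∞) : ℝ≥0∞ :=
  lnorm r (Ioo 0 t) b fun s => lnorm q (Ioo s t) a g

/-- The weight of an `R`-space with values in `[0,∞]`. -/
noncomputable def weightR (r : ℝ≥0∞) (b : ℝ → ℝ) (q : ℝ≥0∞) (a : ℝ → ℝ) (t : ℝ) : ℝ≥0∞ :=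
  lnorm r (Ioi t) b (fun s => lnorm q (Ioi s) a fun _ => 1)
    + lnorm r (Ioo 0 t) b (fun _ => 1) * lnorm q (Ioi t) a (fun _ => 1)

/-- The parameters of a nontrivial `R`-space. -/
structure RParams (r : ℝ≥0∞) (b : ℝ → ℝ) (q : ℝ≥0∞) (a : ℝ → ℝ) : Prop where
  hr : 0 < r
  hq : 0 < q
  hb : RegVar 0 b
  ha : RegVar 0 a
  left : lnorm r (Ioo 0 1) b (fun _ => 1) < ∞
  right : lnorm r (Ioi 1) b (fun s => lnorm q (Ioi s) a fun _ => 1) < ∞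

/-- Only finite constants can be moved through a norm; an infinite value is reached as a supremum of
finite ones. -/
theorem mul_le_of_forall_ne_top {A B x : ℝ≥0∞}
    (h : ∀ c : ℝ≥0∞, c ≠ ∞ → c ≤ x → A * c ≤ B) : A * x ≤ B := by
  rcases eq_or_ne x ∞ with rfl | hx
  · rw [← ENNReal.iSup_natCast, ENNReal.mul_iSup]
    exact iSup_le fun n => h n (ENNReal.natCast_ne_top n) le_top
  · exact h x hx le_rfl

theorem one_le_ofReal_div_rpow {s t ε : ℝ} (hs : 0 < s) (hst : s ≤ t) (hε : 0 ≤ ε) :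
    1 ≤ ENNReal.ofReal ((t / s) ^ ε) := by
  rw [ENNReal.one_le_ofReal]
  exact Real.one_le_rpow ((one_le_div hs).2 hst) hε

/-- Between s and t, a(u) is at most a constant times (t/u)^ε a(t); the norm of u^{-ε} beyond s is
of order s^{-ε}, and a(t) is controlled by the tail beyond t. -/
theorem RegVar.lnorm_tail_le {q : ℝ≥0∞} (hq : 0 < q) {a : ℝ → ℝ} (ha : RegVar 0 a) {ε : ℝ}
    (hε : 0 < ε) : ∃ C : ℝ≥0∞, C ≠ ∞ ∧ ∀ s t : ℝ, 0 < s → s ≤ t →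
      lnorm q (Ioi s) a (fun _ => 1)
        ≤ C * ENNReal.ofReal ((t / s) ^ ε) * lnorm q (Ioi t) a (fun _ => 1) := by
  obtain ⟨C₀, hC₀, h₀⟩ := exists_lnorm_Ioi_le hq
  obtain ⟨C₁, hC₁, h₁⟩ := (RegVar.rpow_id (-ε)).lnorm_Ioi_le hq (neg_lt_zero.2 hε)
  obtain ⟨C₂, hC₂, h₂⟩ := ha.le_lnorm_Ioi hq
  obtain ⟨D, hD, k⟩ := ha.bound ε hε
  refine ⟨C₀ * (ENNReal.ofReal D * C₁ * C₂ + 1), by finiteness, fun s t hs hst => ?_⟩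
  have ht := hs.trans_le hst
  have hat := ha.pos t ht
  set T := lnorm q (Ioi t) a (fun _ => 1)
  have e1 := one_le_ofReal_div_rpow hs hst hε.le
  have h3 : lnorm q (Ioo s t) a (fun _ => 1)
      ≤ ENNReal.ofReal D * C₁ * C₂ * ENNReal.ofReal ((t / s) ^ ε) * T := calc
    lnorm q (Ioo s t) a (fun _ => 1) ≤ ENNReal.ofReal (D * t ^ ε * a t) *
        lnorm q (Ioo s t) (fun u => u ^ (-ε)) (fun _ => 1) := by
        refine lnorm_le_const_mul measurableSet_Ioo ENNReal.ofReal_ne_top fun u hu => ?_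
        have hu0 : 0 < u := hs.trans hu.1
        rw [mul_one, mul_one, ← ENNReal.ofReal_mul (by positivity)]
        refine ENNReal.ofReal_le_ofReal ((k u t hu0 hu.2.le).2.trans_eq ?_)
        rw [sub_zero, Real.div_rpow ht.le hu0.le, Real.rpow_neg hu0.le]
        field_simp
    _ ≤ ENNReal.ofReal (D * t ^ ε * a t) * (C₁ * ENNReal.ofReal (s ^ (-ε))) := by
        gcongr
        exact (lnorm_mono_set _ (fun u hu => hu.1) _ _).trans (h₁ s hs)
    _ = ENNReal.ofReal D * C₁ * ENNReal.ofReal ((t / s) ^ ε) * ENNReal.ofReal (a t) := by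
        rw [ENNReal.ofReal_mul (by positivity), ENNReal.ofReal_mul hD.le,
          Real.div_rpow ht.le hs.le, Real.rpow_neg hs.le, div_eq_mul_inv (t ^ ε),
          ENNReal.ofReal_mul (p := t ^ ε) (by positivity)]
        ring
    _ ≤ ENNReal.ofReal D * C₁ * ENNReal.ofReal ((t / s) ^ ε) * (C₂ * T) := by
        gcongr; exact h₂ t ht
    _ = _ := by ring
  calc lnorm q (Ioi s) a (fun _ => 1)
      ≤ C₀ * (lnorm q (Ioo s t) a (fun _ => 1) + 1 * T) := by
        rw [one_mul]; exact h₀ s t hst _ _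
    _ ≤ C₀ * (ENNReal.ofReal D * C₁ * C₂ * ENNReal.ofReal ((t / s) ^ ε) * T
          + ENNReal.ofReal ((t / s) ^ ε) * T) := by gcongr
    _ = _ := by ring

/-! ### The weight of an R-space and the parts of its norm. -/

namespace RParams

variable {r q : ℝ≥0∞} {b a : ℝ → ℝ} (h : RParams r b q a)
include h

/-- An infinite tail at 2 would make all tails at s < 2 infinite, and the outer norm over (1, 2)
would contradict `right`. Finiteness then passes to every t by `lnorm_tail_le` or monotonicity. -/
theorem tail_ne_top {t : ℝ} (ht : 0 < t) : lnorm q (Ioi t) a (fun _ => 1) ≠ ∞ := by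
  have h2 : lnorm q (Ioi 2) a (fun _ => 1) ≠ ∞ := by
    intro hcon
    obtain ⟨C, hC, k⟩ := h.hb.mul_le_lnorm h.hr
    have h3 := k _ QuasiConcave.one 2 two_pos
    -- The interval (2/2, 2) is (1, 2) in the form in which `mul_le_lnorm` delivers it at t = 2.
    have h5 : (lnorm r (Ioo (2 / 2) 2) b fun _ => (∞ : ℝ≥0∞))
        ≤ lnorm r (Ioi 1) b (fun s => lnorm q (Ioi s) a fun _ => 1) := by
      refine (lnorm_mono_right measurableSet_Ioo _ fun u hu => ?_).trans
        (lnorm_mono_set _ (fun u hu => ?_) _ _)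
      · refine le_trans ?_ (lnorm_mono_set q (Ioi_subset_Ioi hu.2.le) _ _)
        rw [hcon]
      · have := hu.1
        norm_num at this
        exact this
    have hpos : lnorm r (Ioo (2 / 2) 2) b (fun _ => 1) ≠ 0 := by
      intro h0
      rw [h0, mul_zero, mul_one, le_zero_iff, ENNReal.ofReal_eq_zero] at h3
      exact absurd (h.hb.pos 2 two_pos) (not_lt.2 h3)
    have h6 : lnorm r (Ioo (2 / 2) 2) b (fun _ => 1) * ∞
        ≤ lnorm r (Ioi 1) b (fun s => lnorm q (Ioi s) a fun _ => 1) := by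
      refine mul_le_of_forall_ne_top fun c hc _ => ?_
      rw [mul_comm, ← lnorm_const _ _ _ hc]
      exact (lnorm_mono_right measurableSet_Ioo _ fun u _ => le_top).trans h5
    rw [ENNReal.mul_top hpos] at h6
    exact absurd h.right (not_lt.2 h6)
  rcases le_total t 2 with hle | hle
  · obtain ⟨C, hC, k⟩ := h.ha.lnorm_tail_le h.hq one_pos
    exact ne_top_of_le_ne_top (by finiteness) (k t 2 ht hle)
  · exact ne_top_of_le_ne_top h2 (lnorm_mono_set q (Ioi_subset_Ioi hle) _ _)

/-- When the cut moves from s to t, the mass of b on (s, t) passes from one summand of the weight to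
the other, and there the tail of a lies between its values at t and at s. So the weight decreases up
to a constant, yet slower than any power. -/
theorem weightR_le {ε : ℝ} (hε : 0 < ε) : ∃ C : ℝ≥0∞, C ≠ ∞ ∧ ∀ s t : ℝ, 0 < s → s ≤ t →
    weightR r b q a s ≤ C * ENNReal.ofReal ((t / s) ^ ε) * weightR r b q a t ∧
    weightR r b q a t ≤ C * weightR r b q a s := by
  obtain ⟨C₀, hC₀, h₀⟩ := exists_lnorm_Ioi_le h.hr
  obtain ⟨C₁, hC₁, h₁⟩ := h.ha.lnorm_tail_le h.hq hε
  obtain ⟨C₂, hC₂, h₂⟩ := exists_lnorm_Ioo_le h.hr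
  refine ⟨C₀ + (C₀ * C₁ + C₁) + (1 + C₂), by finiteness, fun s t hs hst => ?_⟩
  have ht := hs.trans_le hst
  have e1 := one_le_ofReal_div_rpow hs hst hε.le
  have hTt := h.tail_ne_top ht
  have hTs := h.tail_ne_top hs
  have h2 := h₁ s t hs hst
  set e := ENNReal.ofReal ((t / s) ^ ε)
  unfold weightR
  set Tt := lnorm q (Ioi t) a (fun _ => 1)
  set Ts := lnorm q (Ioi s) a (fun _ => 1)
  set R : ℝ → ℝ≥0∞ := fun s => lnorm q (Ioi s) a fun _ => 1
  have hR : Antitone R := fun x y hxy => lnorm_mono_set q (Ioi_subset_Ioi hxy) _ _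
  set P := lnorm r (Ioi t) b R
  set Bs := lnorm r (Ioo 0 s) b (fun _ => 1)
  set Bt := lnorm r (Ioo 0 t) b (fun _ => 1)
  have hBst : Bs ≤ Bt := lnorm_mono_set _ (Ioo_subset_Ioo_right hst) _ _
  constructor
  · have h3 : lnorm r (Ioo s t) b R ≤ Ts * Bt := by
      rw [← lnorm_const _ _ _ hTs]
      exact (lnorm_mono_right measurableSet_Ioo _ fun u hu => hR hu.1.le).trans
        (lnorm_mono_set _ (Ioo_subset_Ioo_left hs.le) _ _)
    calc lnorm r (Ioi s) b R + Bs * Ts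
        ≤ C₀ * (Ts * Bt + 1 * P) + Bt * Ts := by
          rw [one_mul]
          gcongr
          exact (h₀ s t hst _ _).trans (by gcongr)
      _ ≤ C₀ * (C₁ * e * Tt * Bt + e * P) + Bt * (C₁ * e * Tt) := by gcongr
      _ = e * (C₀ * P) + e * ((C₀ * C₁ + C₁) * (Bt * Tt)) := by ring
      _ ≤ e * ((C₀ + (C₀ * C₁ + C₁) + (1 + C₂)) * P)
          + e * ((C₀ + (C₀ * C₁ + C₁) + (1 + C₂)) * (Bt * Tt)) := by
          gcongr ?_ + e * (?_ * _)
          · gcongr; rw [add_assoc]; exact le_self_add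
          · exact le_add_self.trans le_self_add
      _ = _ := by ring
  · have hB : Bt ≤ C₂ * (Bs + lnorm r (Ioo s t) b (fun _ => 1)) := h₂ 0 s t hs.le hst _ _
    have hTT : Tt ≤ Ts := hR hst
    have h3 : lnorm r (Ioo s t) b (fun _ => 1) * Tt ≤ lnorm r (Ioi s) b R := by
      rw [mul_comm, ← lnorm_const _ _ _ hTt]
      exact (lnorm_mono_right measurableSet_Ioo _ fun u hu => hR hu.2.le).trans
        (lnorm_mono_set _ (fun u hu => hu.1) _ _)
    have h4 : P ≤ lnorm r (Ioi s) b R := lnorm_mono_set _ (Ioi_subset_Ioi hst) _ _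
    calc P + Bt * Tt ≤ P + C₂ * (Bs + lnorm r (Ioo s t) b (fun _ => 1)) * Tt := by gcongr
      _ = P + C₂ * (Bs * Tt + lnorm r (Ioo s t) b (fun _ => 1) * Tt) := by ring
      _ ≤ (lnorm r (Ioi s) b R + Bs * Ts) + C₂ * (Bs * Ts + lnorm r (Ioi s) b R) := by
          gcongr; exact h4.trans le_self_add
      _ = (1 + C₂) * (lnorm r (Ioi s) b R + Bs * Ts) := by ring
      _ ≤ _ := by gcongr ?_ * _; exact le_add_self

theorem weightR_ne_top {t : ℝ} (ht : 0 < t) : weightR r b q a t ≠ ∞ := by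
  obtain ⟨C, hC, k⟩ := h.weightR_le one_pos
  have h1 : weightR r b q a 1 ≠ ∞ := by
    have := h.left.ne
    have := h.right.ne
    have := h.tail_ne_top one_pos
    unfold weightR
    finiteness
  rcases le_total t 1 with hle | hle
  · exact ne_top_of_le_ne_top (by finiteness) (k t 1 ht hle).1
  · exact ne_top_of_le_ne_top (by finiteness) (k 1 t one_pos hle).2

theorem exists_mul_le_weightR : ∃ C : ℝ≥0∞, C ≠ ∞ ∧ ∀ t : ℝ, 0 < t →
    ENNReal.ofReal (b t * a t) ≤ C * weightR r b q a t := by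
  obtain ⟨C, hC, k⟩ := h.hb.mul_le_lnorm h.hr
  obtain ⟨D, hD, l⟩ := h.ha.le_lnorm_Ioi h.hq
  refine ⟨C * D, by finiteness, fun t ht => ?_⟩
  have hbt := h.hb.pos t ht
  have h1 := k _ QuasiConcave.one t ht
  rw [mul_one] at h1
  have h2 : lnorm r (Ioo (t / 2) t) b (fun _ => 1) ≤ lnorm r (Ioo 0 t) b (fun _ => 1) :=
    lnorm_mono_set _ (Ioo_subset_Ioo_left (by positivity)) _ _
  rw [ENNReal.ofReal_mul hbt.le]
  calc _ ≤ (C * lnorm r (Ioo 0 t) b (fun _ => 1)) * (D * lnorm q (Ioi t) a (fun _ => 1)) := by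
        gcongr
        · exact h1.trans (by gcongr)
        · exact l t ht
    _ = C * D * (lnorm r (Ioo 0 t) b (fun _ => 1) * lnorm q (Ioi t) a (fun _ => 1)) := by ring
    _ ≤ _ := by gcongr; exact le_add_self

theorem weightR_ne_zero {t : ℝ} (ht : 0 < t) : weightR r b q a t ≠ 0 := by
  obtain ⟨C, hC, k⟩ := h.exists_mul_le_weightR
  intro h0
  have := k t ht
  rw [h0, mul_zero, le_zero_iff, ENNReal.ofReal_eq_zero] at this
  exact absurd (mul_pos (h.hb.pos t ht) (h.ha.pos t ht)) (not_lt.2 this)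

theorem ofReal_toReal_weightR {t : ℝ} (ht : 0 < t) :
    ENNReal.ofReal (weightR r b q a t).toReal = weightR r b q a t :=
  ENNReal.ofReal_toReal (h.weightR_ne_top ht)

theorem regVar_weightR : RegVar 0 fun t => (weightR r b q a t).toReal := by
  refine ⟨fun t ht => ENNReal.toReal_pos (h.weightR_ne_zero ht) (h.weightR_ne_top ht),
    fun ε hε => ?_⟩
  obtain ⟨C, hC, k⟩ := h.weightR_le hε
  refine ⟨C.toReal + 1, by positivity, fun s t hs hst => ?_⟩
  have ht := hs.trans_le hst
  have e1 : 1 ≤ (t / s) ^ ε := Real.one_le_rpow ((one_le_div hs).2 hst) hε.le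
  obtain ⟨k1, k2⟩ := k s t hs hst
  have hs' := h.weightR_ne_top hs
  have ht' := h.weightR_ne_top ht
  have l1 := ENNReal.toReal_mono (by finiteness) k1
  have l2 := ENNReal.toReal_mono (by finiteness) k2
  rw [ENNReal.toReal_mul, ENNReal.toReal_mul, ENNReal.toReal_ofReal (by positivity)] at l1
  rw [ENNReal.toReal_mul] at l2
  rw [add_zero, sub_zero]
  constructor
  · refine l2.trans ?_
    gcongr
    nlinarith [ENNReal.toReal_nonneg (a := C)]
  · refine l1.trans ?_
    gcongr
    linarith

/-- The part over `(0,t)` of the `R`-norm of a function of positive index. -/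
theorem partR_le_of_regVar {α : ℝ} (hα : 0 < α) {m : ℝ → ℝ} (hm : RegVar α m) :
    ∃ C : ℝ≥0∞, C ≠ ∞ ∧ ∀ t : ℝ, 0 < t →
      partR r b q a t (fun u => ENNReal.ofReal (m u))
        ≤ C * (weightR r b q a t * ENNReal.ofReal (m t)) := by
  obtain ⟨C, hC, k⟩ := (h.ha.mul hm).lnorm_Ioo_le h.hq (by linarith)
  obtain ⟨D, hD, l⟩ := h.ha.le_lnorm_Ioi h.hq
  refine ⟨C * D, by finiteness, fun t ht => ?_⟩
  have hT := h.tail_ne_top ht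
  calc partR r b q a t (fun u => ENNReal.ofReal (m u))
      -- Positivity of the index makes the inner norm at most a multiple of a(t) m(t), uniformly in
      -- s, and a(t) is bounded by the tail beyond t.
      ≤ lnorm r (Ioo 0 t) b
          (fun _ => C * (D * lnorm q (Ioi t) a (fun _ => 1) * ENNReal.ofReal (m t))) := by
        refine lnorm_mono_right measurableSet_Ioo _ fun s hs => ?_
        calc lnorm q (Ioo s t) a (fun u => ENNReal.ofReal (m u))
            = lnorm q (Ioo s t) (fun u => a u * m u) (fun _ => 1) := by
              refine lnorm_congr measurableSet_Ioo fun u hu => ?_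
              rw [mul_one, ENNReal.ofReal_mul (h.ha.pos u (hs.1.trans hu.1)).le]
          _ ≤ lnorm q (Ioo 0 t) (fun u => a u * m u) (fun _ => 1) :=
              lnorm_mono_set _ (Ioo_subset_Ioo_left hs.1.le) _ _
          _ ≤ C * ENNReal.ofReal (a t * m t) := k t ht
          _ ≤ _ := by
              rw [ENNReal.ofReal_mul (h.ha.pos t ht).le]
              gcongr
              exact l t ht
    _ = C * D * ((lnorm r (Ioo 0 t) b (fun _ => 1) * lnorm q (Ioi t) a (fun _ => 1))
          * ENNReal.ofReal (m t)) := by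
        rw [lnorm_const _ _ _ (by finiteness)]; ring
    _ ≤ _ := by gcongr; exact le_add_self

omit h in
theorem partR_const_mul (t : ℝ) {c : ℝ≥0∞} (hc : c ≠ ∞) (g : ℝ → ℝ≥0∞) :
    partR r b q a t (fun u => c * g u) = c * partR r b q a t g := by
  simp only [partR, lnorm_const_mul _ _ _ hc]

omit h in
theorem partR_mono {t : ℝ} {g g' : ℝ → ℝ≥0∞} (hg : ∀ u ∈ Ioo 0 t, g u ≤ g' u) :
    partR r b q a t g ≤ partR r b q a t g' :=
  lnorm_mono_right measurableSet_Ioo _ fun _ hs =>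
    lnorm_mono_right measurableSet_Ioo _ fun u hu => hg u ⟨hs.1.trans hu.1, hu.2⟩

omit h in
theorem partR_le_normR (t : ℝ) (g : ℝ → ℝ≥0∞) : partR r b q a t g ≤ normR r b q a g :=
  (lnorm_mono_right measurableSet_Ioo _ fun _ _ => lnorm_mono_set _ (fun _ hu => hu.1) _ _).trans
    (lnorm_mono_set _ (fun _ hu => hu.1) _ _)

omit h in
-- Monotonicity in the endpoint suffices, whatever the weight and the function are.
theorem measurable_lnorm_Ioo (q : ℝ≥0∞) (w : ℝ → ℝ) (g : ℝ → ℝ≥0∞) (t : ℝ) :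
    Measurable fun s => lnorm q (Ioo s t) w g :=
  Antitone.measurable fun _ _ hxy => lnorm_mono_set _ (Ioo_subset_Ioo_left hxy) _ _

omit h in
theorem measurable_partR (g : ℝ → ℝ≥0∞) : Measurable fun t => partR r b q a t g :=
  Monotone.measurable fun _ _ hxy =>
    (lnorm_mono_right measurableSet_Ioo _ fun _ _ =>
      lnorm_mono_set _ (Ioo_subset_Ioo_right hxy) _ _).trans
    (lnorm_mono_set _ (Ioo_subset_Ioo_right hxy) _ _)

theorem partR_add_le : ∃ C : ℝ≥0∞, C ≠ ∞ ∧ ∀ t : ℝ, ∀ F G : ℝ → ℝ≥0∞,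
    Measurable F → Measurable G →
    partR r b q a t (fun u => F u + G u) ≤ C * (partR r b q a t F + partR r b q a t G) := by
  obtain ⟨C, hC, k⟩ := h.ha.lnorm_add_le q
  obtain ⟨D, hD, l⟩ := h.hb.lnorm_add_le r
  refine ⟨C * D, by finiteness, fun t F G hF hG => ?_⟩
  calc partR r b q a t (fun u => F u + G u)
      ≤ lnorm r (Ioo 0 t) b (fun s => C * (lnorm q (Ioo s t) a F + lnorm q (Ioo s t) a G)) :=
        lnorm_mono_right measurableSet_Ioo _ fun s hs =>
          k _ measurableSet_Ioo (fun u hu => hs.1.trans hu.1) F G hF hG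
    _ ≤ C * (D * (partR r b q a t F + partR r b q a t G)) := by
        rw [lnorm_const_mul _ _ _ hC]
        gcongr
        exact l _ measurableSet_Ioo (fun u hu => hu.1) _ _ (measurable_lnorm_Ioo _ _ _ _)
          (measurable_lnorm_Ioo _ _ _ _)
    _ = _ := by ring

/-- Beyond t, g is at least g(t). Restricting the R-norm to u > t with s > t or with s < t produces
the two summands of the weight, whence the factor 2. -/
theorem weightR_mul_le_normR {g : ℝ → ℝ≥0∞} (hg : Monotone g) {t : ℝ} (ht : 0 < t) :
    weightR r b q a t * g t ≤ 2 * normR r b q a g := by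
  refine mul_le_of_forall_ne_top fun c hc hct => ?_
  have h1 : lnorm r (Ioi t) b (fun s => lnorm q (Ioi s) a fun _ => 1) * c ≤ normR r b q a g := by
    rw [mul_comm, ← lnorm_const_mul _ _ _ hc]
    refine (lnorm_mono_right measurableSet_Ioi _ fun s hs => ?_).trans
      (lnorm_mono_set _ (Ioi_subset_Ioi ht.le) _ _)
    rw [← lnorm_const _ _ _ hc]
    exact lnorm_mono_right measurableSet_Ioi _ fun u hu =>
      hct.trans (hg (le_of_lt (lt_trans hs hu)))
  have h2 : lnorm r (Ioo 0 t) b (fun _ => 1) * lnorm q (Ioi t) a (fun _ => 1) * c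
      ≤ normR r b q a g := by
    have hT := h.tail_ne_top ht
    rw [mul_assoc, mul_comm, ← lnorm_const _ _ _ (by finiteness)]
    refine (lnorm_mono_right measurableSet_Ioo _ fun s hs => ?_).trans
      (lnorm_mono_set _ (fun u hu => hu.1) _ _)
    rw [mul_comm, ← lnorm_const _ _ _ hc]
    exact (lnorm_mono_right measurableSet_Ioi _ fun u hu => hct.trans (hg (le_of_lt hu))).trans
      (lnorm_mono_set _ (Ioi_subset_Ioi hs.2.le) _ _)
  rw [weightR, add_mul, two_mul]
  exact add_le_add h1 h2

/-- The analytic half of the upper Holmstedt estimate, to be used with g = K(·, f₀), F a multiple of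
K(·, f) and D a multiple of ‖f₀‖ + t‖f₁‖. The domain s < u is cut at t: the regions t < s < u and s
< t < u yield the two summands of the weight, and s < u < t the part. -/
theorem normR_le_of_le : ∃ C : ℝ≥0∞, C ≠ ∞ ∧ ∀ t : ℝ, 0 < t → ∀ (g F : ℝ → ℝ≥0∞) (D : ℝ≥0∞),
    Measurable F → (∀ u ∈ Ioo 0 t, g u ≤ F u + ENNReal.ofReal (u / t) * D) →
    (∀ u, t < u → g u ≤ D) →
    normR r b q a g ≤ C * (partR r b q a t F + weightR r b q a t * D) := by
  obtain ⟨C₀, hC₀, k₀⟩ := exists_lnorm_Ioi_le h.hr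
  obtain ⟨C₁, hC₁, k₁⟩ := exists_lnorm_Ioi_le h.hq
  obtain ⟨C₂, hC₂, k₂⟩ := h.hb.lnorm_add_le r
  obtain ⟨C₃, hC₃, k₃⟩ := h.partR_add_le
  obtain ⟨C₄, hC₄, k₄⟩ := h.partR_le_of_regVar one_pos (RegVar.rpow_id 1)
  refine ⟨C₀ * (C₁ * C₂ * (C₃ * (1 + C₄) + 1) + 1) + 1, by finiteness, fun t ht g F D hF h₁ h₂ => ?_⟩
  rcases eq_or_ne D ∞ with rfl | hD
  · rw [ENNReal.mul_top (h.weightR_ne_zero ht), add_top, ENNReal.mul_top (by simp)]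
    exact le_top
  set X := weightR r b q a t with hX
  set P := partR r b q a t F with hP
  have hT := h.tail_ne_top ht
  set T := lnorm q (Ioi t) a (fun _ => 1) with hTdef
  have e1 : lnorm r (Ioi t) b (fun s => lnorm q (Ioi s) a g) ≤ X * D := calc
    lnorm r (Ioi t) b (fun s => lnorm q (Ioi s) a g)
      ≤ lnorm r (Ioi t) b (fun s => D * lnorm q (Ioi s) a fun _ => 1) := by
        refine lnorm_mono_right measurableSet_Ioi _ fun s hs => ?_
        rw [← lnorm_const _ _ _ hD]
        exact lnorm_mono_right measurableSet_Ioi _ fun u hu => h₂ u (lt_trans hs hu)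
    _ = lnorm r (Ioi t) b (fun s => lnorm q (Ioi s) a fun _ => 1) * D := by
        rw [lnorm_const_mul _ _ _ hD, mul_comm]
    _ ≤ _ := by gcongr; exact le_self_add
  have e2 : partR r b q a t g ≤ C₃ * (P + C₄ * (X * D)) := calc
    partR r b q a t g
      ≤ partR r b q a t (fun u => F u + ENNReal.ofReal t⁻¹ * D * ENNReal.ofReal (u ^ (1 : ℝ))) := by
        refine partR_mono fun u hu => (h₁ u hu).trans_eq ?_
        rw [Real.rpow_one, div_eq_mul_inv, ENNReal.ofReal_mul hu.1.le]
        ring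
    _ ≤ C₃ * (P + ENNReal.ofReal t⁻¹ * D * (C₄ * (X * ENNReal.ofReal (t ^ (1 : ℝ))))) := by
        refine (k₃ t _ _ hF (by fun_prop)).trans ?_
        gcongr
        rw [partR_const_mul _ (by finiteness)]
        gcongr
        exact k₄ t ht
    _ = C₃ * (P + C₄ * (X * D) * (ENNReal.ofReal t⁻¹ * ENNReal.ofReal t)) := by
        rw [Real.rpow_one]; ring
    _ = _ := by
        rw [← ENNReal.ofReal_mul (by positivity), inv_mul_cancel₀ ht.ne', ENNReal.ofReal_one,
          mul_one]
  have e3 : lnorm r (Ioo 0 t) b (fun s => lnorm q (Ioi s) a g)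
      ≤ C₁ * (C₂ * (partR r b q a t g + X * D)) := calc
    lnorm r (Ioo 0 t) b (fun s => lnorm q (Ioi s) a g)
      ≤ lnorm r (Ioo 0 t) b (fun s => C₁ * (lnorm q (Ioo s t) a g + D * T)) := by
        refine lnorm_mono_right measurableSet_Ioo _ fun s hs => (k₁ s t hs.2.le a g).trans ?_
        gcongr
        rw [hTdef, ← lnorm_const _ _ _ hD]
        exact lnorm_mono_right measurableSet_Ioi _ fun u hu => h₂ u hu
    _ ≤ C₁ * (C₂ * (partR r b q a t g + D * T * lnorm r (Ioo 0 t) b (fun _ => 1))) := by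
        rw [lnorm_const_mul _ _ _ hC₁, ← lnorm_const r (Ioo 0 t) b (c := D * T) (by finiteness)]
        gcongr
        exact k₂ _ measurableSet_Ioo (fun u hu => hu.1) _ _ (measurable_lnorm_Ioo _ _ _ _)
          measurable_const
    _ = C₁ * (C₂ * (partR r b q a t g + (lnorm r (Ioo 0 t) b (fun _ => 1) * T) * D)) := by ring
    _ ≤ _ := by gcongr; exact le_add_self
  calc normR r b q a g
      ≤ C₀ * (lnorm r (Ioo 0 t) b (fun s => lnorm q (Ioi s) a g)
          + lnorm r (Ioi t) b (fun s => lnorm q (Ioi s) a g)) := k₀ 0 t ht.le _ _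
    _ ≤ C₀ * (C₁ * (C₂ * (C₃ * (P + C₄ * (X * D)) + X * D)) + X * D) := by
        gcongr
        exact e3.trans (by gcongr)
    _ = C₀ * C₁ * C₂ * C₃ * P + C₀ * (C₁ * C₂ * (C₃ * C₄ + 1) + 1) * (X * D) := by ring
    _ ≤ (C₀ * C₁ * C₂ * C₃ * P + C₀ * (C₁ * C₂ * (C₃ * C₄ + 1) + 1) * (X * D))
        + (C₀ * C₁ * C₂ * C₃ * (X * D) + C₀ * (C₁ * C₂ * (C₃ * C₄ + 1) + 1) * P + P + X * D) :=
        le_self_add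
    _ = (C₀ * (C₁ * C₂ * (C₃ * (1 + C₄) + 1) + 1) + 1) * (P + X * D) := by ring

/-- A Hardy type inequality for quasi-concave functions. -/
theorem lnorm_partR_le {p : ℝ≥0∞} (hp : 0 < p) {θ : ℝ} (hθ : 0 < θ) {W : ℝ → ℝ}
    (hW : RegVar (-θ) W) : ∃ C : ℝ≥0∞, C ≠ ∞ ∧ ∀ g : ℝ → ℝ≥0∞, QuasiConcave g →
      lnorm p (Ioi 0) W (fun t => partR r b q a t g)
        ≤ C * lnorm p (Ioi 0) (fun t => W t * (weightR r b q a t).toReal) g := by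
  set χ : ℝ → ℝ := fun t => (weightR r b q a t).toReal with hχdef
  have hχ : RegVar 0 χ := h.regVar_weightR
  -- The power θ is shared equally. By quasi-concavity, g(u) is at most a multiple of u^{θ/2}/χ(u)
  -- times the norm of u^{-θ/2} χ g over (0, t). The R-part of u^{θ/2}/χ is at most a multiple of
  -- t^{θ/2}, and a Hardy inequality in the single exponent p remains, unrelated to r and q.
  have hw : RegVar (-(θ / 2) + 0) (fun u => u ^ (-(θ / 2)) * χ u) :=
    (RegVar.rpow_id (-(θ / 2))).mul hχ
  have hm : RegVar (θ / 2 + -0) (fun u => u ^ (θ / 2) * (χ u)⁻¹) :=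
    (RegVar.rpow_id (θ / 2)).mul hχ.inv
  have hv : RegVar (-θ + θ / 2) (fun t => W t * t ^ (θ / 2)) := hW.mul (RegVar.rpow_id _)
  obtain ⟨C₁, hC₁, k₁⟩ := hw.mul_le_lnorm hp
  obtain ⟨C₂, hC₂, k₂⟩ := h.partR_le_of_regVar (by linarith) hm
  obtain ⟨C₃, hC₃, k₃⟩ := hv.lnorm_lnorm_Ioo_le hp (by linarith) hw
  refine ⟨(C₁ * C₂ + 1) * C₃, by finiteness, fun g hg => ?_⟩
  set w : ℝ → ℝ := fun u => u ^ (-(θ / 2)) * χ u with hwdef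
  have key : ∀ t, 0 < t → partR r b q a t g
      ≤ (C₁ * C₂ + 1) * (ENNReal.ofReal (t ^ (θ / 2)) * lnorm p (Ioo 0 t) w g) := by
    intro t ht
    have htp : 0 < t ^ (θ / 2) := by positivity
    set N := lnorm p (Ioo 0 t) w g with hN
    rcases eq_or_ne N ∞ with hN' | hN'
    · rw [hN', ENNReal.mul_top (by simpa using htp), ENNReal.mul_top (by simp)]
      exact le_top
    have e1 : ∀ u ∈ Ioo 0 t, g u ≤ C₁ * N * ENNReal.ofReal (u ^ (θ / 2) * (χ u)⁻¹) := by
      intro u hu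
      have hu0 : 0 < u := hu.1
      have hχu := hχ.pos u hu0
      have e2 : ENNReal.ofReal (w u) * g u ≤ C₁ * N := by
        refine (k₁ g hg u hu0).trans ?_
        gcongr
        exact lnorm_mono_set _ (Ioo_subset_Ioo (by positivity) hu.2.le) _ _
      have e3 : ENNReal.ofReal (u ^ (θ / 2) * (χ u)⁻¹) * ENNReal.ofReal (w u) = 1 := by
        rw [← ENNReal.ofReal_mul (by positivity), hwdef]
        dsimp only
        rw [Real.rpow_neg hu0.le]
        have : 0 < u ^ (θ / 2) := by positivity
        rw [show u ^ (θ / 2) * (χ u)⁻¹ * ((u ^ (θ / 2))⁻¹ * χ u) = 1 by field_simp,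
          ENNReal.ofReal_one]
      calc g u = ENNReal.ofReal (u ^ (θ / 2) * (χ u)⁻¹) * (ENNReal.ofReal (w u) * g u) := by
            rw [← mul_assoc, e3, one_mul]
        _ ≤ ENNReal.ofReal (u ^ (θ / 2) * (χ u)⁻¹) * (C₁ * N) := by gcongr
        _ = _ := by ring
    calc partR r b q a t g
        ≤ C₁ * N * partR r b q a t (fun u => ENNReal.ofReal (u ^ (θ / 2) * (χ u)⁻¹)) := by
          rw [← partR_const_mul _ (by finiteness)]
          exact partR_mono e1
      _ ≤ C₁ * N * (C₂ * (weightR r b q a t * ENNReal.ofReal (t ^ (θ / 2) * (χ t)⁻¹))) := by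
          gcongr; exact k₂ t ht
      _ = C₁ * C₂ * (ENNReal.ofReal (t ^ (θ / 2)) * N) := by
          have hχt := hχ.pos t ht
          rw [← h.ofReal_toReal_weightR ht, ← ENNReal.ofReal_mul hχt.le]
          rw [show χ t * (t ^ (θ / 2) * (χ t)⁻¹) = t ^ (θ / 2) by field_simp]
          ring
      _ ≤ _ := by gcongr; exact le_self_add
  calc lnorm p (Ioi 0) W (fun t => partR r b q a t g)
      ≤ (C₁ * C₂ + 1) * lnorm p (Ioi 0) (fun t => W t * t ^ (θ / 2))
          (fun t => lnorm p (Ioo 0 t) w g) := by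
        refine lnorm_le_const_mul measurableSet_Ioi (by finiteness) fun t ht => ?_
        rw [ENNReal.ofReal_mul (hW.pos t ht).le]
        calc _ ≤ ENNReal.ofReal (W t) * ((C₁ * C₂ + 1) *
              (ENNReal.ofReal (t ^ (θ / 2)) * lnorm p (Ioo 0 t) w g)) := by
              gcongr; exact key t ht
          _ = _ := by ring
    _ ≤ (C₁ * C₂ + 1) * (C₃ * lnorm p (Ioi 0) (fun u => W u * u ^ (θ / 2) * w u) g) := by
        gcongr; exact k₃ g hg.mono.measurable
    _ = (C₁ * C₂ + 1) * C₃ * lnorm p (Ioi 0) (fun t => W t * χ t) g := by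
        rw [mul_assoc]
        congr 2
        refine lnorm_congr measurableSet_Ioi fun u hu => ?_
        have hu0 : 0 < u := hu
        have : 0 < u ^ (θ / 2) := by positivity
        rw [hwdef]
        dsimp only
        rw [Real.rpow_neg hu0.le, show W u * u ^ (θ / 2) * ((u ^ (θ / 2))⁻¹ * χ u) = W u * χ u by
          field_simp]

end RParams

/-! ### The `K`-functional -/

section

variable {E : Type*} [AddCommGroup E]

/-- Extended quasi-norms on an abelian group. -/
structure IsQuasiNorm (N : E → ℝ≥0∞) : Prop where
  zero : N 0 = 0
  neg : ∀ f, N (-f) = N f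
  add_le : ∃ C : ℝ≥0, ∀ f g, N (f + g) ≤ C * (N f + N g)

theorem IsQuasiBanachIn.isQuasiNorm {𝕜 : Type*} [RCLike 𝕜] [Module 𝕜 E] [TopologicalSpace E]
    {N : E → ℝ≥0∞} (h : IsQuasiBanachIn 𝕜 N) : IsQuasiNorm N where
  zero := (h.eq_zero_iff 0).2 rfl
  neg f := by simpa using h.smul (-1) f
  add_le := h.add_le

theorem peetreK_le (A₀ A₁ : E → ℝ≥0∞) (t : ℝ) (f₀ f₁ : E) :
    peetreK A₀ A₁ t (f₀ + f₁) ≤ A₀ f₀ + ENNReal.ofReal t * A₁ f₁ :=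
  iInf_le_of_le f₀ (iInf_le_of_le f₁ (iInf_le_of_le rfl le_rfl))

theorem le_peetreK {A₀ A₁ : E → ℝ≥0∞} {t : ℝ} {f : E} {x : ℝ≥0∞}
    (h : ∀ f₀ f₁, f₀ + f₁ = f → x ≤ A₀ f₀ + ENNReal.ofReal t * A₁ f₁) : x ≤ peetreK A₀ A₁ t f :=
  le_iInf fun f₀ => le_iInf fun f₁ => le_iInf fun hf => h f₀ f₁ hf

theorem le_const_mul_peetreK {A₀ A₁ : E → ℝ≥0∞} {t : ℝ} {f : E} {x c : ℝ≥0∞} (hc0 : c ≠ 0)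
    (hc : c ≠ ∞) (h : ∀ f₀ f₁, f₀ + f₁ = f → x ≤ c * (A₀ f₀ + ENNReal.ofReal t * A₁ f₁)) :
    x ≤ c * peetreK A₀ A₁ t f := by
  rw [← ENNReal.inv_mul_le_iff hc0 hc]
  exact le_peetreK fun f₀ f₁ hf => (ENNReal.inv_mul_le_iff hc0 hc).2 (h f₀ f₁ hf)

theorem quasiConcave_peetreK (A₀ A₁ : E → ℝ≥0∞) (f : E) :
    QuasiConcave fun t => peetreK A₀ A₁ t f := by
  refine ⟨fun s t hst => ?_, fun s t hs hst => ?_⟩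
  · refine le_peetreK fun f₀ f₁ hf => ?_
    rw [← hf]
    refine (peetreK_le _ _ _ _ _).trans ?_
    gcongr
  · have h1 : 1 ≤ t / s := (one_le_div hs).2 hst
    have h1' : 1 ≤ ENNReal.ofReal (t / s) := by rwa [ENNReal.one_le_ofReal]
    refine le_const_mul_peetreK (by positivity) ENNReal.ofReal_ne_top fun f₀ f₁ hf => ?_
    rw [← hf]
    refine (peetreK_le _ _ _ _ _).trans ?_
    rw [mul_add, ← mul_assoc, ← ENNReal.ofReal_mul (by positivity), div_mul_cancel₀ _ hs.ne']
    gcongr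
    exact le_mul_of_one_le_left' h1'

theorem peetreK_swap_le (A₀ A₁ : E → ℝ≥0∞) {t : ℝ} (ht : 0 < t) (f : E) :
    peetreK A₀ A₁ t f ≤ ENNReal.ofReal t * peetreK A₁ A₀ t⁻¹ f := by
  refine le_const_mul_peetreK (by simpa using ht) ENNReal.ofReal_ne_top fun f₁ f₀ hf => ?_
  rw [← hf, add_comm f₁]
  refine (peetreK_le _ _ _ _ _).trans_eq ?_
  rw [mul_add, ← mul_assoc, ← ENNReal.ofReal_mul ht.le, mul_inv_cancel₀ ht.ne',
    ENNReal.ofReal_one, one_mul, add_comm]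

theorem peetreK_swap (A₀ A₁ : E → ℝ≥0∞) {t : ℝ} (ht : 0 < t) (f : E) :
    peetreK A₀ A₁ t f = ENNReal.ofReal t * peetreK A₁ A₀ t⁻¹ f := by
  refine le_antisymm (peetreK_swap_le A₀ A₁ ht f) ?_
  have h := peetreK_swap_le A₁ A₀ (inv_pos.2 ht) f
  rw [inv_inv] at h
  calc _ ≤ ENNReal.ofReal t * (ENNReal.ofReal t⁻¹ * peetreK A₀ A₁ t f) := by gcongr
    _ = _ := by
      rw [← mul_assoc, ← ENNReal.ofReal_mul ht.le, mul_inv_cancel₀ ht.ne', ENNReal.ofReal_one,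
        one_mul]

theorem peetreK_inv (A₀ A₁ : E → ℝ≥0∞) {t : ℝ} (ht : 0 < t) (f : E) :
    ENNReal.ofReal t * peetreK A₀ A₁ t⁻¹ f = peetreK A₁ A₀ t f :=
  (peetreK_swap A₁ A₀ ht f).symm

variable {A₀ A₁ : E → ℝ≥0∞}

theorem peetreK_le_left (h₁ : IsQuasiNorm A₁) (t : ℝ) (f : E) : peetreK A₀ A₁ t f ≤ A₀ f := by
  simpa [h₁.zero] using peetreK_le A₀ A₁ t f 0

theorem peetreK_le_right (h₀ : IsQuasiNorm A₀) (t : ℝ) (f : E) :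
    peetreK A₀ A₁ t f ≤ ENNReal.ofReal t * A₁ f := by
  simpa [h₀.zero] using peetreK_le A₀ A₁ t 0 f

/-- The infima over decompositions of g and of f are taken one after the other; truncated
subtraction moves the other term aside, so no near-minimisers are chosen. -/
theorem exists_peetreK_add_le (h₀ : IsQuasiNorm A₀) (h₁ : IsQuasiNorm A₁) :
    ∃ C : ℝ≥0∞, C ≠ 0 ∧ C ≠ ∞ ∧ ∀ (t : ℝ) (f g : E),
      peetreK A₀ A₁ t (f + g) ≤ C * (peetreK A₀ A₁ t f + peetreK A₀ A₁ t g) := by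
  obtain ⟨C, hC⟩ := h₀.add_le
  obtain ⟨D, hD⟩ := h₁.add_le
  set B : ℝ≥0∞ := C + D + 1 with hB
  have hB0 : B ≠ 0 := by simp [hB]
  have hBt : B ≠ ∞ := by finiteness
  have hCB : (C : ℝ≥0∞) ≤ B := by rw [hB, add_assoc]; exact le_self_add
  have hDB : (D : ℝ≥0∞) ≤ B := by rw [hB, add_right_comm]; exact le_add_self
  refine ⟨B, hB0, hBt, fun t f g => ?_⟩
  rw [mul_add, ← tsub_le_iff_left]
  refine le_const_mul_peetreK hB0 hBt fun g₀ g₁ hg => ?_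
  rw [tsub_le_iff_left, add_comm (B * peetreK A₀ A₁ t f), ← tsub_le_iff_left]
  refine le_const_mul_peetreK hB0 hBt fun f₀ f₁ hf => ?_
  rw [tsub_le_iff_left, ← hf, ← hg, add_add_add_comm]
  calc peetreK A₀ A₁ t (f₀ + g₀ + (f₁ + g₁))
      ≤ A₀ (f₀ + g₀) + ENNReal.ofReal t * A₁ (f₁ + g₁) :=
        peetreK_le _ _ _ _ _
    _ ≤ B * (A₀ f₀ + A₀ g₀) + ENNReal.ofReal t * (B * (A₁ f₁ + A₁ g₁)) := by
        gcongr
        · exact (hC _ _).trans (by gcongr)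
        · exact (hD _ _).trans (by gcongr)
    _ = _ := by ring

/-! ### Holmstedt's formula -/

variable {r₀ q₀ r₁ q₁ : ℝ≥0∞} {b₀ a₀ b₁ a₁ : ℝ → ℝ}

/-- Below t, f₀ = f - f₁ and K(u, f₁) ≤ (u/t) · t‖f₁‖; above t, K(u, f₀) ≤ ‖f₀‖. These are the two
hypotheses of `normR_le_of_le`. -/
theorem RParams.normR_peetreK_le (h : RParams r₀ b₀ q₀ a₀) (hA₀ : IsQuasiNorm A₀)
    (hA₁ : IsQuasiNorm A₁) : ∃ C : ℝ≥0∞, C ≠ ∞ ∧ ∀ t : ℝ, 0 < t → ∀ f₀ f₁ : E,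
      normR r₀ b₀ q₀ a₀ (fun u => peetreK A₀ A₁ u f₀)
        ≤ C * (partR r₀ b₀ q₀ a₀ t (fun u => peetreK A₀ A₁ u (f₀ + f₁))
          + weightR r₀ b₀ q₀ a₀ t * (A₀ f₀ + ENNReal.ofReal t * A₁ f₁)) := by
  obtain ⟨B, hB0, hB, k⟩ := exists_peetreK_add_le hA₀ hA₁
  obtain ⟨C, hC, l⟩ := h.normR_le_of_le
  refine ⟨C * (B + 1), by finiteness, fun t ht f₀ f₁ => ?_⟩
  set D := A₀ f₀ + ENNReal.ofReal t * A₁ f₁ with hD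
  have hmeas := (quasiConcave_peetreK A₀ A₁ (f₀ + f₁)).mono.measurable
  have key := l t ht (fun u => peetreK A₀ A₁ u f₀)
    (fun u => (B + 1) * peetreK A₀ A₁ u (f₀ + f₁)) ((B + 1) * D) (by fun_prop) ?_ ?_
  · refine key.trans_eq ?_
    rw [RParams.partR_const_mul _ (by finiteness)]
    ring
  · intro u hu
    have e : ENNReal.ofReal u = ENNReal.ofReal (u / t) * ENNReal.ofReal t := by
      rw [← ENNReal.ofReal_mul (by have := hu.1; positivity), div_mul_cancel₀ _ ht.ne']
    calc peetreK A₀ A₁ u f₀ = peetreK A₀ A₁ u (f₀ + f₁ + -f₁) := by rw [add_neg_cancel_right]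
      _ ≤ B * (peetreK A₀ A₁ u (f₀ + f₁) + peetreK A₀ A₁ u (-f₁)) := k _ _ _
      _ ≤ (B + 1) * (peetreK A₀ A₁ u (f₀ + f₁) + ENNReal.ofReal (u / t) * D) := by
          gcongr
          · exact le_self_add
          · refine (peetreK_le_right hA₀ _ _).trans ?_
            rw [hA₁.neg, e, mul_assoc]
            gcongr
            exact le_add_self
      _ = _ := by ring
  · intro u hu
    calc peetreK A₀ A₁ u f₀ ≤ A₀ f₀ := peetreK_le_left hA₁ _ _
      _ ≤ D := le_self_add
      _ ≤ _ := le_mul_of_one_le_left' le_add_self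

variable {χ₀ χ₁ : ℝ → ℝ}

/-- The contribution of g₀ is controlled directly by its norm. For g₁ one has K(u, g₁) ≤ 2X₁
u/χ₁(u); this bound has index 1, so its part up to t is at most a multiple of χ₀(t) t/χ₁(t) = ρ(t)
times X₁. -/
theorem RParams.part_le_normR_add (h₀ : RParams r₀ b₀ q₀ a₀) (h₁ : RParams r₁ b₁ q₁ a₁)
    (hA₀ : IsQuasiNorm A₀) (hA₁ : IsQuasiNorm A₁)
    (hχ₀ : ∀ t, 0 < t → χ₀ t = (weightR r₀ b₀ q₀ a₀ t).toReal)
    (hχ₁ : ∀ t, 0 < t → χ₁ t = (weightR r₁ b₁ q₁ a₁ t⁻¹).toReal) :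
    ∃ C : ℝ≥0∞, C ≠ ∞ ∧ ∀ t : ℝ, 0 < t → ∀ g₀ g₁ : E,
      partR r₀ b₀ q₀ a₀ t (fun u => peetreK A₀ A₁ u (g₀ + g₁))
          + ENNReal.ofReal (χ₀ t) * peetreK A₀ A₁ t (g₀ + g₁)
        ≤ C * (normR r₀ b₀ q₀ a₀ (fun u => peetreK A₀ A₁ u g₀)
          + ENNReal.ofReal (rho χ₀ χ₁ t) * normR r₁ b₁ q₁ a₁ (fun u => peetreK A₁ A₀ u g₁)) := by
  have hχ₀' : RegVar 0 χ₀ := h₀.regVar_weightR.congr hχ₀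
  have hχ₁' : RegVar (-0) χ₁ := h₁.regVar_weightR.comp_inv.congr hχ₁
  have hm : RegVar (1 + - -0) (fun u => u ^ (1 : ℝ) * (χ₁ u)⁻¹) := (RegVar.rpow_id 1).mul hχ₁'.inv
  obtain ⟨B, hB0, hB, k⟩ := exists_peetreK_add_le hA₀ hA₁
  obtain ⟨C₁, hC₁, l₁⟩ := h₀.partR_add_le
  obtain ⟨C₂, hC₂, l₂⟩ := h₀.partR_le_of_regVar (by norm_num) hm
  refine ⟨B * (C₁ * (1 + 2 * C₂) + 2) + 1, by finiteness, fun t ht g₀ g₁ => ?_⟩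
  set m : ℝ → ℝ := fun u => u ^ (1 : ℝ) * (χ₁ u)⁻¹ with hmdef
  set X₀ := normR r₀ b₀ q₀ a₀ (fun u => peetreK A₀ A₁ u g₀) with hX₀
  set X₁ := normR r₁ b₁ q₁ a₁ (fun u => peetreK A₁ A₀ u g₁) with hX₁
  set R := ENNReal.ofReal (rho χ₀ χ₁ t) with hR
  have hχ₀t := hχ₀'.pos t ht
  have hχ₁t := hχ₁'.pos t ht
  have hρ : 0 < rho χ₀ χ₁ t := by unfold rho; positivity
  have hw : weightR r₀ b₀ q₀ a₀ t = ENNReal.ofReal (χ₀ t) := by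
    rw [hχ₀ t ht, h₀.ofReal_toReal_weightR ht]
  have hwm : ENNReal.ofReal (χ₀ t) * ENNReal.ofReal (m t) = R := by
    rw [← ENNReal.ofReal_mul hχ₀t.le, hmdef, hR]
    dsimp only
    rw [Real.rpow_one, rho]
    congr 1
    field_simp
  rcases eq_or_ne X₁ ∞ with hX₁t | hX₁t
  · rw [hX₁t, ENNReal.mul_top (by simpa [hR] using hρ), add_top, ENNReal.mul_top (by simp)]
    exact le_top
  have e1 : ∀ u, 0 < u → peetreK A₀ A₁ u g₁ ≤ 2 * X₁ * ENNReal.ofReal (m u) := by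
    intro u hu
    have hχu := hχ₁'.pos u hu
    have e2 := h₁.weightR_mul_le_normR (quasiConcave_peetreK A₁ A₀ g₁).mono (inv_pos.2 hu)
    rw [← h₁.ofReal_toReal_weightR (inv_pos.2 hu), ← hχ₁ u hu] at e2
    calc peetreK A₀ A₁ u g₁ = ENNReal.ofReal u * peetreK A₁ A₀ u⁻¹ g₁ := peetreK_swap _ _ hu _
      _ = ENNReal.ofReal (m u) * (ENNReal.ofReal (χ₁ u) * peetreK A₁ A₀ u⁻¹ g₁) := by
          rw [← mul_assoc, ← ENNReal.ofReal_mul (by positivity), hmdef]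
          dsimp only
          rw [Real.rpow_one, inv_mul_cancel_right₀ hχu.ne']
      _ ≤ ENNReal.ofReal (m u) * (2 * X₁) := by gcongr
      _ = _ := mul_comm _ _
  have m₀ := (quasiConcave_peetreK A₀ A₁ g₀).mono.measurable
  have m₁ := (quasiConcave_peetreK A₀ A₁ g₁).mono.measurable
  have e3 : partR r₀ b₀ q₀ a₀ t (fun u => peetreK A₀ A₁ u (g₀ + g₁))
      ≤ B * (C₁ * (X₀ + 2 * C₂ * (R * X₁))) := calc
    partR r₀ b₀ q₀ a₀ t (fun u => peetreK A₀ A₁ u (g₀ + g₁))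
      ≤ B * partR r₀ b₀ q₀ a₀ t (fun u => peetreK A₀ A₁ u g₀ + peetreK A₀ A₁ u g₁) := by
        rw [← RParams.partR_const_mul _ hB]
        exact RParams.partR_mono fun u _ => k u g₀ g₁
    _ ≤ B * (C₁ * (partR r₀ b₀ q₀ a₀ t (fun u => peetreK A₀ A₁ u g₀)
          + partR r₀ b₀ q₀ a₀ t (fun u => peetreK A₀ A₁ u g₁))) := by
        gcongr; exact l₁ t _ _ m₀ m₁
    _ ≤ B * (C₁ * (X₀ + 2 * X₁ * (C₂ * R))) := by
        gcongr
        · exact RParams.partR_le_normR _ _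
        · refine (RParams.partR_mono fun u hu => e1 u hu.1).trans ?_
          rw [RParams.partR_const_mul _ (by finiteness), ← hwm, ← hw]
          gcongr
          exact l₂ t ht
    _ = _ := by ring
  have e4 : ENNReal.ofReal (χ₀ t) * peetreK A₀ A₁ t (g₀ + g₁) ≤ B * (2 * (X₀ + R * X₁)) := by
    have e5 := h₀.weightR_mul_le_normR (quasiConcave_peetreK A₀ A₁ g₀).mono ht
    rw [hw] at e5
    calc _ ≤ ENNReal.ofReal (χ₀ t) * (B * (peetreK A₀ A₁ t g₀ + peetreK A₀ A₁ t g₁)) := by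
          gcongr; exact k _ _ _
      _ = B * (ENNReal.ofReal (χ₀ t) * peetreK A₀ A₁ t g₀
            + ENNReal.ofReal (χ₀ t) * peetreK A₀ A₁ t g₁) := by ring
      _ ≤ B * (2 * X₀ + ENNReal.ofReal (χ₀ t) * (2 * X₁ * ENNReal.ofReal (m t))) := by
          gcongr; exact e1 t ht
      _ = B * (2 * (X₀ + (ENNReal.ofReal (χ₀ t) * ENNReal.ofReal (m t)) * X₁)) := by ring
      _ = _ := by rw [hwm]
  calc _ ≤ B * (C₁ * (X₀ + 2 * C₂ * (R * X₁))) + B * (2 * (X₀ + R * X₁)) := add_le_add e3 e4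
    _ ≤ (B * (C₁ * (X₀ + 2 * C₂ * (R * X₁))) + B * (2 * (X₀ + R * X₁)))
        + (B * C₁ * (R * X₁ + 2 * C₂ * X₀) + X₀ + R * X₁) := le_self_add
    _ = _ := by ring

/-- Reversing the couple and inverting t replaces ρ by 1/ρ, so that estimates for the first end of
the couple can be read at the second. -/
theorem rho_swap (χ₀ χ₁ : ℝ → ℝ) (t : ℝ) :
    rho (fun s => χ₁ s⁻¹) (fun s => χ₀ s⁻¹) t⁻¹ = (rho χ₀ χ₁ t)⁻¹ := by
  simp only [rho, inv_inv, inv_div]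
  rw [div_eq_mul_inv, div_eq_mul_inv, mul_inv]
  ring

/-- Holmstedt's formula for a couple of `R`-spaces of a couple and of the reversed couple. -/
theorem holmstedt (h₀ : RParams r₀ b₀ q₀ a₀) (h₁ : RParams r₁ b₁ q₁ a₁)
    (hA₀ : IsQuasiNorm A₀) (hA₁ : IsQuasiNorm A₁)
    (hχ₀ : ∀ t, 0 < t → χ₀ t = (weightR r₀ b₀ q₀ a₀ t).toReal)
    (hχ₁ : ∀ t, 0 < t → χ₁ t = (weightR r₁ b₁ q₁ a₁ t⁻¹).toReal) {X₀ X₁ : E → ℝ≥0∞}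
    (hX₀ : ∀ f, X₀ f = normR r₀ b₀ q₀ a₀ (fun u => peetreK A₀ A₁ u f))
    (hX₁ : ∀ f, X₁ f = normR r₁ b₁ q₁ a₁ (fun u => peetreK A₁ A₀ u f)) :
    ∃ C : ℝ≥0∞, C ≠ ∞ ∧ ∀ t : ℝ, 0 < t → ∀ f : E,
      peetreK X₀ X₁ (rho χ₀ χ₁ t) f
        ≤ C * (partR r₀ b₀ q₀ a₀ t (fun u => peetreK A₀ A₁ u f)
          + ENNReal.ofReal (χ₀ t) * peetreK A₀ A₁ t f
          + ENNReal.ofReal (rho χ₀ χ₁ t) *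
            partR r₁ b₁ q₁ a₁ t⁻¹ (fun u => peetreK A₁ A₀ u f)) ∧
      partR r₀ b₀ q₀ a₀ t (fun u => peetreK A₀ A₁ u f)
          + ENNReal.ofReal (χ₀ t) * peetreK A₀ A₁ t f
          + ENNReal.ofReal (rho χ₀ χ₁ t) *
            partR r₁ b₁ q₁ a₁ t⁻¹ (fun u => peetreK A₁ A₀ u f)
        ≤ C * peetreK X₀ X₁ (rho χ₀ χ₁ t) f := by
  have hχ₀' : RegVar 0 χ₀ := h₀.regVar_weightR.congr hχ₀
  have hχ₁' : RegVar (-0) χ₁ := h₁.regVar_weightR.comp_inv.congr hχ₁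
  obtain ⟨C₀, hC₀, k₀⟩ := h₀.normR_peetreK_le hA₀ hA₁
  obtain ⟨C₁, hC₁, k₁⟩ := h₁.normR_peetreK_le hA₁ hA₀
  obtain ⟨D₀, hD₀, l₀⟩ := h₀.part_le_normR_add h₁ hA₀ hA₁ hχ₀ hχ₁
  obtain ⟨D₁, hD₁, l₁⟩ := h₁.part_le_normR_add h₀ hA₁ hA₀ (χ₀ := fun s => χ₁ s⁻¹)
    (χ₁ := fun s => χ₀ s⁻¹) (fun t ht => by simp [hχ₁ _ (inv_pos.2 ht)])
    (fun t ht => hχ₀ _ (inv_pos.2 ht))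
  refine ⟨(C₀ + C₁ + 1) + (D₀ + D₁ + 1), by finiteness, fun t ht f => ?_⟩
  have hχ₀t := hχ₀'.pos t ht
  have hχ₁t := hχ₁'.pos t ht
  have hρ : 0 < rho χ₀ χ₁ t := by unfold rho; positivity
  have hw₀ : weightR r₀ b₀ q₀ a₀ t = ENNReal.ofReal (χ₀ t) := by
    rw [hχ₀ t ht, h₀.ofReal_toReal_weightR ht]
  have hw₁ : weightR r₁ b₁ q₁ a₁ t⁻¹ = ENNReal.ofReal (χ₁ t) := by
    rw [hχ₁ t ht, h₁.ofReal_toReal_weightR (inv_pos.2 ht)]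
  -- Because ρ(t) χ₁(t)/t = χ₀(t), both components of the decomposition contribute the same multiple
  -- of ‖f₀‖ + t‖f₁‖.
  have hρχ : ENNReal.ofReal (rho χ₀ χ₁ t) * (ENNReal.ofReal (χ₁ t) * ENNReal.ofReal t⁻¹)
      = ENNReal.ofReal (χ₀ t) := by
    rw [← ENNReal.ofReal_mul hχ₁t.le, ← ENNReal.ofReal_mul hρ.le]
    congr 1
    unfold rho
    field_simp
  have htt : ENNReal.ofReal t⁻¹ * ENNReal.ofReal t = 1 := by
    rw [← ENNReal.ofReal_mul (by positivity), inv_mul_cancel₀ ht.ne', ENNReal.ofReal_one]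
  have hρρ : ENNReal.ofReal (rho χ₀ χ₁ t) * ENNReal.ofReal (rho χ₀ χ₁ t)⁻¹ = 1 := by
    rw [← ENNReal.ofReal_mul hρ.le, mul_inv_cancel₀ hρ.ne', ENNReal.ofReal_one]
  have hR0 : ENNReal.ofReal (rho χ₀ χ₁ t) ≠ ∞ := ENNReal.ofReal_ne_top
  set R := ENNReal.ofReal (rho χ₀ χ₁ t)
  set P₀ := partR r₀ b₀ q₀ a₀ t (fun u => peetreK A₀ A₁ u f) with hP₀
  set P₁ := partR r₁ b₁ q₁ a₁ t⁻¹ (fun u => peetreK A₁ A₀ u f) with hP₁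
  constructor
  · have e : peetreK X₀ X₁ (rho χ₀ χ₁ t) f
        ≤ (C₀ + C₁ + 1) * (P₀ + R * P₁)
          + (C₀ + C₁ + 1) * ENNReal.ofReal (χ₀ t) * peetreK A₀ A₁ t f := by
      -- The parts do not depend on the decomposition and are moved to the left before the infimum
      -- is taken.
      rw [← tsub_le_iff_left]
      refine le_const_mul_peetreK (by simpa using hχ₀t) (by finiteness) fun f₀ f₁ hf => ?_
      rw [tsub_le_iff_left]
      have u₀ := k₀ t ht f₀ f₁
      have u₁ := k₁ t⁻¹ (inv_pos.2 ht) f₁ f₀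
      rw [hf, hw₀, ← hX₀] at u₀
      rw [add_comm f₁, hf, hw₁, ← hX₁] at u₁
      set D := A₀ f₀ + ENNReal.ofReal t * A₁ f₁ with hD
      have e2 : A₁ f₁ + ENNReal.ofReal t⁻¹ * A₀ f₀ = ENNReal.ofReal t⁻¹ * D := by
        rw [hD, mul_add, ← mul_assoc, htt, one_mul, add_comm]
      rw [e2] at u₁
      calc peetreK X₀ X₁ (rho χ₀ χ₁ t) f ≤ X₀ f₀ + R * X₁ f₁ := hf ▸ peetreK_le _ _ _ _ _
        _ ≤ C₀ * (P₀ + ENNReal.ofReal (χ₀ t) * D)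
            + R * (C₁ * (P₁ + ENNReal.ofReal (χ₁ t) * (ENNReal.ofReal t⁻¹ * D))) := by gcongr
        _ = C₀ * (P₀ + ENNReal.ofReal (χ₀ t) * D) + C₁ * (R * P₁
            + R * (ENNReal.ofReal (χ₁ t) * ENNReal.ofReal t⁻¹) * D) := by ring
        _ = C₀ * (P₀ + ENNReal.ofReal (χ₀ t) * D) + C₁ * (R * P₁ + ENNReal.ofReal (χ₀ t) * D) := by
            rw [hρχ]
        _ ≤ (C₀ * (P₀ + ENNReal.ofReal (χ₀ t) * D) + C₁ * (R * P₁ + ENNReal.ofReal (χ₀ t) * D))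
            + (C₀ * (R * P₁) + C₁ * P₀ + (P₀ + R * P₁ + ENNReal.ofReal (χ₀ t) * D)) := le_self_add
        _ = _ := by ring
    calc _ ≤ _ := e
      _ = (C₀ + C₁ + 1) * (P₀ + ENNReal.ofReal (χ₀ t) * peetreK A₀ A₁ t f + R * P₁) := by ring
      _ ≤ _ := by gcongr ?_ * _; exact le_self_add
  · refine le_const_mul_peetreK (by simp) (by finiteness) fun g₀ g₁ hg => ?_
    have u₀ := l₀ t ht g₀ g₁
    have u₁ := l₁ t⁻¹ (inv_pos.2 ht) g₁ g₀
    rw [hg, ← hX₀, ← hX₁] at u₀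
    rw [rho_swap, add_comm g₁, hg, ← hX₀, ← hX₁] at u₁
    -- Multiplying the reversed estimate by ρ(t) restores the original form of the K-functional.
    have u₁' : R * P₁ ≤ D₁ * (X₀ g₀ + R * X₁ g₁) := calc
      R * P₁ ≤ R * (D₁ * (X₁ g₁ + ENNReal.ofReal (rho χ₀ χ₁ t)⁻¹ * X₀ g₀)) := by
          gcongr; exact le_self_add.trans u₁
      _ = D₁ * (R * ENNReal.ofReal (rho χ₀ χ₁ t)⁻¹ * X₀ g₀ + R * X₁ g₁) := by ring
      _ = _ := by rw [hρρ, one_mul]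
    calc _ ≤ D₀ * (X₀ g₀ + R * X₁ g₁) + D₁ * (X₀ g₀ + R * X₁ g₁) := add_le_add u₀ u₁'
      _ = (D₀ + D₁) * (X₀ g₀ + R * X₁ g₁) := by ring
      _ ≤ _ := by
          gcongr ?_ * _
          exact le_self_add.trans le_add_self

end

/-! ### Reiteration -/

section

variable {E : Type*} [AddCommGroup E] {A₀ A₁ X₀ X₁ : E → ℝ≥0∞}
  {r r₀ q₀ r₁ q₁ : ℝ≥0∞} {a b₀ a₀ b₁ a₁ χ₀ χ₁ ρ : ℝ → ℝ}

theorem regVar_rho (hχ₀ : RegVar 0 χ₀) (hχ₁ : RegVar 0 χ₁) : RegVar 1 (rho χ₀ χ₁) := by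
  have h := ((RegVar.rpow_id 1).mul hχ₀).mul hχ₁.inv
  rw [show (1 : ℝ) + 0 + -0 = 1 by norm_num] at h
  exact h.congr fun t ht => by rw [rho, Real.rpow_one, div_eq_mul_inv]

theorem regVar_rpow_mul_comp (hρ : RegVar 1 ρ) (ha : RegVar 0 a) {θ : ℝ} (hθ : 0 ≤ θ) :
    RegVar (-θ) fun t => ρ t ^ (-θ) * a (ρ t) := by
  have h := (hρ.rpow_nonneg hθ).inv.mul (ha.comp hρ)
  rw [show -(θ * 1) + 0 = -θ by ring] at h
  exact h.congr fun t ht => by rw [Real.rpow_neg (hρ.pos t ht).le]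

/-- Substitution τ = ρ(t) in the norm, followed by Holmstedt's formula inside it. The upper bound
needs additivity of the norm, hence the measurable replacements for χ₀ and ρ; each lower bound keeps
just one of the three terms. -/
theorem reiteration (h₀ : RParams r₀ b₀ q₀ a₀) (h₁ : RParams r₁ b₁ q₁ a₁)
    (hA₀ : IsQuasiNorm A₀) (hA₁ : IsQuasiNorm A₁) (hr : 0 < r) (ha : RegVar 0 a)
    (hχ₀ : ∀ t, 0 < t → χ₀ t = (weightR r₀ b₀ q₀ a₀ t).toReal)
    (hχ₁ : ∀ t, 0 < t → χ₁ t = (weightR r₁ b₁ q₁ a₁ t⁻¹).toReal)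
    (hX₀ : ∀ f, X₀ f = normR r₀ b₀ q₀ a₀ (fun u => peetreK A₀ A₁ u f))
    (hX₁ : ∀ f, X₁ f = normR r₁ b₁ q₁ a₁ (fun u => peetreK A₁ A₀ u f))
    {θ : ℝ} (hθ : 0 ≤ θ) {W : ℝ → ℝ}
    (hW : ∀ t, 0 < t → W t = rho χ₀ χ₁ t ^ (-θ) * a (rho χ₀ χ₁ t)) :
    ∃ C : ℝ≥0∞, C ≠ ∞ ∧ ∀ f : E,
      stdSpace X₀ X₁ θ r a f
        ≤ C * (lnorm r (Ioi 0) W (fun t => partR r₀ b₀ q₀ a₀ t fun u => peetreK A₀ A₁ u f)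
          + lnorm r (Ioi 0) (fun t => W t * χ₀ t) (fun u => peetreK A₀ A₁ u f)
          + lnorm r (Ioi 0) (fun t => W t * rho χ₀ χ₁ t)
            (fun t => partR r₁ b₁ q₁ a₁ t⁻¹ fun u => peetreK A₁ A₀ u f)) ∧
      lnorm r (Ioi 0) W (fun t => partR r₀ b₀ q₀ a₀ t fun u => peetreK A₀ A₁ u f)
        ≤ C * stdSpace X₀ X₁ θ r a f ∧
      lnorm r (Ioi 0) (fun t => W t * χ₀ t) (fun u => peetreK A₀ A₁ u f)
        ≤ C * stdSpace X₀ X₁ θ r a f ∧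
      lnorm r (Ioi 0) (fun t => W t * rho χ₀ χ₁ t)
        (fun t => partR r₁ b₁ q₁ a₁ t⁻¹ fun u => peetreK A₁ A₀ u f)
        ≤ C * stdSpace X₀ X₁ θ r a f := by
  have hχ₀' : RegVar 0 χ₀ := h₀.regVar_weightR.congr hχ₀
  have hχ₁' : RegVar 0 χ₁ := by simpa using h₁.regVar_weightR.comp_inv.congr hχ₁
  have hρ := regVar_rho hχ₀' hχ₁'
  have hWr : RegVar (-θ) W := (regVar_rpow_mul_comp hρ ha hθ).congr hW
  have hw : RegVar (-θ + 0) (fun u => u ^ (-θ) * a u) := (RegVar.rpow_id (-θ)).mul ha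
  obtain ⟨K, hK, k⟩ := exists_lnorm_comp_equiv hρ hw hr
  obtain ⟨H, hH, l⟩ := holmstedt h₀ h₁ hA₀ hA₁ hχ₀ hχ₁ hX₀ hX₁
  obtain ⟨B, hB, m⟩ := hWr.lnorm_add_le r
  obtain ⟨v, hvm, hv, D, hD, hχv⟩ := hχ₀'.exists_measurable
  obtain ⟨σ, hσm, hσ, D', hD', hρσ⟩ := hρ.exists_measurable
  set ρ := rho χ₀ χ₁ with hρdef
  refine ⟨K * H * (B * (B + 1) * (1 + ENNReal.ofReal D + ENNReal.ofReal D')) + H * K,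
    by finiteness, fun f => ?_⟩
  have hstd : stdSpace X₀ X₁ θ r a f
      = lnorm r (Ioi 0) (fun u => u ^ (-θ) * a u) (fun u => peetreK X₀ X₁ u f) :=
    wnorm_eq_lnorm _ hr _ measurableSet_Ioi subset_rfl _
  obtain ⟨k₁, k₂⟩ := k _ (quasiConcave_peetreK X₀ X₁ f)
  rw [← hstd] at k₁ k₂
  have hWeq : lnorm r (Ioi 0) (fun t => ρ t ^ (-θ) * a (ρ t)) (fun t => peetreK X₀ X₁ (ρ t) f)
      = lnorm r (Ioi 0) W (fun t => peetreK X₀ X₁ (ρ t) f) :=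
    lnorm_congr measurableSet_Ioi fun t ht => by rw [hW t ht]
  rw [hWeq] at k₁ k₂
  have hWpos := hWr.pos
  set S := stdSpace X₀ X₁ θ r a f
  set P₀ : ℝ → ℝ≥0∞ := fun t => partR r₀ b₀ q₀ a₀ t fun u => peetreK A₀ A₁ u f with hP₀
  set P₁ : ℝ → ℝ≥0∞ := fun t => partR r₁ b₁ q₁ a₁ t⁻¹ fun u => peetreK A₁ A₀ u f with hP₁
  have hKm := (quasiConcave_peetreK A₀ A₁ f).mono.measurable
  have hP₀m : Measurable P₀ := RParams.measurable_partR _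
  have hP₁m : Measurable P₁ := (RParams.measurable_partR _).comp measurable_inv
  have hup : ∀ G : ℝ → ℝ≥0∞, (∀ t, 0 < t → G t ≤ H * peetreK X₀ X₁ (ρ t) f) →
      lnorm r (Ioi 0) W G
        ≤ (K * H * (B * (B + 1) * (1 + ENNReal.ofReal D + ENNReal.ofReal D')) + H * K) * S := by
    intro G hG
    calc lnorm r (Ioi 0) W G ≤ H * lnorm r (Ioi 0) W (fun t => peetreK X₀ X₁ (ρ t) f) := by
          rw [← lnorm_const_mul _ _ _ hH]
          exact lnorm_mono_right measurableSet_Ioi _ hG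
      _ ≤ H * (K * S) := by gcongr
      _ = H * K * S := by ring
      _ ≤ _ := by gcongr ?_ * _; exact le_add_self
  have hmove : ∀ (φ : ℝ → ℝ), (∀ t, 0 < t → 0 < φ t) → ∀ G : ℝ → ℝ≥0∞,
      lnorm r (Ioi 0) (fun t => W t * φ t) G
        = lnorm r (Ioi 0) W (fun t => ENNReal.ofReal (φ t) * G t) := fun φ hφ G =>
    lnorm_congr measurableSet_Ioi fun t ht => by
      rw [ENNReal.ofReal_mul (hWpos t ht).le, mul_assoc]
  refine ⟨?_, hup _ fun t ht => ?_, ?_, ?_⟩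
  · have hdom : ∀ (φ ψ : ℝ → ℝ) (e : ℝ), 0 < e → (∀ t, 0 < t → 0 < φ t ∧ ψ t ≤ e * φ t) →
        ∀ G : ℝ → ℝ≥0∞, lnorm r (Ioi 0) W (fun t => ENNReal.ofReal (ψ t) * G t)
          ≤ ENNReal.ofReal e * lnorm r (Ioi 0) (fun t => W t * φ t) G := by
      intro φ ψ e he hφ G
      rw [hmove φ (fun t ht => (hφ t ht).1)]
      refine lnorm_le_const_mul measurableSet_Ioi ENNReal.ofReal_ne_top fun t ht => ?_
      calc ENNReal.ofReal (W t) * (ENNReal.ofReal (ψ t) * G t)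
          ≤ ENNReal.ofReal (W t) * (ENNReal.ofReal (e * φ t) * G t) := by
            gcongr; exact (hφ t ht).2
        _ = _ := by rw [ENNReal.ofReal_mul he.le]; ring
    set N₀ := lnorm r (Ioi 0) W P₀
    set N₁ := lnorm r (Ioi 0) (fun t => W t * χ₀ t) (fun u => peetreK A₀ A₁ u f)
    set N₂ := lnorm r (Ioi 0) (fun t => W t * ρ t) P₁
    have hsum : lnorm r (Ioi 0) W (fun t => P₀ t + ENNReal.ofReal (v t) * peetreK A₀ A₁ t f
        + ENNReal.ofReal (σ t) * P₁ t)
        ≤ B * (B * (N₀ + ENNReal.ofReal D * N₁) + ENNReal.ofReal D' * N₂) := by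
      refine (m _ measurableSet_Ioi subset_rfl _ _ (by fun_prop) (by fun_prop)).trans ?_
      gcongr
      · refine (m _ measurableSet_Ioi subset_rfl _ _ hP₀m (by fun_prop)).trans ?_
        gcongr
        exact hdom _ _ D hD (fun t ht => ⟨hχ₀'.pos t ht, (hχv t ht).2⟩) _
      · exact hdom _ _ D' hD' (fun t ht => ⟨hρ.pos t ht, (hρσ t ht).2⟩) _
    calc S ≤ K * lnorm r (Ioi 0) W (fun t => peetreK X₀ X₁ (ρ t) f) := k₂
      _ ≤ K * (H * lnorm r (Ioi 0) W (fun t => P₀ t + ENNReal.ofReal (v t) * peetreK A₀ A₁ t f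
            + ENNReal.ofReal (σ t) * P₁ t)) := by
          gcongr
          rw [← lnorm_const_mul _ _ _ hH]
          refine lnorm_mono_right measurableSet_Ioi _ fun t ht => (l t ht f).1.trans ?_
          gcongr
          · exact (hχv t ht).1
          · exact (hρσ t ht).1
      _ ≤ K * (H * (B * (B * (N₀ + ENNReal.ofReal D * N₁) + ENNReal.ofReal D' * N₂))) := by gcongr
      _ ≤ K * (H * (B * ((B + 1) * ((1 + ENNReal.ofReal D + ENNReal.ofReal D') * N₀
            + (1 + ENNReal.ofReal D + ENNReal.ofReal D') * N₁)
            + (B + 1) * (1 + ENNReal.ofReal D + ENNReal.ofReal D') * N₂))) := by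
          gcongr
          · exact le_self_add
          · exact le_mul_of_one_le_left' (by rw [add_assoc]; exact le_self_add)
          · exact le_add_self.trans le_self_add
          · exact le_add_self.trans (le_mul_of_one_le_left' le_add_self)
      _ = K * H * (B * (B + 1) * (1 + ENNReal.ofReal D + ENNReal.ofReal D')) * (N₀ + N₁ + N₂) := by
          ring
      _ ≤ _ := by gcongr ?_ * _; exact le_self_add
  · exact (le_self_add.trans le_self_add).trans (l t ht f).2
  · rw [hmove _ hχ₀'.pos]
    exact hup _ fun t ht => (le_add_self.trans le_self_add).trans (l t ht f).2
  · rw [hmove _ hρ.pos]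
    exact hup _ fun t ht => le_add_self.trans (l t ht f).2

/-- For θ > 0 the middle term absorbs the first one. -/
theorem lnorm_partR_peetreK_le (h₀ : RParams r₀ b₀ q₀ a₀) (hr : 0 < r)
    (hχ₀ : ∀ t, 0 < t → χ₀ t = (weightR r₀ b₀ q₀ a₀ t).toReal)
    {θ : ℝ} (hθ : 0 < θ) {W : ℝ → ℝ} (hW : RegVar (-θ) W) :
    ∃ C : ℝ≥0∞, C ≠ ∞ ∧ ∀ f : E,
      lnorm r (Ioi 0) W (fun t => partR r₀ b₀ q₀ a₀ t fun u => peetreK A₀ A₁ u f)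
      ≤ C * lnorm r (Ioi 0) (fun t => W t * χ₀ t) (fun u => peetreK A₀ A₁ u f) := by
  obtain ⟨C, hC, k⟩ := h₀.lnorm_partR_le hr hθ hW
  refine ⟨C, hC, fun f => (k _ (quasiConcave_peetreK A₀ A₁ f)).trans_eq ?_⟩
  congr 1
  exact lnorm_congr measurableSet_Ioi fun t ht => by rw [hχ₀ t ht]

/-- For θ < 1 the middle term absorbs the third one: inverting t gives the same Hardy inequality for
the reversed couple, with 1 - θ in place of θ. -/
theorem lnorm_partR_inv_le (h₁ : RParams r₁ b₁ q₁ a₁) (hr : 0 < r)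
    (hχ₁ : ∀ t, 0 < t → χ₁ t = (weightR r₁ b₁ q₁ a₁ t⁻¹).toReal) (hχ₀ : RegVar 0 χ₀)
    {θ : ℝ} (hθ : θ < 1) {W : ℝ → ℝ} (hW : RegVar (-θ) W) :
    ∃ C : ℝ≥0∞, C ≠ ∞ ∧ ∀ f : E,
      lnorm r (Ioi 0) (fun t => W t * rho χ₀ χ₁ t)
        (fun t => partR r₁ b₁ q₁ a₁ t⁻¹ fun u => peetreK A₁ A₀ u f)
      ≤ C * lnorm r (Ioi 0) (fun t => W t * χ₀ t) (fun u => peetreK A₀ A₁ u f) := by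
  have hχ₁' : RegVar 0 χ₁ := by simpa using h₁.regVar_weightR.comp_inv.congr hχ₁
  have hρ := regVar_rho hχ₀ hχ₁'
  have hV : RegVar (-(1 - θ)) (fun t => W t⁻¹ * rho χ₀ χ₁ t⁻¹) := by
    have := (hW.mul hρ).comp_inv
    rwa [show -(-θ + 1) = -(1 - θ) by ring] at this
  obtain ⟨C, hC, k⟩ := h₁.lnorm_partR_le hr (by linarith) hV
  refine ⟨C, hC, fun f => ?_⟩
  rw [lnorm_inv, preimage_inv_Ioi_zero]
  simp only [inv_inv]
  refine (k _ (quasiConcave_peetreK A₁ A₀ f)).trans_eq ?_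
  rw [lnorm_inv, preimage_inv_Ioi_zero]
  congr 1
  refine lnorm_congr measurableSet_Ioi fun t ht => ?_
  have ht : 0 < t := ht
  have hWt := hW.pos t ht
  have hχ₀t := hχ₀.pos t ht
  have hχ₁t := hχ₁'.pos t ht
  rw [inv_inv, ← hχ₁ t ht, ← peetreK_inv A₁ A₀ ht, ← mul_assoc,
    ← ENNReal.ofReal_mul (by positivity)]
  congr 2
  rw [rho]
  field_simp

/-! ### Translation of the spaces to the measure `du/u` -/

theorem spaceR_eq_normR (hr₀ : 0 < r₀) (hq₀ : 0 < q₀) (f : E) :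
    spaceR A₀ A₁ 0 r₀ b₀ q₀ a₀ f = normR r₀ b₀ q₀ a₀ (fun u => peetreK A₀ A₁ u f) := by
  rw [spaceR, wnorm_eq_lnorm _ hr₀ _ measurableSet_Ioi subset_rfl, normR]
  refine lnorm_congr measurableSet_Ioi fun t ht => ?_
  have ht : 0 < t := ht
  rw [wnorm_eq_lnorm _ hq₀ _ measurableSet_Ioi (Ioi_subset_Ioi ht.le)]
  simp

/-- The factor u^{-1} belonging to θ = 1 is exactly what exchanging A₀ and A₁ in the K-functional
consumes, so θ becomes 0. -/
theorem lnorm_inv_mul_peetreK (I : Set ℝ) (hI : MeasurableSet I) (hI0 : I ⊆ Ioi 0)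
    (ha₁ : RegVar 0 a₁) (f : E) :
    lnorm q₁ I (fun u => u ^ (-1 : ℝ) * a₁ u) (fun u => peetreK A₀ A₁ u f)
      = lnorm q₁ ((fun u => u⁻¹) ⁻¹' I) (fun u => a₁ u⁻¹) (fun u => peetreK A₁ A₀ u f) := by
  rw [lnorm_inv]
  refine lnorm_congr (measurable_inv hI) fun u hu => ?_
  have hu : 0 < u := inv_pos.1 (hI0 hu)
  have hau := ha₁.pos u⁻¹ (inv_pos.2 hu)
  rw [← peetreK_inv A₀ A₁ hu, ← mul_assoc, ← ENNReal.ofReal_mul hau.le, Real.rpow_neg_one, inv_inv,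
    mul_comm u]

theorem spaceL_eq_normR (hr₁ : 0 < r₁) (hq₁ : 0 < q₁) (ha₁ : RegVar 0 a₁) (f : E) :
    spaceL A₀ A₁ 1 r₁ b₁ q₁ a₁ f
      = normR r₁ (fun u => b₁ u⁻¹) q₁ (fun u => a₁ u⁻¹) (fun u => peetreK A₁ A₀ u f) := by
  rw [spaceL, wnorm_eq_lnorm _ hr₁ _ measurableSet_Ioi subset_rfl, normR, lnorm_inv,
    preimage_inv_Ioi_zero]
  refine lnorm_congr measurableSet_Ioi fun t ht => ?_
  have ht : 0 < t := ht
  rw [wnorm_eq_lnorm _ hq₁ _ measurableSet_Ioo (fun u hu => hu.1),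
    lnorm_inv_mul_peetreK _ measurableSet_Ioo (fun u hu => hu.1) ha₁,
    preimage_inv_Ioo_zero (inv_pos.2 ht), inv_inv]
  simp

theorem spaceRL_eq_lnorm (hr : 0 < r) (hr₀ : 0 < r₀) (hq₀ : 0 < q₀) {c : ℝ → ℝ} (f : E) :
    spaceRL A₀ A₁ 0 r c r₀ b₀ q₀ a₀ f
      = lnorm r (Ioi 0) c (fun t => partR r₀ b₀ q₀ a₀ t fun u => peetreK A₀ A₁ u f) := by
  rw [spaceRL, wnorm_eq_lnorm _ hr _ measurableSet_Ioi subset_rfl]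
  refine lnorm_congr measurableSet_Ioi fun t ht => ?_
  rw [wnorm_eq_lnorm _ hr₀ _ measurableSet_Ioo (fun u hu => hu.1), Real.rpow_zero, one_mul, partR]
  congr 1
  refine lnorm_congr measurableSet_Ioo fun s hs => ?_
  rw [wnorm_eq_lnorm _ hq₀ _ measurableSet_Ioo (fun u hu => hs.1.trans hu.1)]
  simp

theorem spaceLR_eq_lnorm (hr : 0 < r) (hr₁ : 0 < r₁) (hq₁ : 0 < q₁) (ha₁ : RegVar 0 a₁)
    {c : ℝ → ℝ} (f : E) :
    spaceLR A₀ A₁ 1 r c r₁ b₁ q₁ a₁ f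
      = lnorm r (Ioi 0) c (fun t => partR r₁ (fun u => b₁ u⁻¹) q₁ (fun u => a₁ u⁻¹) t⁻¹
        fun u => peetreK A₁ A₀ u f) := by
  rw [spaceLR, wnorm_eq_lnorm _ hr _ measurableSet_Ioi subset_rfl]
  refine lnorm_congr measurableSet_Ioi fun t ht => ?_
  have ht : 0 < t := ht
  rw [wnorm_eq_lnorm _ hr₁ _ measurableSet_Ioi (Ioi_subset_Ioi ht.le), Real.rpow_zero, one_mul,
    partR, lnorm_inv, preimage_inv_Ioi ht]
  congr 1
  refine lnorm_congr measurableSet_Ioo fun s hs => ?_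
  have hs0 : 0 < s := hs.1
  rw [wnorm_eq_lnorm _ hq₁ _ measurableSet_Ioo (fun u hu => ht.trans hu.1),
    lnorm_inv_mul_peetreK _ measurableSet_Ioo (fun u hu => ht.trans hu.1) ha₁,
    preimage_inv_Ioo ht (inv_pos.2 hs0), inv_inv]
  simp

theorem chiR_eq (hr₀ : 0 < r₀) (hq₀ : 0 < q₀) {t : ℝ} (ht : 0 < t) :
    chiR r₀ b₀ q₀ a₀ t = (weightR r₀ b₀ q₀ a₀ t).toReal := by
  have e : wnorm 0 r₀ b₀ (Ioi t) (fun s => wnorm 0 q₀ a₀ (Ioi s) fun _ => 1)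
      = lnorm r₀ (Ioi t) b₀ (fun s => lnorm q₀ (Ioi s) a₀ fun _ => 1) := by
    rw [wnorm_eq_lnorm _ hr₀ _ measurableSet_Ioi (Ioi_subset_Ioi ht.le)]
    refine lnorm_congr measurableSet_Ioi fun s hs => ?_
    rw [wnorm_eq_lnorm _ hq₀ _ measurableSet_Ioi (Ioi_subset_Ioi (ht.trans hs).le)]
    simp
  rw [chiR, weightR, e, wnorm_eq_lnorm _ hr₀ _ measurableSet_Ioo (fun u hu => hu.1),
    wnorm_eq_lnorm _ hq₀ _ measurableSet_Ioi (Ioi_subset_Ioi ht.le)]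
  simp

theorem wnorm_Ioo_wnorm_Ioo (hr₁ : 0 < r₁) (hq₁ : 0 < q₁) {t : ℝ} (ht : 0 < t) :
    wnorm 0 r₁ b₁ (Ioo 0 t) (fun s => wnorm 0 q₁ a₁ (Ioo 0 s) fun _ => 1)
      = lnorm r₁ (Ioi t⁻¹) (fun u => b₁ u⁻¹)
        (fun s => lnorm q₁ (Ioi s) (fun u => a₁ u⁻¹) fun _ => 1) := by
  rw [wnorm_eq_lnorm _ hr₁ _ measurableSet_Ioo (fun u hu => hu.1), lnorm_inv,
    preimage_inv_Ioo_zero ht]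
  refine lnorm_congr measurableSet_Ioi fun s hs => ?_
  have hs : 0 < s := (inv_pos.2 ht).trans hs
  rw [wnorm_eq_lnorm _ hq₁ _ measurableSet_Ioo (fun u hu => hu.1), lnorm_inv,
    preimage_inv_Ioo_zero (inv_pos.2 hs)]
  simp

theorem chiL_eq (hr₁ : 0 < r₁) (hq₁ : 0 < q₁) {t : ℝ} (ht : 0 < t) :
    chiL r₁ b₁ q₁ a₁ t
      = (weightR r₁ (fun u => b₁ u⁻¹) q₁ (fun u => a₁ u⁻¹) t⁻¹).toReal := by
  rw [chiL, weightR, wnorm_Ioo_wnorm_Ioo hr₁ hq₁ ht,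
    wnorm_eq_lnorm _ hr₁ _ measurableSet_Ioi (Ioi_subset_Ioi ht.le),
    wnorm_eq_lnorm _ hq₁ _ measurableSet_Ioo (fun u hu => hu.1), lnorm_inv r₁ (Ioi t),
    preimage_inv_Ioi ht, lnorm_inv q₁ (Ioo 0 t), preimage_inv_Ioo_zero ht]
  simp

/-- This is the origin of a^#: ρ^{-θ} χ₀ = t^{-θ} χ₀^{1-θ} χ₁^θ. -/
theorem stdSpace_aSharp_eq (hr : 0 < r) (hχ₀ : RegVar 0 χ₀) (hχ₁ : RegVar 0 χ₁) (θ : ℝ)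
    {W : ℝ → ℝ} (hW : ∀ t, 0 < t → W t = rho χ₀ χ₁ t ^ (-θ) * a (rho χ₀ χ₁ t)) (f : E) :
    stdSpace A₀ A₁ θ r (aSharp χ₀ χ₁ a θ) f
      = lnorm r (Ioi 0) (fun t => W t * χ₀ t) (fun u => peetreK A₀ A₁ u f) := by
  rw [stdSpace, wnorm_eq_lnorm _ hr _ measurableSet_Ioi subset_rfl]
  refine lnorm_congr measurableSet_Ioi fun t ht => ?_
  have ht : 0 < t := ht
  have h0 := hχ₀.pos t ht
  have h1 := hχ₁.pos t ht
  congr 2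
  rw [hW t ht, aSharp]
  have e : rho χ₀ χ₁ t ^ (-θ) * χ₀ t = t ^ (-θ) * (χ₀ t ^ (1 - θ) * χ₁ t ^ θ) := by
    rw [rho, Real.div_rpow (by positivity) h1.le, Real.mul_rpow ht.le h0.le,
      Real.rpow_neg h1.le, div_inv_eq_mul, Real.rpow_sub h0, Real.rpow_one, Real.rpow_neg h0.le]
    ring
  calc t ^ (-θ) * (χ₀ t ^ (1 - θ) * χ₁ t ^ θ * a (rho χ₀ χ₁ t))
      = (t ^ (-θ) * (χ₀ t ^ (1 - θ) * χ₁ t ^ θ)) * a (rho χ₀ χ₁ t) := by ring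
    _ = _ := by rw [← e]; ring

omit [AddCommGroup E] in
theorem spaceEq_of_le {X Y : E → ℝ≥0∞} {C D : ℝ≥0∞} (hC : C ≠ ∞) (hD : D ≠ ∞)
    (h : ∀ f, Y f ≤ C * X f) (k : ∀ f, X f ≤ D * Y f) : SpaceEq X Y :=
  ⟨⟨C.toNNReal, fun f _ => by rw [ENNReal.coe_toNNReal hC]; exact h f⟩,
    ⟨D.toNNReal, fun f _ => by rw [ENNReal.coe_toNNReal hD]; exact k f⟩⟩

end

end RealInterp

/-! ### The reiteration theorem. -/

theorem theorem36 {𝕜 E : Type*} [RCLike 𝕜] [AddCommGroup E] [Module 𝕜 E]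
    [TopologicalSpace E] [IsTopologicalAddGroup E] [ContinuousSMul 𝕜 E] [T2Space E]
    (A₀ A₁ : E → ℝ≥0∞) (hA : RealInterp.IsCompatibleCouple 𝕜 A₀ A₁)
    (r r₀ q₀ r₁ q₁ : ℝ≥0∞) (hr : 0 < r) (hr₀ : 0 < r₀) (hq₀ : 0 < q₀) (hr₁ : 0 < r₁) (hq₁ : 0 < q₁)
    (a a₀ b₀ a₁ b₁ : ℝ → ℝ) (ha : RealInterp.SV a) (ha₀ : RealInterp.SV a₀)
    (hb₀ : RealInterp.SV b₀) (ha₁ : RealInterp.SV a₁) (hb₁ : RealInterp.SV b₁)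
    -- the conditions on the parameters of the second space
    (h₁ : RealInterp.wnorm 0 r₁ b₁ (Set.Ioi 1) (fun _ => 1) < ∞)
    (h₁' : RealInterp.wnorm 0 r₁ b₁ (Set.Ioo 0 1)
      (fun s => RealInterp.wnorm 0 q₁ a₁ (Set.Ioo 0 s) fun _ => 1) < ∞)
    -- the conditions on the parameters of the first space
    (h₀ : RealInterp.wnorm 0 r₀ b₀ (Set.Ioo 0 1) (fun _ => 1) < ∞)
    (h₀' : RealInterp.wnorm 0 r₀ b₀ (Set.Ioi 1)
      (fun s => RealInterp.wnorm 0 q₀ a₀ (Set.Ioi s) fun _ => 1) < ∞)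
    (χ₀ χ₁ ρ : ℝ → ℝ) (hχ₀ : χ₀ = RealInterp.chiR r₀ b₀ q₀ a₀)
    (hχ₁ : χ₁ = RealInterp.chiL r₁ b₁ q₁ a₁) (hρ : ρ = RealInterp.rho χ₀ χ₁)
    (X₀ X₁ : E → ℝ≥0∞) (hX₀ : X₀ = RealInterp.spaceR A₀ A₁ 0 r₀ b₀ q₀ a₀)
    (hX₁ : X₁ = RealInterp.spaceL A₀ A₁ 1 r₁ b₁ q₁ a₁) :
    (∀ θ : ℝ, 0 < θ → θ < 1 →
      RealInterp.SpaceEq (RealInterp.stdSpace X₀ X₁ θ r a)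
        (RealInterp.stdSpace A₀ A₁ θ r (RealInterp.aSharp χ₀ χ₁ a θ))) ∧
    (RealInterp.wnorm 0 r a (Set.Ioi 1) (fun _ => 1) < ∞ →
      RealInterp.SpaceEq (RealInterp.stdSpace X₀ X₁ 0 r a)
        (RealInterp.interSpace
          (RealInterp.stdSpace A₀ A₁ 0 r (RealInterp.aSharp χ₀ χ₁ a 0))
          (RealInterp.spaceRL A₀ A₁ 0 r (a ∘ ρ) r₀ b₀ q₀ a₀))) ∧
    (RealInterp.wnorm 0 r a (Set.Ioo 0 1) (fun _ => 1) < ∞ →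
      RealInterp.SpaceEq (RealInterp.stdSpace X₀ X₁ 1 r a)
        (RealInterp.interSpace
          (RealInterp.stdSpace A₀ A₁ 1 r (RealInterp.aSharp χ₀ χ₁ a 1))
          (RealInterp.spaceLR A₀ A₁ 1 r (a ∘ ρ) r₁ b₁ q₁ a₁))) := by
  open RealInterp Set in
  have hN₀ := hA.left.isQuasiNorm
  have hN₁ := hA.right.isQuasiNorm
  have P₀ : RParams r₀ b₀ q₀ a₀ := by
    refine ⟨hr₀, hq₀, hb₀.regVar, ha₀.regVar, ?_, ?_⟩
    · rw [wnorm_eq_lnorm _ hr₀ _ measurableSet_Ioo (fun u hu => hu.1)] at h₀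
      simpa using h₀
    · refine lt_of_eq_of_lt ?_ h₀'
      rw [wnorm_eq_lnorm _ hr₀ _ measurableSet_Ioi (Ioi_subset_Ioi zero_le_one)]
      refine lnorm_congr measurableSet_Ioi fun s hs => ?_
      rw [wnorm_eq_lnorm _ hq₀ _ measurableSet_Ioi (Ioi_subset_Ioi (zero_lt_one.trans hs).le)]
      simp
  have P₁ : RParams r₁ (fun u => b₁ u⁻¹) q₁ (fun u => a₁ u⁻¹) := by
    refine ⟨hr₁, hq₁, by simpa using hb₁.regVar.comp_inv, by simpa using ha₁.regVar.comp_inv, ?_, ?_⟩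
    · rw [wnorm_eq_lnorm _ hr₁ _ measurableSet_Ioi (Ioi_subset_Ioi zero_le_one), lnorm_inv,
        preimage_inv_Ioi one_pos] at h₁
      simpa using h₁
    · rw [wnorm_Ioo_wnorm_Ioo hr₁ hq₁ one_pos] at h₁'
      simpa using h₁'
  have e₀ : ∀ t, 0 < t → χ₀ t = (weightR r₀ b₀ q₀ a₀ t).toReal := fun t ht =>
    hχ₀ ▸ chiR_eq hr₀ hq₀ ht
  have e₁ : ∀ t, 0 < t → χ₁ t = (weightR r₁ (fun u => b₁ u⁻¹) q₁ (fun u => a₁ u⁻¹) t⁻¹).toReal :=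
    fun t ht => hχ₁ ▸ chiL_eq hr₁ hq₁ ht
  have f₀ : ∀ f, X₀ f = normR r₀ b₀ q₀ a₀ (fun u => peetreK A₀ A₁ u f) := fun f =>
    hX₀ ▸ spaceR_eq_normR hr₀ hq₀ f
  have f₁ : ∀ f, X₁ f = normR r₁ (fun u => b₁ u⁻¹) q₁ (fun u => a₁ u⁻¹)
      (fun u => peetreK A₁ A₀ u f) := fun f => hX₁ ▸ spaceL_eq_normR hr₁ hq₁ ha₁.regVar f
  have g₀ : RegVar 0 χ₀ := P₀.regVar_weightR.congr e₀
  have g₁ : RegVar 0 χ₁ := by simpa using P₁.regVar_weightR.comp_inv.congr e₁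
  have gρ := regVar_rho g₀ g₁
  refine ⟨fun θ hθ hθ' => ?_, fun _ => ?_, fun _ => ?_⟩
  · have hW := regVar_rpow_mul_comp gρ ha.regVar hθ.le
    obtain ⟨C, hC, k⟩ := reiteration P₀ P₁ hN₀ hN₁ hr ha.regVar e₀ e₁ f₀ f₁ hθ.le
      (W := fun t => rho χ₀ χ₁ t ^ (-θ) * a (rho χ₀ χ₁ t)) (fun t _ => rfl)
    obtain ⟨D₀, hD₀, l₀⟩ := lnorm_partR_peetreK_le (A₀ := A₀) (A₁ := A₁) P₀ hr e₀ hθ hW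
    obtain ⟨D₁, hD₁, l₁⟩ := lnorm_partR_inv_le (A₀ := A₀) (A₁ := A₁) P₁ hr e₁ g₀ hθ' hW
    refine spaceEq_of_le (C := C) (D := C * (D₀ + 1 + D₁)) hC (by finiteness) (fun f => ?_)
      (fun f => ?_)
    · rw [stdSpace_aSharp_eq hr g₀ g₁ θ (fun t _ => rfl)]
      exact (k f).2.2.1
    · rw [stdSpace_aSharp_eq hr g₀ g₁ θ (fun t _ => rfl)]
      refine (k f).1.trans ?_
      rw [mul_assoc, add_mul, add_mul, one_mul]
      gcongr
      · exact l₀ f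
      · exact l₁ f
  -- At θ = 0 the weight W is a ∘ ρ itself, so the first of the three norms is the R,L-norm.
  · have hWeq : ∀ t, 0 < t → (a ∘ ρ) t = rho χ₀ χ₁ t ^ (-0 : ℝ) * a (rho χ₀ χ₁ t) := by
      intro t _
      simp [hρ]
    have hW : RegVar (-0) (a ∘ ρ) :=
      (regVar_rpow_mul_comp gρ ha.regVar le_rfl).congr hWeq
    obtain ⟨C, hC, k⟩ := reiteration P₀ P₁ hN₀ hN₁ hr ha.regVar e₀ e₁ f₀ f₁ le_rfl hWeq
    obtain ⟨D₁, hD₁, l₁⟩ := lnorm_partR_inv_le (A₀ := A₀) (A₁ := A₁) P₁ hr e₁ g₀ one_pos hW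
    refine spaceEq_of_le (C := C) (D := C * (1 + 1 + D₁)) hC (by finiteness) (fun f => ?_)
      (fun f => ?_)
    · rw [interSpace, stdSpace_aSharp_eq hr g₀ g₁ 0 hWeq, spaceRL_eq_lnorm hr hr₀ hq₀]
      exact max_le (k f).2.2.1 (k f).2.1
    · rw [interSpace, stdSpace_aSharp_eq hr g₀ g₁ 0 hWeq, spaceRL_eq_lnorm hr hr₀ hq₀]
      refine (k f).1.trans ?_
      rw [mul_assoc, add_mul, add_mul, one_mul]
      gcongr
      · exact le_max_right _ _
      · exact le_max_left _ _
      · exact (l₁ f).trans (by gcongr; exact le_max_left _ _)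
  · have hWeq : ∀ t, 0 < t → rho χ₀ χ₁ t ^ (-1 : ℝ) * a (rho χ₀ χ₁ t)
        = rho χ₀ χ₁ t ^ (-1 : ℝ) * a (rho χ₀ χ₁ t) := fun t _ => rfl
    have hW := regVar_rpow_mul_comp gρ ha.regVar zero_le_one
    obtain ⟨C, hC, k⟩ := reiteration P₀ P₁ hN₀ hN₁ hr ha.regVar e₀ e₁ f₀ f₁ zero_le_one
      (W := fun t => rho χ₀ χ₁ t ^ (-1 : ℝ) * a (rho χ₀ χ₁ t)) hWeq
    obtain ⟨D₀, hD₀, l₀⟩ := lnorm_partR_peetreK_le (A₀ := A₀) (A₁ := A₁) P₀ hr e₀ one_pos hW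
    -- At θ = 1 the factor ρ of the third term cancels ρ^{-1} in W, which leaves the weight a ∘ ρ of
    -- the L,R-norm.
    have hLR : ∀ f, spaceLR A₀ A₁ 1 r (a ∘ ρ) r₁ b₁ q₁ a₁ f
        = lnorm r (Ioi 0) (fun t => rho χ₀ χ₁ t ^ (-1 : ℝ) * a (rho χ₀ χ₁ t) * rho χ₀ χ₁ t)
          (fun t => partR r₁ (fun u => b₁ u⁻¹) q₁ (fun u => a₁ u⁻¹) t⁻¹
            fun u => peetreK A₁ A₀ u f) := by
      intro f
      rw [spaceLR_eq_lnorm hr hr₁ hq₁ ha₁.regVar]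
      refine lnorm_congr measurableSet_Ioi fun t ht => ?_
      have := gρ.pos t ht
      rw [Function.comp_apply, hρ, Real.rpow_neg_one, mul_right_comm, inv_mul_cancel₀ this.ne',
        one_mul]
    refine spaceEq_of_le (C := C) (D := C * (D₀ + 1 + 1)) hC (by finiteness) (fun f => ?_)
      (fun f => ?_)
    · rw [interSpace, stdSpace_aSharp_eq hr g₀ g₁ 1 hWeq, hLR]
      exact max_le (k f).2.2.1 (k f).2.2.2
    · rw [interSpace, stdSpace_aSharp_eq hr g₀ g₁ 1 hWeq, hLR]
      refine (k f).1.trans ?_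
      rw [mul_assoc, add_mul, add_mul, one_mul]
      gcongr
      · exact (l₀ f).trans (by gcongr; exact le_max_left _ _)
      · exact le_max_left _ _
      · exact le_max_right _ _
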